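/- Let $(V,\omega)$ be a complex symplectic vector space of dimension $4$, let $\mathfrak{sp}(V)\subset\operatorname{End}(V)$ be its symplectic Lie algebra (of dimension $10$), and let $$Z=\{B\in\mathfrak{sp}(V) : B^2=0\},$$ a closed subvariety of $\mathfrak{sp}(V)$. Let $I_0\subset\mathbb{C}[\mathfrak{sp}(V)]$ be the ideal of polynomial functions vanishing on $Z$ and $\mathcal{O}_Z=\mathbb{C}[\mathfrak{sp}(V)]/I_0$. With linear coordinates $x_1,\dots,x_{10}$ on $\mathfrak{sp}(V)$, let $$T^1_Z=\operatorname{coker}\Bigl(\Theta\colon \bigoplus_{i=1}^{10}\mathcal{O}_Z\,\partial_{x_i}\longrightarrow \operatorname{Hom}_{\mathcal{O}_Z}(I_0/I_0^2,\mathcal{O}_Z)\Bigr),\qquad \Theta(\partial_{x_i})([f])=\partial_{x_i}f \bmod I_0 ,$$ be the module of first-order deformations of $Z$. Then: 1. The $\mathcal{O}_Z$-module $T^1_Z$ is pure of dimension $4$: it has dimension $4$, and every nonzero submodule of $T^1_Z$ has dimension $4$ (the dimension of a module is the Krull dimension of its support). 2. In particular, $T^1_Z$ has no nonzero submodule supported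 at the origin $0\in Z$. 3. Consequently, an infinitesimal deformation of $Z$ that does not change the singularities of $Z$ away from $0$ does not deform the singularity at $0$ either. Precisely: let $A$ be a local Artinian $\mathbb{C}$-algebra with residue field $\mathbb{C}$, and let $\mathcal{Z}=\operatorname{Spec}\mathcal{B}\to\operatorname{Spec}A$ be a flat deformation of $Z$, with a given identification $\mathcal{B}/\mathfrak{m}_A\mathcal{B}\cong\mathcal{O}_Z$ of $\mathbb{C}$-algebras. If every point of $Z\setminus\{0\}$ has a principal open neighbourhood over which $\mathcal{Z}$ is isomorphic, as a deformation, to the trivial one, then $\mathcal{Z}$ is isomorphic, as a deformation, to the trivial deformation $Z\times\operatorname{Spec}A$. (An isomorphism of deformations is one over $A$ that induces the identity on the special fibre.) -/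

import Mathlib

open scoped TensorProduct

noncomputable section

/-! ### The module `T¹` of an affine scheme embedded in affine space -/

section TangentCohomology

variable {k σ : Type*} [Field k] [Fintype σ] (I : Ideal (MvPolynomial σ k))

/-- For a vector field `∑ aᵢ ∂ᵢ` with coefficients `aᵢ` in `𝒪 = k[x]/I`, the `k[x]`-linear map
`I/I² → 𝒪`, `[f] ↦ ∑ aᵢ ∂ᵢ f`. -/
def vectorFieldMap (a : σ → MvPolynomial σ k ⧸ I) :
    I.Cotangent →ₗ[MvPolynomial σ k] MvPolynomial σ k ⧸ I :=
  (I • ⊤ : Submodule (MvPolynomial σ k) I).liftQ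
    { toFun := fun f => ∑ i, a i * Ideal.Quotient.mk I (MvPolynomial.pderiv i (f : MvPolynomial σ k))
      map_add' := fun f g => by simp [mul_add, Finset.sum_add_distrib]
      map_smul' := fun r f => by
        have hf : Ideal.Quotient.mk I (f : MvPolynomial σ k) = 0 :=
          Ideal.Quotient.eq_zero_iff_mem.2 f.2
        simp only [Submodule.coe_smul, smul_eq_mul, Derivation.leibniz, map_add, map_mul, hf,
          zero_mul, add_zero, RingHom.id_apply,
          show ∀ x : MvPolynomial σ k ⧸ I, r • x = Ideal.Quotient.mk I r * x from
            fun x => Algebra.smul_def r x, Finset.mul_sum]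
        exact Finset.sum_congr rfl fun i _ => by ring }
    (by
      rw [Submodule.smul_le]
      intro r hr f _
      have hr' : Ideal.Quotient.mk I r = 0 := Ideal.Quotient.eq_zero_iff_mem.2 hr
      rw [LinearMap.mem_ker, map_smul]
      exact (Algebra.smul_def r (_ : MvPolynomial σ k ⧸ I)).trans
        (by rw [Ideal.Quotient.algebraMap_eq, hr', zero_mul]))

/-- The map `Θ : ⨁ 𝒪 ∂ᵢ → Hom_𝒪(I/I², 𝒪)`, `∂ᵢ ↦ ([f] ↦ ∂ᵢ f)`, where `𝒪 = k[x]/I`. -/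
def tangentToNormal :
    (σ → MvPolynomial σ k ⧸ I) →ₗ[MvPolynomial σ k ⧸ I]
      (I.Cotangent →ₗ[MvPolynomial σ k ⧸ I] MvPolynomial σ k ⧸ I) where
  toFun a := (vectorFieldMap I a).extendScalarsOfSurjective Ideal.Quotient.mk_surjective
  map_add' a b := by
    ext f
    obtain ⟨f, rfl⟩ := I.toCotangent_surjective f
    change ∑ i, (a i + b i) * _ = ∑ i, a i * _ + ∑ i, b i * _
    simp [add_mul, Finset.sum_add_distrib]
  map_smul' r a := by
    ext f
    obtain ⟨f, rfl⟩ := I.toCotangent_surjective f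
    change ∑ i, (r * a i) * _ = r * ∑ i, a i * _
    simp [Finset.mul_sum, mul_assoc]

/-- `Θ(∑ aᵢ ∂ᵢ)([f]) = ∑ aᵢ ∂ᵢ f`. -/
theorem tangentToNormal_apply (a : σ → MvPolynomial σ k ⧸ I) (f : I) :
    tangentToNormal I a (I.toCotangent f) =
      ∑ i, a i * Ideal.Quotient.mk I (MvPolynomial.pderiv i (f : MvPolynomial σ k)) := rfl

/-- `T¹ = coker Θ`, a module over `𝒪 = k[x]/I`. -/
abbrev TangentOne : Type _ :=
  (I.Cotangent →ₗ[MvPolynomial σ k ⧸ I] MvPolynomial σ k ⧸ I) ⧸ LinearMap.range (tangentToNormal I)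

end TangentCohomology

/-- A module is pure of dimension `d` if it has dimension `d` and so has each of its nonzero
submodules, where the dimension of a module is the Krull dimension of its support. -/
def IsPureOfDim (R M : Type*) [CommRing R] [AddCommGroup M] [Module R M] (d : ℕ) : Prop :=
  Module.supportDim R M = d ∧
    ∀ N : Submodule R M, N ≠ ⊥ → Module.supportDim R N = d

/-! ### Deformations over local Artinian bases -/

section Deformation

variable {k : Type*} (A : Type*) {B S : Type*} [Field k]
  [CommRing A] [Algebra k A]
  [CommRing B] [Algebra k B] [Algebra A B] [IsScalarTower k A B]
  [CommRing S] [Algebra k S]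

/-- For a local `k`-algebra `A` with residue field `k`: `π : B → S` makes the `A`-algebra `B` a
deformation of `Spec S` over `Spec A`, that is, `B` is flat over `A` and `π` identifies the special
fibre `B/𝔪_A B` with `S`. -/
structure IsDeformation [IsLocalRing A] (π : B →ₐ[k] S) : Prop where
  flat : Module.Flat A B
  surjective : Function.Surjective π
  ker_eq : RingHom.ker π = (IsLocalRing.maximalIdeal A).map (algebraMap A B)

/-- The deformation is isomorphic to the product deformation `A ⊗ S`, by an isomorphism of
`A`-algebras that induces the identity of `S` on the special fibre. -/
def IsTrivialDeformation (π : B →ₐ[k] S) : Prop :=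
  ∃ e : (A ⊗[k] S) ≃ₐ[A] B, ∀ s : S, π (e (1 ⊗ₜ[k] s)) = s

/-- The deformation is locally trivial away from the closed subset `V(𝔞)` of `Spec S`: every point
outside `V(𝔞)` has a principal open neighbourhood `D(π g)`, `g ∈ B`, over which the deformation
is trivial. -/
def IsLocallyTrivialAwayFrom (π : B →ₐ[k] S) (𝔞 : Ideal S) : Prop :=
  ∀ p : PrimeSpectrum S, p ∉ PrimeSpectrum.zeroLocus (𝔞 : Set S) →
    ∃ g : B, π g ∉ p.asIdeal ∧ IsTrivialDeformation A (Localization.awayMapₐ π g)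

end Deformation

/-! ### The variety `{B ∈ 𝔰𝔭(V) | B² = 0}` -/

section SquareZero

variable {V ι : Type*} [AddCommGroup V] [Module ℂ V] [Fintype ι] {ω : LinearMap.BilinForm ℂ V}
  (b : Module.Basis ι ℂ (skewAdjointLieSubalgebra ω))

/-- `Z = {B ∈ 𝔰𝔭(V, ω) | B² = 0}`, as a set of coordinate vectors with respect to the basis `b` of
`𝔰𝔭(V, ω)`. -/
def squareZeroLocus : Set (ι → ℂ) :=
  {x | ((b.equivFun.symm x : skewAdjointLieSubalgebra ω) : Module.End ℂ V) ^ 2 = 0}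

/-- The ideal of `Z` in the ring `ℂ[𝔰𝔭(V)]` of polynomial functions. -/
def squareZeroIdeal : Ideal (MvPolynomial ι ℂ) :=
  MvPolynomial.vanishingIdeal ℂ (squareZeroLocus b)

/-- The coordinate ring `𝒪_Z`. -/
abbrev SquareZeroRing : Type _ := MvPolynomial ι ℂ ⧸ squareZeroIdeal b

/-- The ideal of `𝒪_Z` generated by the linear coordinates of `𝔰𝔭(V)`: the maximal ideal of the
origin `0 ∈ Z`. -/
def originIdeal : Ideal (SquareZeroRing b) :=
  Ideal.span (Set.range fun i => Ideal.Quotient.mk (squareZeroIdeal b) (MvPolynomial.X i))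

end SquareZero

end

/-!
Choose a symplectic basis of `V`, with matrix `J`. Sending `A ∈ 𝔰𝔭(V)` to the matrix `B` of the
quadratic form `ω(A x, x)` identifies `𝔰𝔭(V)` with the symmetric `4 × 4` matrices and `Z` with
those for which `B J B = 0`, namely the matrices `B = u vᵀ + v uᵀ` with `ω(u, v) = 0`. Hence `𝒪_Z`
embeds into the coordinate ring `R = PairRing` of the hypersurface `ω(u, v) = 0`
(`isPairPresentation_squareZeroIdeal`), as the invariants of the orthogonal group that is generated
by the torus `(u, v) ↦ (t u, t⁻¹ v)` and the exchange of `u` and `v`. The ideal of `Z` is generated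
by the entries of `B J B` (`aeval_eq_zero_of_aeval_pairSym`): over an arbitrary ring, a symmetric
matrix with `B J B = 0` acts, along with operators `u i * v j` that satisfy the Segre relations, on
a module that has an element with trivial annihilator.

A homomorphism `I/I² → 𝒪_Z` is determined by the skew matrix `H` of the images of the entries of
`B J B`, and the syzygy `(B J B) J B = B J (B J B)` gives `H J B = B J H`. Evaluating at `J u` and
`J v` over the domain `R`, dividing by the bivector `u ∧ v` (`PairRing.wedge_dvd`), and sorting by
weights under the torus shows that `H` is the sum of a tangent part `X J B + B J X` and a multiple
of `J` (`exists_eq_polar_add`). There is a homomorphism `φ` with `H = J`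
(`exists_normalMatrix_eq_sympMatrix`), and `s φ` is tangent if and only if `s` vanishes on the
matrices of rank one (`smul_mem_range_iff`): the products `(u ∧ v)ᵢⱼ (u ∧ v)ₖₗ`, which up to sign
are the `2 × 2` minors of `B`, carry `J` into the tangent part by a Clifford identity
(`exists_polar_eq_wedge_mul_wedge`), and conversely a tangent `c J` has rank at most two on the
matrices of rank one. So `T¹` is isomorphic to the coordinate ring of the cone of matrices of rank
one, a domain of dimension `4`: all its nonzero submodules have the same support, of dimension `4`,
which is not the origin.

For the last part, trivializations are lifted along small extensions of the base, by induction over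
the ideals of `A` (`Ideal.small_extension_induction`). A trivialization modulo an ideal is given by
a homomorphism `θ` from the polynomial ring to `B` that carries `I` into the extension of the
ideal. The obstruction to the next step is a homomorphism `h : I/I² → 𝒪_Z`, which only matters
modulo tangent vector fields (`IsDeformation.exists_obstruction`, `IsDeformation.exists_lift`).
Where the deformation is trivial, the trivialization at hand differs from the given one by an
automorphism of the trivial deformation; such automorphisms lift, being composed of exponentials of
derivations, so that `h` is tangent there (`IsDeformation.exists_lift_of_tensorProduct`,
`IsDeformation.exists_pow_smul_mem_range`). The class of `h` in `T¹` thus spans a submodule that is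
supported at the origin, and it vanishes.
-/

noncomputable section

/-! ### Kernels of monomial maps -/

section Toric

open MvPolynomial

theorem aeval_monomial_toFinsupp {k σ E : Type*} [CommSemiring k] [DecidableEq σ] [CommSemiring E]
    [Algebra k E] (z : σ → E) (s : Multiset σ) :
    aeval z (monomial (Multiset.toFinsupp s) (1 : k)) = (s.map z).prod := by
  rw [aeval_monomial, map_one, one_mul]
  induction s using Multiset.induction_on with
  | empty => simp
  | cons i s ih =>
    rw [Multiset.map_cons, Multiset.prod_cons, ← ih, ← Multiset.singleton_add,
      Multiset.toFinsupp_add, Finsupp.prod_add_index' (by simp) (by intros; rw [pow_add])]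
    simp [Multiset.toFinsupp_singleton]

/-- If the elements `z i` of an algebra satisfy all the multiplicative relations that hold between
the monomials `X ^ a i`, then they satisfy all the polynomial relations between them. -/
theorem aeval_eq_zero_of_aeval_monomial_eq_zero {k σ τ E : Type*} [Field k] [CommRing E]
    [Algebra k E] (a : σ → τ →₀ ℕ) (z : σ → E)
    (h : ∀ s t : Multiset σ, (s.map a).sum = (t.map a).sum → (s.map z).prod = (t.map z).prod)
    (f : MvPolynomial σ k)
    (hf : aeval (fun i => (monomial (a i) (1 : k) : MvPolynomial τ k)) f = 0) :
    aeval z f = 0 := by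
  classical
  let A : Multiset σ → (τ →₀ ℕ) := fun s => (s.map a).sum
  let g : (τ →₀ ℕ) → E := fun e =>
    if he : ∃ s : Multiset σ, A s = e then (he.choose.map z).prod else 0
  have hg : ∀ s : Multiset σ, g (A s) = (s.map z).prod := by
    intro s
    have he : ∃ s' : Multiset σ, A s' = A s := ⟨s, rfl⟩
    simp only [g, dif_pos he]
    exact h _ _ he.choose_spec
  let Ψ : MvPolynomial τ k →ₗ[k] E := (basisMonomials τ k).constr k g
  have hΨ : ∀ e, Ψ (monomial e 1) = g e := fun e => by
    have := (basisMonomials τ k).constr_basis k g e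
    rwa [coe_basisMonomials] at this
  have key : Ψ ∘ₗ (aeval (fun i => (monomial (a i) (1 : k) : MvPolynomial τ k))).toLinearMap
      = (aeval z).toLinearMap := by
    refine (basisMonomials σ k).ext fun d => ?_
    obtain ⟨s, rfl⟩ : ∃ s : Multiset σ, d = Multiset.toFinsupp s :=
      ⟨Finsupp.toMultiset d, by simp⟩
    have hprod : (s.map fun i => (monomial (a i) (1 : k) : MvPolynomial τ k)).prod
        = monomial (A s) 1 := by
      simp only [A]
      induction s using Multiset.induction_on with
      | empty => simp
      | cons i s ih =>
        rw [Multiset.map_cons, Multiset.prod_cons, ih, monomial_mul, Multiset.map_cons,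
          Multiset.sum_cons, one_mul]
    simp only [LinearMap.comp_apply, AlgHom.toLinearMap_apply, coe_basisMonomials]
    rw [aeval_monomial_toFinsupp, aeval_monomial_toFinsupp, hprod, hΨ, hg]
  have := LinearMap.congr_fun key f
  simp only [LinearMap.comp_apply, AlgHom.toLinearMap_apply, hf, map_zero] at this
  exact this.symm

/-- The exponent of the monomial `u_{p,i} v_{p,j}`. -/
def segreExponent {P I K : Type*} (x : P × I × K) : (P × I) ⊕ (P × K) →₀ ℕ :=
  Finsupp.single (Sum.inl (x.1, x.2.1)) 1 + Finsupp.single (Sum.inr (x.1, x.2.2)) 1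

/-- Elements satisfying the `2 × 2` minors of a family of generic matrices satisfy every
multiplicative relation between the monomials `u_{p,i} v_{p,j}`. -/
theorem prod_eq_of_segre {P I K E : Type*} [CommMonoid E] (z : P × I × K → E)
    (hz : ∀ p i j k l, z (p, i, j) * z (p, k, l) = z (p, i, l) * z (p, k, j))
    (s t : Multiset (P × I × K))
    (h : (s.map segreExponent).sum = (t.map segreExponent).sum) :
    (s.map z).prod = (t.map z).prod := by
  classical
  have mem : ∀ (t : Multiset (P × I × K)) (x), (t.map segreExponent).sum x ≠ 0 →
      ∃ b ∈ t, segreExponent b x ≠ 0 := by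
    intro t x hx
    induction t using Multiset.induction_on with
    | empty => simp at hx
    | cons b t ih =>
      by_cases hb : segreExponent b x = 0
      · rw [Multiset.map_cons, Multiset.sum_cons, Finsupp.add_apply, hb, zero_add] at hx
        obtain ⟨c, hc, hcx⟩ := ih hx
        exact ⟨c, Multiset.mem_cons_of_mem hc, hcx⟩
      · exact ⟨b, Multiset.mem_cons_self _ _, hb⟩
  induction s using Multiset.induction_on generalizing t with
  | empty =>
    induction t using Multiset.induction_on with
    | empty => rfl
    | cons b t _ =>
      exfalso
      have := DFunLike.congr_fun h (Sum.inl (b.1, b.2.1))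
      simp only [Multiset.map_zero, Multiset.sum_zero, Finsupp.coe_zero, Pi.zero_apply,
        Multiset.map_cons, Multiset.sum_cons, segreExponent, Finsupp.add_apply,
        Finsupp.single_eq_same] at this
      omega
  | cons x s ih =>
    obtain ⟨p, i, j⟩ := x
    obtain ⟨b, hb, hbi⟩ := mem t (Sum.inl (p, i)) (by
      rw [← h]; simp [segreExponent])
    obtain ⟨c, hc, hcj⟩ := mem t (Sum.inr (p, j)) (by
      rw [← h]; simp [segreExponent])
    obtain ⟨p', i', l⟩ := b
    obtain ⟨p'', k, j'⟩ := c
    obtain ⟨rfl, rfl⟩ : p' = p ∧ i' = i := by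
      by_contra hne
      apply hbi
      simp only [segreExponent, Finsupp.add_apply, Finsupp.single_apply]
      rw [if_neg (by simpa using hne)]; simp
    obtain ⟨rfl, rfl⟩ : p'' = p' ∧ j' = j := by
      by_contra hne
      apply hcj
      simp only [segreExponent, Finsupp.add_apply, Finsupp.single_apply]
      rw [if_neg (by simp), if_neg (by simpa using hne), add_zero]
    obtain ⟨t, rfl⟩ := Multiset.exists_cons_of_mem hb
    rw [Multiset.map_cons, Multiset.sum_cons] at h
    rw [Multiset.map_cons, Multiset.prod_cons]
    by_cases hlj : l = j'
    · subst hlj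
      rw [Multiset.map_cons, Multiset.sum_cons, add_right_inj] at h
      rw [Multiset.map_cons, Multiset.prod_cons, ih t h]
    · have hc' : (p'', k, j') ∈ t := by
        rcases Multiset.mem_cons.1 hc with h1 | h1
        · simp only [Prod.mk.injEq] at h1
          exact absurd h1.2.2.symm hlj
        · exact h1
      obtain ⟨t, rfl⟩ := Multiset.exists_cons_of_mem hc'
      have key := ih ((p'', k, l) ::ₘ t) (by
        rw [Multiset.map_cons, Multiset.sum_cons]
        simp only [Multiset.map_cons, Multiset.sum_cons] at h
        apply add_left_cancel (a := segreExponent (p'', i', j'))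
        rw [h]
        simp only [segreExponent]
        abel)
      rw [key]
      simp only [Multiset.map_cons, Multiset.prod_cons]
      rw [← mul_assoc, ← mul_assoc, hz]

/-- The exponent of the monomial `x_i x_j`. -/
def veroneseExponent {I : Type*} : Sym2 I → I →₀ ℕ :=
  Sym2.lift ⟨fun i j => Finsupp.single i 1 + Finsupp.single j 1, fun _ _ => add_comm _ _⟩

theorem veroneseExponent_mk {I : Type*} (i j : I) :
    veroneseExponent s(i, j) = Finsupp.single i 1 + Finsupp.single j 1 := rfl

/-- Elements satisfying the `2 × 2` minors of the generic symmetric matrix satisfy every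
multiplicative relation between the monomials `x_i x_j`. -/
theorem prod_eq_of_veronese {I E : Type*} [CommMonoid E] (z : Sym2 I → E)
    (hz : ∀ i j k l, z s(i, j) * z s(k, l) = z s(i, l) * z s(k, j))
    (s t : Multiset (Sym2 I))
    (h : (s.map veroneseExponent).sum = (t.map veroneseExponent).sum) :
    (s.map z).prod = (t.map z).prod := by
  classical
  have mem : ∀ (t : Multiset (Sym2 I)) (x), (t.map veroneseExponent).sum x ≠ 0 →
      ∃ l, s(x, l) ∈ t := by
    intro t x hx
    induction t using Multiset.induction_on with
    | empty => simp at hx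
    | cons b t ih =>
      by_cases hb : veroneseExponent b x = 0
      · rw [Multiset.map_cons, Multiset.sum_cons, Finsupp.add_apply, hb, zero_add] at hx
        obtain ⟨c, hc⟩ := ih hx
        exact ⟨c, Multiset.mem_cons_of_mem hc⟩
      · have : x ∈ b := by
          induction b with
          | _ i j =>
            rw [Sym2.mem_iff]
            by_contra hne
            push Not at hne
            apply hb
            simp [veroneseExponent_mk, hne.1.symm, hne.2.symm]
        obtain ⟨l, rfl⟩ := this
        exact ⟨l, Multiset.mem_cons_self _ _⟩
  induction s using Multiset.induction_on generalizing t with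
  | empty =>
    induction t using Multiset.induction_on with
    | empty => rfl
    | cons b t _ =>
      exfalso
      induction b with
      | _ i j =>
        have := DFunLike.congr_fun h i
        simp only [Multiset.map_zero, Multiset.sum_zero, Finsupp.coe_zero, Pi.zero_apply,
          Multiset.map_cons, Multiset.sum_cons, veroneseExponent_mk, Finsupp.add_apply,
          Finsupp.single_eq_same] at this
        omega
  | cons x s ih =>
    induction x with
    | _ i j =>
    obtain ⟨l, hb⟩ := mem t i (by rw [← h]; simp [veroneseExponent_mk])
    obtain ⟨t, rfl⟩ := Multiset.exists_cons_of_mem hb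
    rw [Multiset.map_cons, Multiset.sum_cons, Multiset.map_cons, Multiset.sum_cons] at h
    rw [Multiset.map_cons, Multiset.prod_cons]
    by_cases hlj : l = j
    · subst hlj
      rw [add_right_inj] at h
      rw [Multiset.map_cons, Multiset.prod_cons, ih t h]
    · rw [veroneseExponent_mk, veroneseExponent_mk, add_assoc, add_assoc, add_right_inj] at h
      obtain ⟨k, hc⟩ := mem t j (by
        have := DFunLike.congr_fun h j
        simp [hlj] at this
        omega)
      obtain ⟨t, rfl⟩ := Multiset.exists_cons_of_mem hc
      have key := ih (s(k, l) ::ₘ t) (by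
        simp only [Multiset.map_cons, Multiset.sum_cons, veroneseExponent_mk] at h ⊢
        apply add_left_cancel (a := Finsupp.single j 1)
        rw [h]
        abel)
      rw [key]
      simp only [Multiset.map_cons, Multiset.prod_cons]
      rw [← mul_assoc, ← mul_assoc, hz, Sym2.eq_swap (a := j) (b := k)]

end Toric

/-! ### Symmetric matrices with `B J B = 0` -/

section SquareZeroMatrix

variable {Q : Type*} [CommRing Q]

/-- The entry `(i, j)` of `B J Bᵀ`, where `J` is the standard symplectic form in dimension `4`,
`J₀₁ = J₂₃ = 1`. -/
def sqEntry (B : Fin 4 → Fin 4 → Q) (i j : Fin 4) : Q :=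
  B i 0 * B j 1 - B i 1 * B j 0 + B i 2 * B j 3 - B i 3 * B j 2

/-- The `2 × 2` minor of `B` with rows `i, j` and columns `k, l`. -/
def minorTwo (B : Fin 4 → Fin 4 → Q) (i j k l : Fin 4) : Q := B i k * B j l - B i l * B j k

/-- The `3 × 3` minor of `B` with rows `a, b, c` and columns `j, l, q`. -/
def minorThree (B : Fin 4 → Fin 4 → Q) (a b c j l q : Fin 4) : Q :=
  B a j * (B b l * B c q - B b q * B c l) - B a l * (B b j * B c q - B b q * B c j)
    + B a q * (B b j * B c l - B b l * B c j)

set_option maxHeartbeats 1000000 in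
/-- Three of the four indices contain exactly one of the two hyperbolic pairs `{0, 1}`, `{2, 3}`,
so that the `3 × 3` minors are combinations of the entries of `B J Bᵀ`. -/
theorem minorThree_eq_zero {B : Fin 4 → Fin 4 → Q} (hF : ∀ i j, sqEntry B i j = 0)
    (a b c j l q : Fin 4) : minorThree B a b c j l q = 0 := by
  have key : ∀ q, sqEntry B a b * B c q + sqEntry B b c * B a q + sqEntry B c a * B b q = 0 :=
    fun q => by rw [hF, hF, hF]; ring
  simp only [sqEntry] at key
  simp only [minorThree]
  fin_cases j <;> fin_cases l <;> fin_cases q <;>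
    simp only [Fin.zero_eta, Fin.mk_one, Fin.reduceFinMk] <;>
    first
    | ring1
    | linear_combination key 0
    | linear_combination -key 0
    | linear_combination key 1
    | linear_combination -key 1
    | linear_combination key 2
    | linear_combination -key 2
    | linear_combination key 3
    | linear_combination -key 3

/-- For a symmetric matrix `B` with `B J B = 0`, the module of skew matrices `ℓ` that satisfy the
relations linear in `ℓ` holding for `B = u vᵀ + v uᵀ` and `ℓ = u vᵀ - v uᵀ`. -/
def oddModule (B : Fin 4 → Fin 4 → Q) : Submodule Q (Fin 4 → Fin 4 → Q) where
  carrier := {ℓ | (∀ i j, ℓ i j = -ℓ j i) ∧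
    (∀ i j k l, B i j * ℓ k l + ℓ i j * B k l = B i l * ℓ k j + ℓ i l * B k j) ∧
    ℓ 0 1 + ℓ 2 3 = 0}
  zero_mem' := by simp
  add_mem' := by
    rintro x y ⟨h1, h2, h3⟩ ⟨h1', h2', h3'⟩
    refine ⟨fun i j => ?_, fun i j k l => ?_, ?_⟩ <;> simp only [Pi.add_apply]
    · rw [h1 i j, h1' i j]; ring
    · linear_combination h2 i j k l + h2' i j k l
    · linear_combination h3 + h3'
  smul_mem' := by
    rintro c x ⟨h1, h2, h3⟩
    refine ⟨fun i j => ?_, fun i j k l => ?_, ?_⟩ <;> simp only [Pi.smul_apply, smul_eq_mul]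
    · rw [h1 i j]; ring
    · linear_combination c * h2 i j k l
    · linear_combination c * h3

variable {B : Fin 4 → Fin 4 → Q}

theorem minorTwo_symm (hB : ∀ i j, B i j = B j i) (i j k l : Fin 4) :
    minorTwo B i j k l = minorTwo B k l i j := by
  simp only [minorTwo]
  rw [hB i k, hB j l, hB i l, hB j k]
  ring

theorem neg_minorTwo_mem_oddModule (hB : ∀ i j, B i j = B j i) (hF : ∀ i j, sqEntry B i j = 0)
    (i j : Fin 4) : (fun p q => -minorTwo B i j p q) ∈ oddModule B := by
  refine ⟨fun p q => by simp only [minorTwo]; ring, fun p q k l => ?_, ?_⟩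
  · have h1 := minorThree_eq_zero hF p k i q l j
    have h2 := minorThree_eq_zero hF p k j q l i
    simp only [minorThree] at h1 h2
    simp only [minorTwo]
    simp only [hB j i, hB j p, hB j q, hB j k, hB j l, hB i p, hB i q, hB i k, hB i l] at h1 h2 ⊢
    linear_combination h2 - h1
  · have := hF i j
    simp only [sqEntry] at this
    simp only [minorTwo]
    linear_combination -this

theorem mul_minorTwo_comm (hB : ∀ i j, B i j = B j i) {ℓ : Fin 4 → Fin 4 → Q} (hℓ : ℓ ∈ oddModule B)
    (h2 : ∃ c : Q, 2 * c = 1) (i j k l p q : Fin 4) :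
    ℓ i j * minorTwo B k l p q = ℓ k l * minorTwo B i j p q := by
  obtain ⟨c, hc⟩ := h2
  obtain ⟨hs, hR, -⟩ := hℓ
  have : 2 * (ℓ i j * minorTwo B k l p q - ℓ k l * minorTwo B i j p q) = 0 := by
    simp only [minorTwo]
    have e : ∀ a b c d e f, B a b * (B c d * ℓ e f + ℓ c d * B e f - B c f * ℓ e d - ℓ c f * B e d)
        = 0 := fun a b c d e f => by rw [hR c d e f]; ring
    have e1 := e j l i p k q
    have e2 := e i q j l k p
    have e3 := e i p j l k q
    have e4 := e k q i j l p
    have e5 := e i j k p l q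
    have e6 := e i j k l q p
    have e7 := e i j k l p q
    have e8 := e k l i j q p
    have e9 := e k l i j p q
    have e10 := e k l i p j q
    have e11 := e k p i j l q
    simp only [hB l j, hB p j, hB q j, hB p l, hB q l, hB q p, hs l j, hs p j, hs q j, hs p l,
      hs q l, hs q p]
      at e1 e2 e3 e4 e5 e6 e7 e8 e9 e10 e11 ⊢
    linear_combination 2 * (-e1 - e2 + e3 - e4 + e11) - e5 - e6 + e7 + e8 - e9 + e10
  linear_combination c * this
    - (ℓ i j * minorTwo B k l p q - ℓ k l * minorTwo B i j p q) * hc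

end SquareZeroMatrix

/-! ### The action of the products of coordinates -/

section SegreAction

open MvPolynomial

variable {Q : Type*} [CommRing Q] [Algebra ℂ Q] (b : Sym2 (Fin 4) → Q)

/-- The symmetric matrix with entries `b s(i, j)`. -/
def symMat {Q : Type*} (b : Sym2 (Fin 4) → Q) (i j : Fin 4) : Q := b s(i, j)

theorem symMat_comm {Q : Type*} (b : Sym2 (Fin 4) → Q) (i j : Fin 4) :
    symMat b i j = symMat b j i := by
  rw [symMat, symMat, Sym2.eq_swap]

variable (hF : ∀ i j, sqEntry (symMat b) i j = 0)

/-- Twice the multiplication by `u i * v j = (B i j + ℓ i j) / 2` on the module of pairs of an even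
and an odd element, where `B = u vᵀ + v uᵀ` and `ℓ = u vᵀ - v uᵀ`. -/
def segreEnd (x : Unit × Fin 4 × Fin 4) : Module.End ℂ (Q × oddModule (symMat b)) where
  toFun y := (symMat b x.2.1 x.2.2 * y.1 + y.2.1 x.2.1 x.2.2,
    symMat b x.2.1 x.2.2 • y.2 +
      y.1 • ⟨_, neg_minorTwo_mem_oddModule (symMat_comm b) hF x.2.1 x.2.2⟩)
  map_add' y z := by
    ext
    · simp; ring
    · simp; ring
  map_smul' c y := by
    ext
    · simp
    · simp

theorem segreEnd_comm (x y : Unit × Fin 4 × Fin 4) :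
    segreEnd b hF x * segreEnd b hF y = segreEnd b hF y * segreEnd b hF x := by
  have h2 : ∃ c : Q, 2 * c = 1 := ⟨algebraMap ℂ Q 2⁻¹, by
    rw [← map_ofNat (algebraMap ℂ Q) 2, ← map_mul]; simp⟩
  refine LinearMap.ext fun ⟨q, ℓ⟩ => Prod.ext ?_ (Subtype.ext <| funext fun p => funext fun r => ?_)
  · simp only [segreEnd, Module.End.mul_apply, LinearMap.coe_mk, AddHom.coe_mk, Submodule.coe_add,
      Submodule.coe_smul, Pi.add_apply, Pi.smul_apply, smul_eq_mul, minorTwo]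
    rw [symMat_comm b y.2.1 x.2.1, symMat_comm b y.2.2 x.2.2, symMat_comm b y.2.1 x.2.2,
      symMat_comm b y.2.2 x.2.1]
    ring
  · have := mul_minorTwo_comm (symMat_comm b) ℓ.2 h2 x.2.1 x.2.2 y.2.1 y.2.2 p r
    simp only [segreEnd, Module.End.mul_apply, LinearMap.coe_mk, AddHom.coe_mk, Submodule.coe_add,
      Submodule.coe_smul, Pi.add_apply, Pi.smul_apply, smul_eq_mul]
    linear_combination this

theorem segreEnd_segre (i j k l : Fin 4) :
    segreEnd b hF ((), i, j) * segreEnd b hF ((), k, l) =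
      segreEnd b hF ((), i, l) * segreEnd b hF ((), k, j) := by
  have h2 : ∃ c : Q, 2 * c = 1 := ⟨algebraMap ℂ Q 2⁻¹, by
    rw [← map_ofNat (algebraMap ℂ Q) 2, ← map_mul]; simp⟩
  refine LinearMap.ext fun ⟨q, ℓ⟩ => Prod.ext ?_ (Subtype.ext <| funext fun p => funext fun r => ?_)
  · have h1 := ℓ.2.2.1 i j k l
    simp only [segreEnd, Module.End.mul_apply, LinearMap.coe_mk, AddHom.coe_mk, Submodule.coe_add,
      Submodule.coe_smul, Pi.add_apply, Pi.smul_apply, smul_eq_mul, minorTwo]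
    simp only [symMat_comm b k i, symMat_comm b l j, symMat_comm b l i, symMat_comm b k j,
      symMat_comm b j i] at h1 ⊢
    linear_combination h1
  · have h1 := mul_minorTwo_comm (symMat_comm b) ℓ.2 h2 k l p r i j
    have h2 := mul_minorTwo_comm (symMat_comm b) ℓ.2 h2 k j p r i l
    have h3 := (neg_minorTwo_mem_oddModule (symMat_comm b) hF p r).2.1 i j k l
    have h4 : symMat b i j * symMat b k l - minorTwo (symMat b) k l i j =
        symMat b i l * symMat b k j - minorTwo (symMat b) k j i l := by
      simp only [minorTwo]
      rw [symMat_comm b l i, symMat_comm b j i, symMat_comm b l j]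
      ring
    simp only [segreEnd, Module.End.mul_apply, LinearMap.coe_mk, AddHom.coe_mk, Submodule.coe_add,
      Submodule.coe_smul, Pi.add_apply, Pi.smul_apply, smul_eq_mul]
    simp only [minorTwo_symm (symMat_comm b) _ _ p r]
    linear_combination q * h3 + ℓ.1 p r * h4 - h1 + h2

/-- The entries of the symmetric matrix `z + zᵀ`, where `z` is the generic matrix. -/
def symmetrization : Sym2 (Fin 4) → MvPolynomial (Unit × Fin 4 × Fin 4) ℂ :=
  Sym2.lift ⟨fun i j => X ((), i, j) + X ((), j, i), fun _ _ => add_comm _ _⟩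

open scoped IsMulCommutative in
/-- Commuting endomorphisms satisfying the `2 × 2` minors of a generic matrix define an action of
the polynomial ring through which the kernel of the Segre parametrization acts as zero. -/
theorem exists_algHom_of_segre {M : Type*} [AddCommGroup M] [Module ℂ M]
    (Z : Unit × Fin 4 × Fin 4 → Module.End ℂ M) (hcomm : ∀ x y, Z x * Z y = Z y * Z x)
    (hZ : ∀ i j k l, Z ((), i, j) * Z ((), k, l) = Z ((), i, l) * Z ((), k, j)) :
    ∃ Φ : MvPolynomial (Unit × Fin 4 × Fin 4) ℂ →ₐ[ℂ] Module.End ℂ M, (∀ x, Φ (X x) = Z x) ∧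
      ∀ f, aeval (R := ℂ) (fun i => (monomial (segreExponent i) (1 : ℂ))) f = 0 → Φ f = 0 := by
  obtain ⟨A, hA, hmem⟩ : ∃ A : Subalgebra ℂ (Module.End ℂ M), IsMulCommutative A ∧ ∀ x, Z x ∈ A :=
    ⟨Algebra.adjoin ℂ (Set.range Z), Algebra.isMulCommutative_adjoin ℂ (by
      rintro _ ⟨x, rfl⟩ _ ⟨y, rfl⟩; exact hcomm x y), fun x => Algebra.subset_adjoin ⟨x, rfl⟩⟩
  let z : Unit × Fin 4 × Fin 4 → A := fun x => ⟨Z x, hmem x⟩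
  refine ⟨A.val.comp (aeval z), fun x => by simp [z], fun f hf => ?_⟩
  rw [AlgHom.comp_apply, aeval_eq_zero_of_aeval_monomial_eq_zero segreExponent z
    (prod_eq_of_segre z fun p i j k l => Subtype.ext (hZ i j k l)) f hf, map_zero]

/-- If the operators `Z (i, j)` behave as `2 u i * v j` with `ω(u, v) = 0`, then a polynomial in the
symmetrized products that becomes a multiple of `ω(u, v)` acts as zero. -/
theorem algHom_aeval_eq_zero_of_segre {M : Type*} [AddCommGroup M] [Module ℂ M]
    (Z : Unit × Fin 4 × Fin 4 → Module.End ℂ M) (hcomm : ∀ x y, Z x * Z y = Z y * Z x)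
    (hZ : ∀ i j k l, Z ((), i, j) * Z ((), k, l) = Z ((), i, l) * Z ((), k, j))
    (hw : ∀ y, Z ((), 0, 1) y - Z ((), 1, 0) y + Z ((), 2, 3) y - Z ((), 3, 2) y = 0)
    (Ψ : Q →ₐ[ℂ] Module.End ℂ M)
    (hΨ : ∀ i j y, Z ((), i, j) y + Z ((), j, i) y = (2 : ℂ) • Ψ (b s(i, j)) y)
    (f : MvPolynomial (Sym2 (Fin 4)) ℂ) (g : MvPolynomial (Unit × Fin 4 × Fin 4) ℂ)
    (h : aeval (R := ℂ) (fun i => (monomial (segreExponent i) (1 : ℂ))) (aeval symmetrization f) =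
      aeval (R := ℂ) (fun i => (monomial (segreExponent i) (1 : ℂ)))
        ((X ((), 0, 1) - X ((), 1, 0) + X ((), 2, 3) - X ((), 3, 2)) * g)) :
    Ψ (aeval b f) = 0 := by
  obtain ⟨Φ, hΦ, hΦ0⟩ := exists_algHom_of_segre (fun x => (2⁻¹ : ℂ) • Z x)
    (fun x y => by rw [smul_mul_smul_comm, smul_mul_smul_comm, hcomm])
    (fun i j k l => by rw [smul_mul_smul_comm, smul_mul_smul_comm, hZ])
  have hz := hΦ0 _ ((map_sub _ _ _).trans (sub_eq_zero.2 h))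
  have hw' : Φ (X ((), 0, 1) - X ((), 1, 0) + X ((), 2, 3) - X ((), 3, 2)) = 0 := by
    simp only [map_sub, map_add, hΦ, ← smul_sub, ← smul_add]
    convert smul_zero _ using 2
    exact LinearMap.ext hw
  rw [map_sub, map_mul, hw', zero_mul, sub_zero] at hz
  have key : Φ.comp (aeval symmetrization) = Ψ.comp (aeval b) := by
    refine algHom_ext fun s => ?_
    induction s with
    | _ i j =>
    refine LinearMap.ext fun y => ?_
    simp only [AlgHom.comp_apply, aeval_X, symmetrization, Sym2.lift_mk, map_add, hΦ,
      LinearMap.add_apply, LinearMap.smul_apply, ← smul_add, hΨ, smul_smul]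
    norm_num
  have := DFunLike.congr_fun key f
  rwa [AlgHom.comp_apply, AlgHom.comp_apply, hz, eq_comm] at this

/-- Let `B` be a symmetric matrix with `B J B = 0` and `f` a polynomial in the entries of `B`. If
`f` becomes a multiple of `ω(u, v)` on substituting `u vᵀ + v uᵀ`, the cofactor being a polynomial
in the products `u i * v j`, then `f` vanishes at `B`. -/
theorem aeval_eq_zero_of_symmetrization (hF : ∀ i j, sqEntry (symMat b) i j = 0)
    (f : MvPolynomial (Sym2 (Fin 4)) ℂ) (g : MvPolynomial (Unit × Fin 4 × Fin 4) ℂ)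
    (h : aeval (R := ℂ) (fun i => (monomial (segreExponent i) (1 : ℂ))) (aeval symmetrization f) =
      aeval (R := ℂ) (fun i => (monomial (segreExponent i) (1 : ℂ)))
        ((X ((), 0, 1) - X ((), 1, 0) + X ((), 2, 3) - X ((), 3, 2)) * g)) :
    aeval b f = 0 := by
  have := algHom_aeval_eq_zero_of_segre b (segreEnd b hF) (segreEnd_comm b hF)
    (segreEnd_segre b hF) (fun ⟨q, ℓ⟩ => ?_) (Algebra.lsmul ℂ ℂ (Q × oddModule (symMat b)))
    (fun i j ⟨q, ℓ⟩ => ?_) f g h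
  · simpa using congrArg Prod.fst (LinearMap.congr_fun this (1, 0))
  · refine Prod.ext ?_ (Subtype.ext <| funext fun p => funext fun r => ?_)
    · have h1 := ℓ.2.1 1 0
      have h2 := ℓ.2.1 3 2
      have h3 := ℓ.2.2.2
      simp only [segreEnd, LinearMap.coe_mk,
        AddHom.coe_mk, Prod.fst_sub, Prod.fst_add, Prod.fst_zero,
        symMat_comm b 1 0, symMat_comm b 3 2]
      linear_combination -h1 - h2 + 2 * h3
    · have h3 := (neg_minorTwo_mem_oddModule (symMat_comm b) hF p r).2.2
      simp only [segreEnd, LinearMap.coe_mk,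
        AddHom.coe_mk, Prod.snd_sub, Prod.snd_add, Prod.snd_zero,
        symMat_comm b 1 0, symMat_comm b 3 2, Submodule.coe_add, Submodule.coe_sub,
        Submodule.coe_smul, Pi.add_apply, Pi.sub_apply, Pi.smul_apply, smul_eq_mul,
        minorTwo_symm (symMat_comm b) _ _ p r, Submodule.coe_zero, Pi.zero_apply]
      have h1 := ℓ.2.1 1 0
      simp only [minorTwo] at h3 ⊢
      linear_combination 2 * q * h3
  · refine Prod.ext ?_ (Subtype.ext <| funext fun p => funext fun r => ?_)
    · have h1 := ℓ.2.1 j i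
      simp only [segreEnd, LinearMap.coe_mk, AddHom.coe_mk, Prod.smul_fst, Prod.fst_add,
        symMat_comm b j i]
      change _ = (2 : ℂ) • (symMat b i j * q)
      rw [Algebra.smul_def, map_ofNat]
      linear_combination h1
    · simp only [segreEnd, LinearMap.coe_mk, AddHom.coe_mk, Prod.smul_snd, Prod.snd_add,
        symMat_comm b j i, Submodule.coe_add, Submodule.coe_smul, Pi.add_apply, Pi.smul_apply,
        smul_eq_mul, minorTwo]
      change _ = (2 : ℂ) • (symMat b i j * ℓ.1 p r)
      rw [Algebra.smul_def, map_ofNat]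
      ring

end SegreAction

/-! ### Pairs of orthogonal vectors -/

section OrthogonalPairs

open MvPolynomial

/-- The polynomial ring in the coordinates of two vectors `u, v` of a four-dimensional space. -/
abbrev PairPoly : Type := MvPolynomial (Fin 4 ⊕ Fin 4) ℂ

/-- The symplectic form `ω(u, v)` as a polynomial in the coordinates of `u` and `v`. -/
def omegaPoly : PairPoly :=
  X (.inl 0) * X (.inr 1) - X (.inl 1) * X (.inr 0) + X (.inl 2) * X (.inr 3)
    - X (.inl 3) * X (.inr 2)

/-- The coordinate ring of the variety of pairs `(u, v)` with `ω(u, v) = 0`. -/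
abbrev PairRing : Type := PairPoly ⧸ Ideal.span {omegaPoly}

namespace PairRing

/-- The coordinates of `u`. -/
def u (i : Fin 4) : PairRing := Ideal.Quotient.mk _ (X (.inl i))

/-- The coordinates of `v`. -/
def v (i : Fin 4) : PairRing := Ideal.Quotient.mk _ (X (.inr i))

/-- The coordinates of `u ∧ v`. -/
def wedge (i j : Fin 4) : PairRing := u i * v j - u j * v i

theorem omega_eq_zero : u 0 * v 1 - u 1 * v 0 + u 2 * v 3 - u 3 * v 2 = 0 := by
  have : Ideal.Quotient.mk (Ideal.span {omegaPoly}) omegaPoly = 0 :=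
    Ideal.Quotient.eq_zero_iff_mem.2 (Ideal.mem_span_singleton_self _)
  exact this

theorem prime_omegaPoly : Prime omegaPoly := by
  have hirr : Irreducible ((X (.inl 0) : PairPoly) * X (.inr 1) + (- (X (.inl 1) * X (.inr 0)) +
      X (.inl 2) * X (.inr 3) - X (.inl 3) * X (.inr 2))) := by
    refine irreducible_mul_X_add _ _ _ (X_ne_zero _) (by simp) ?_ ?_
    · have hd : ∀ x ∈ ({.inl 1, .inr 0, .inl 2, .inr 3, .inl 3, .inr 2} : Finset (Fin 4 ⊕ Fin 4)),
          X x ∈ supported ℂ ((Set.univ : Set (Fin 4 ⊕ Fin 4)) \ {.inr 1}) := by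
        intro x hx
        refine X_mem_supported.2 ?_
        simp only [Set.mem_sdiff, Set.mem_univ, Set.mem_singleton_iff, true_and]
        rintro rfl
        simp at hx
      have : (- (X (.inl 1) * X (.inr 0)) + X (.inl 2) * X (.inr 3) - X (.inl 3) * X (.inr 2) :
          PairPoly) ∈ supported ℂ ((Set.univ : Set (Fin 4 ⊕ Fin 4)) \ {.inr 1}) := by
        refine sub_mem (add_mem (neg_mem (mul_mem ?_ ?_)) (mul_mem ?_ ?_)) (mul_mem ?_ ?_) <;>
          exact hd _ (by simp)
      intro h
      simpa using (mem_supported.1 this) h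
    · refine (Irreducible.isRelPrime_iff_not_dvd (X_prime).irreducible).2 ?_
      rintro ⟨q, hq⟩
      have := congrArg (eval (Sum.elim ![0, 0, 1, 0] ![0, 0, 0, 1] : Fin 4 ⊕ Fin 4 → ℂ)) hq
      simp at this
  have : omegaPoly = (X (.inl 0) : PairPoly) * X (.inr 1) + (- (X (.inl 1) * X (.inr 0)) +
      X (.inl 2) * X (.inr 3) - X (.inl 3) * X (.inr 2)) := by
    rw [omegaPoly]; ring
  rw [this]
  exact hirr.prime

instance : (Ideal.span {omegaPoly}).IsPrime :=
  (Ideal.span_singleton_prime prime_omegaPoly.ne_zero).2 prime_omegaPoly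

instance : IsDomain PairRing := Ideal.Quotient.isDomain _

/-- An algebra homomorphism out of `PairRing` is given by a pair of orthogonal vectors. -/
def lift {E : Type*} [CommRing E] [Algebra ℂ E] (x y : Fin 4 → E)
    (h : x 0 * y 1 - x 1 * y 0 + x 2 * y 3 - x 3 * y 2 = 0) : PairRing →ₐ[ℂ] E :=
  Ideal.Quotient.liftₐ _ (aeval (Sum.elim x y)) (by
    intro a ha
    obtain ⟨c, rfl⟩ := Ideal.mem_span_singleton.1 ha
    rw [map_mul]
    have : aeval (Sum.elim x y) omegaPoly = 0 := by simpa [omegaPoly] using h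
    rw [this, zero_mul])

@[simp] theorem lift_u {E : Type*} [CommRing E] [Algebra ℂ E] (x y : Fin 4 → E) (h) (i : Fin 4) :
    lift x y h (u i) = x i :=
  aeval_X _ _

@[simp] theorem lift_v {E : Type*} [CommRing E] [Algebra ℂ E] (x y : Fin 4 → E) (h) (i : Fin 4) :
    lift x y h (v i) = y i :=
  aeval_X _ _

theorem wedge_ne_zero : wedge 0 1 ≠ 0 := by
  intro h
  have := congrArg (lift (E := ℂ) ![1, 0, 1, 0] ![0, 1, 0, -1] (by simp)) h
  simp [wedge] at this

/-- The quotient of `PairRing` by `(u ∧ v)₀₁` is a domain, namely the coordinate ring of a product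
of two Segre cones, in which `(u ∧ v)₀₂` does not vanish. -/
theorem wedge_dvd {x y : PairRing} (h : wedge 0 2 * x = wedge 0 1 * y) : wedge 0 1 ∣ x := by
  obtain ⟨x, rfl⟩ := Ideal.Quotient.mk_surjective x
  obtain ⟨y, rfl⟩ := Ideal.Quotient.mk_surjective y
  let d : Fin 4 → Fin 4 → PairPoly := fun i j => X (.inl i) * X (.inr j) - X (.inl j) * X (.inr i)
  -- modulo `ω` and `d 0 1`, also `d 2 3` vanishes; the map `e` arranges the variables into the two
  -- `2 × 2` matrices with these determinants
  let J : Ideal PairPoly := Ideal.span {d 0 1, d 2 3}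
  let e : Fin 4 ⊕ Fin 4 → Fin 2 × Fin 2 × Fin 2 :=
    Sum.elim ![(0, 0, 0), (0, 0, 1), (1, 0, 0), (1, 0, 1)]
        ![(0, 1, 0), (0, 1, 1), (1, 1, 0), (1, 1, 1)]
  let e' : Fin 2 × Fin 2 × Fin 2 → Fin 4 ⊕ Fin 4 := fun x =>
    ![![![.inl 0, .inl 1], ![.inr 0, .inr 1]], ![![.inl 2, .inl 3], ![.inr 2, .inr 3]]]
        x.1 x.2.1 x.2.2
  have hee : ∀ i, e' (e i) = i := by
    rintro (i | i) <;> fin_cases i <;> rfl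
  have h01 : Ideal.Quotient.mk J (d 0 1) = 0 :=
    Ideal.Quotient.eq_zero_iff_mem.2 (Ideal.subset_span (by simp))
  have h23 : Ideal.Quotient.mk J (d 2 3) = 0 :=
    Ideal.Quotient.eq_zero_iff_mem.2 (Ideal.subset_span (by simp))
  let χ := aeval (R := ℂ) (fun i : Fin 4 ⊕ Fin 4 => (monomial (segreExponent (e i)) (1 : ℂ)))
  have hχ : ∀ f, χ f = 0 → f ∈ J := by
    intro f hf
    have := aeval_eq_zero_of_aeval_monomial_eq_zero (fun i => segreExponent (e i))
      (fun i => Ideal.Quotient.mk J (X i)) (fun s t hst => ?_) f hf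
    · rw [← Ideal.Quotient.eq_zero_iff_mem, ← this]
      have : Ideal.Quotient.mkₐ ℂ J = aeval (fun i => Ideal.Quotient.mk J (X i)) :=
        algHom_ext fun i => by simp
      rw [← this]; rfl
    · have := prod_eq_of_segre (fun x => Ideal.Quotient.mk J (X (e' x))) (fun p i j k l => ?_)
        (s.map e) (t.map e) (by simpa [Multiset.map_map, Function.comp_def] using hst)
      · simpa [Multiset.map_map, Function.comp_def, hee] using this
      · simp only [d, map_sub, map_mul] at h01 h23
        fin_cases p <;> fin_cases i <;> fin_cases j <;> fin_cases k <;> fin_cases l <;>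
          simp [e'] <;> first | ring1 | linear_combination h01 | linear_combination -h01 |
            linear_combination h23 | linear_combination -h23
  have hχ01 : χ (d 0 1) = 0 := by
    simp only [χ, d, map_sub, map_mul, aeval_X, monomial_mul, e, segreExponent, Sum.elim_inl,
      Sum.elim_inr]
    rw [sub_eq_zero]
    congr 1
    simp
    abel_nf
  have hχ23 : χ (d 2 3) = 0 := by
    simp only [χ, d, map_sub, map_mul, aeval_X, monomial_mul, e, segreExponent, Sum.elim_inl,
      Sum.elim_inr]
    rw [sub_eq_zero]
    congr 1
    simp
    abel_nf
  have hχ02 : χ (d 0 2) ≠ 0 := by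
    intro h0
    have := congrArg (eval (fun x => if x = Sum.inl (1, 0) then 0 else 1)) h0
    simp [χ, d, e, segreExponent, eval_monomial] at this
  have hω : omegaPoly = d 0 1 + d 2 3 := by
    simp only [omegaPoly, d]; ring
  have hmem : d 0 2 * x - d 0 1 * y ∈ Ideal.span {omegaPoly} := by
    rw [← Ideal.Quotient.eq_zero_iff_mem, map_sub, sub_eq_zero]
    exact h
  have hx : χ x = 0 := by
    obtain ⟨c, hc⟩ := Ideal.mem_span_singleton.1 hmem
    have := congrArg χ hc
    rw [map_sub, map_mul, map_mul, map_mul, hω, map_add, hχ01, hχ23] at this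
    simpa [hχ02] using this
  obtain ⟨p, q, hpq⟩ := Ideal.mem_span_pair.1 (hχ x hx)
  refine ⟨Ideal.Quotient.mk _ (p - q), ?_⟩
  have : x - d 0 1 * (p - q) ∈ Ideal.span {omegaPoly} :=
    Ideal.mem_span_singleton.2 ⟨q, by rw [← hpq, hω]; ring⟩
  rw [← Ideal.Quotient.eq_zero_iff_mem, map_sub, sub_eq_zero] at this
  exact this

/-- A vector that becomes a multiple of the bivector `u ∧ v` over the field of fractions is a
multiple of it. -/
theorem exists_eq_mul_wedge {ι : Type*} (x : ι → PairRing) (i₁ i₂ : ι) (w : ι → PairRing)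
    (h₁ : w i₁ = wedge 0 1) (h₂ : w i₂ = wedge 0 2) (h : ∀ i j, w i * x j = w j * x i) :
    ∃ c, ∀ i, x i = c * w i := by
  obtain ⟨c, hc⟩ := wedge_dvd (x := x i₁) (y := x i₂) (by rw [← h₁, ← h₂, h])
  refine ⟨c, fun i => mul_left_cancel₀ wedge_ne_zero ?_⟩
  rw [← h₁, h, hc, h₁]
  ring

end PairRing
end OrthogonalPairs

/-! ### Weights for the torus acting on pairs of vectors -/

section Weights

open MvPolynomial LaurentPolynomial

variable {E : Type*} [CommRing E] [Algebra ℂ E] (u v : Fin 4 → E)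

/-- The span of the monomials in the `u i` and `v i` of weight `n`, where the `u i` have weight `1`
and the `v i` weight `-1`. -/
def weightSpace (n : ℤ) : Submodule ℂ E :=
  Submodule.span ℂ {x | ∃ s t : Multiset (Fin 4),
    (s.card : ℤ) - t.card = n ∧ x = (s.map u).prod * (t.map v).prod}

theorem mul_u_mem_weightSpace (i : Fin 4) {n : ℤ} {x : E} (hx : x ∈ weightSpace u v n) :
    u i * x ∈ weightSpace u v (n + 1) := by
  induction hx using Submodule.span_induction with
  | mem x hx =>
    obtain ⟨s, t, h, rfl⟩ := hx
    exact Submodule.subset_span ⟨i ::ₘ s, t, by simp; omega, by simp [mul_assoc]⟩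
  | zero => simp
  | add x y _ _ hx hy => rw [mul_add]; exact add_mem hx hy
  | smul c x _ hx => rw [mul_smul_comm]; exact Submodule.smul_mem _ _ hx

theorem mul_v_mem_weightSpace (i : Fin 4) {n : ℤ} {x : E} (hx : x ∈ weightSpace u v n) :
    v i * x ∈ weightSpace u v (n - 1) := by
  induction hx using Submodule.span_induction with
  | mem x hx =>
    obtain ⟨s, t, h, rfl⟩ := hx
    exact Submodule.subset_span ⟨s, i ::ₘ t, by simp; omega, by simp; ring⟩
  | zero => simp
  | add x y _ _ hx hy => rw [mul_add]; exact add_mem hx hy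
  | smul c x _ hx => rw [mul_smul_comm]; exact Submodule.smul_mem _ _ hx

/-- The components of an element for the torus action lie in the weight spaces. -/
theorem coeff_mem_weightSpace (τ : E →ₐ[ℂ] E[T;T⁻¹])
    (hu : ∀ i, τ (u i) = AddMonoidAlgebra.single 1 (u i))
    (hv : ∀ i, τ (v i) = AddMonoidAlgebra.single (-1) (v i)) (f : PairPoly) (n : ℤ) :
    (τ (aeval (Sum.elim u v) f)).coeff n ∈ weightSpace u v n := by
  induction f using MvPolynomial.induction_on generalizing n with
  | C a =>
    rw [aeval_C, AlgHom.commutes, LaurentPolynomial.algebraMap_apply, LaurentPolynomial.C_apply]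
    split_ifs with h
    · subst h
      rw [Algebra.algebraMap_eq_smul_one]
      exact Submodule.smul_mem _ _ (Submodule.subset_span ⟨0, 0, by simp, by simp⟩)
    · exact zero_mem _
  | add p q hp hq =>
    rw [map_add, map_add, AddMonoidAlgebra.coeff_add, Finsupp.add_apply]
    exact add_mem (hp n) (hq n)
  | mul_X p i hp =>
    rw [mul_comm, map_mul, map_mul, aeval_X]
    rcases i with i | i
    · rw [Sum.elim_inl, hu, AddMonoidAlgebra.coeff_single_mul_apply]
      convert mul_u_mem_weightSpace u v i (hp (-1 + n)) using 2
      ring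
    · rw [Sum.elim_inr, hv, AddMonoidAlgebra.coeff_single_mul_apply]
      convert mul_v_mem_weightSpace u v i (hp (- -1 + n)) using 2
      ring

/-- A monomial of weight `n ≥ 0` is a product of `n` factors `u i` with factors `u i * v j`. -/
theorem weightSpace_le (n : ℕ) (N : Submodule ℂ E) (h0 : ∀ s : Multiset (Fin 4), s.card = n →
    (s.map u).prod ∈ N) (hN : ∀ i j, ∀ x ∈ N, u i * v j * x ∈ N) :
    weightSpace u v n ≤ N := by
  refine Submodule.span_le.2 ?_
  rintro _ ⟨s, t, hst, rfl⟩
  induction t using Multiset.induction_on generalizing s with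
  | empty => simpa using h0 s (by simpa using hst)
  | cons j t ih =>
    obtain ⟨i, hi⟩ := Multiset.card_pos_iff_exists_mem.1 (show 0 < s.card by simp at hst; omega)
    obtain ⟨s, rfl⟩ := Multiset.exists_cons_of_mem hi
    have := hN i j _ (ih s (by simp at hst; omega))
    rw [Multiset.map_cons, Multiset.prod_cons, Multiset.map_cons, Multiset.prod_cons]
    rw [SetLike.mem_coe]
    convert this using 1
    ring

end Weights

/-! ### The ideal of the variety of symmetric matrices with `B J B = 0` -/

section Kernel

open MvPolynomial LaurentPolynomial

/-- The entries of `u vᵀ + v uᵀ`. -/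
def pairSym {E : Type*} [CommRing E] (u v : Fin 4 → E) : Sym2 (Fin 4) → E :=
  Sym2.lift ⟨fun i j => u i * v j + u j * v i, fun _ _ => add_comm _ _⟩

theorem pairSym_mk {E : Type*} [CommRing E] (u v : Fin 4 → E) (i j : Fin 4) :
    pairSym u v s(i, j) = u i * v j + u j * v i := rfl

/-- The torus action on `PairPoly`. -/
def pairPolyTorus : PairPoly →ₐ[ℂ] PairPoly[T;T⁻¹] :=
  aeval (Sum.elim (fun i => AddMonoidAlgebra.single 1 (X (.inl i)))
    (fun i => AddMonoidAlgebra.single (-1) (X (.inr i))))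

/-- A polynomial in the entries of a symmetric matrix that vanishes on `u vᵀ + v uᵀ` for all `u, v`
with `ω(u, v) = 0` vanishes at every symmetric matrix `B` with `B J B = 0`, over any ring. -/
theorem aeval_eq_zero_of_aeval_pairSym {Q : Type*} [CommRing Q] [Algebra ℂ Q]
    (b : Sym2 (Fin 4) → Q) (hF : ∀ i j, sqEntry (symMat b) i j = 0)
    (f : MvPolynomial (Sym2 (Fin 4)) ℂ) (hf : aeval (pairSym PairRing.u PairRing.v) f = 0) :
    aeval b f = 0 := by
  let x : Fin 4 → PairPoly := fun i => X (.inl i)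
  let y : Fin 4 → PairPoly := fun i => X (.inr i)
  let f₀ : PairPoly := aeval (pairSym x y) f
  have hmk : (Ideal.Quotient.mkₐ ℂ (Ideal.span {omegaPoly})).comp (aeval (pairSym x y)) =
      aeval (pairSym PairRing.u PairRing.v) := by
    refine algHom_ext fun s => ?_
    induction s with
    | _ i j =>
    simp [pairSym_mk, x, y, PairRing.u, PairRing.v]
  obtain ⟨g, hg⟩ : omegaPoly ∣ f₀ := by
    rw [← Ideal.mem_span_singleton, ← Ideal.Quotient.eq_zero_iff_mem, ← hf, ← hmk]
    rfl
  have hT : (LaurentPolynomial.T 1 : PairPoly[T;T⁻¹]) * LaurentPolynomial.T (-1) = 1 := by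
    rw [← LaurentPolynomial.T_add]; simp
  -- `f₀` and `ω` have weight `0`, so the cofactor may be replaced by its part of weight `0`.
  have h1 : ∀ f : MvPolynomial (Sym2 (Fin 4)) ℂ, pairPolyTorus (aeval (pairSym x y) f) =
      LaurentPolynomial.C (aeval (pairSym x y) f) := by
    intro f
    have : pairPolyTorus.comp (aeval (pairSym x y)) =
        ((Algebra.ofId PairPoly PairPoly[T;T⁻¹]).restrictScalars ℂ).comp
          (aeval (pairSym x y)) := by
      refine algHom_ext fun s => ?_
      induction s with
      | _ i j =>
      simp [pairSym_mk, x, y, pairPolyTorus, Algebra.ofId_apply,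
        LaurentPolynomial.algebraMap_apply]
      linear_combination (LaurentPolynomial.C (X (.inl i)) * LaurentPolynomial.C (X (.inr j))
        + LaurentPolynomial.C (X (.inl j)) * LaurentPolynomial.C (X (.inr i))) * hT
    exact DFunLike.congr_fun this f
  have h2 : pairPolyTorus omegaPoly = LaurentPolynomial.C omegaPoly := by
    simp only [omegaPoly, pairPolyTorus, map_add, map_sub, map_mul, aeval_X, Sum.elim_inl,
      Sum.elim_inr, single_eq_C_mul_T]
    linear_combination (LaurentPolynomial.C (X (.inl 0)) * LaurentPolynomial.C (X (.inr 1))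
      - LaurentPolynomial.C (X (.inl 1)) * LaurentPolynomial.C (X (.inr 0))
      + LaurentPolynomial.C (X (.inl 2)) * LaurentPolynomial.C (X (.inr 3))
      - LaurentPolynomial.C (X (.inl 3)) * LaurentPolynomial.C (X (.inr 2))) * hT
  have h3 : f₀ = omegaPoly * (pairPolyTorus g).coeff 0 := by
    have := congrArg (fun p => (pairPolyTorus p).coeff 0) hg
    simp only [map_mul, f₀, h1, h2] at this
    rw [← single_eq_C omegaPoly, AddMonoidAlgebra.coeff_single_mul_apply] at this
    simpa only [LaurentPolynomial.C_apply, if_true, neg_zero, zero_add] using this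
  obtain ⟨g', hg'⟩ : ∃ g', aeval (R := ℂ) (fun i : Unit × Fin 4 × Fin 4 => x i.2.1 * y i.2.2) g' =
      (pairPolyTorus g).coeff 0 := by
    have hmem := coeff_mem_weightSpace x y pairPolyTorus (fun i => by simp [pairPolyTorus, x])
      (fun i => by simp [pairPolyTorus, y]) g 0
    have hid : aeval (Sum.elim x y) g = g := by
      conv_rhs => rw [← aeval_X_left_apply g]
      congr 2
      ext i
      rcases i with i | i <;> rfl
    rw [hid] at hmem
    refine weightSpace_le x y 0 (LinearMap.range (aeval (R := ℂ)
      (fun i : Unit × Fin 4 × Fin 4 => x i.2.1 * y i.2.2)).toLinearMap) ?_ ?_ hmem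
    · intro s hs
      rw [Multiset.card_eq_zero.1 hs]
      exact ⟨1, by simp⟩
    · rintro i j _ ⟨p, rfl⟩
      exact ⟨X ((), i, j) * p, by simp⟩
  refine aeval_eq_zero_of_symmetrization b hF f g' ?_
  let ren : PairPoly →ₐ[ℂ] MvPolynomial ((Unit × Fin 4) ⊕ (Unit × Fin 4)) ℂ :=
    rename (Sum.map (fun i => ((), i)) (fun i => ((), i)))
  have hseg : ren.comp (aeval (R := ℂ) (fun i : Unit × Fin 4 × Fin 4 => x i.2.1 * y i.2.2)) =
      aeval (R := ℂ) (fun i => (monomial (segreExponent i) (1 : ℂ))) := by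
    refine algHom_ext fun i => ?_
    rw [AlgHom.comp_apply, aeval_X, aeval_X, map_mul, segreExponent, ← one_mul (1 : ℂ),
      ← monomial_mul]
    simp only [ren, x, y, rename_X]
    rfl
  have hsym : (aeval (R := ℂ) (fun i => (monomial (segreExponent i) (1 : ℂ)))).comp
      (aeval symmetrization) = ren.comp (aeval (pairSym x y)) := by
    refine algHom_ext fun s => ?_
    induction s with
    | _ i j =>
    rw [← hseg]
    simp [symmetrization, pairSym_mk]
  have h4 := DFunLike.congr_fun hsym f
  rw [AlgHom.comp_apply, AlgHom.comp_apply] at h4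
  rw [h4]
  change ren f₀ = _
  rw [h3, map_mul, ← hg', map_mul, ← hseg]
  congr 1
  simp [omegaPoly, x, y]

end Kernel

/-! ### The invariant ring of the orthogonal group -/

namespace PairRing

open MvPolynomial LaurentPolynomial

/-- The ring of the functions of `u vᵀ + v uᵀ`. -/
def invariants : Subalgebra ℂ PairRing := (aeval (pairSym u v)).range

theorem pairSym_mem_invariants (i j : Fin 4) : u i * v j + u j * v i ∈ invariants :=
  ⟨X s(i, j), by rw [← pairSym_mk]; exact aeval_X _ _⟩

/-- The automorphism that exchanges `u` and `v`. -/
def swap : PairRing →ₐ[ℂ] PairRing := lift v u (by linear_combination -omega_eq_zero)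

/-- The action of the torus, for which the `u i` have weight `1` and the `v i` weight `-1`. -/
def torus : PairRing →ₐ[ℂ] PairRing[T;T⁻¹] :=
  lift (fun i => AddMonoidAlgebra.single 1 (u i)) (fun i => AddMonoidAlgebra.single (-1) (v i)) (by
    simp only [AddMonoidAlgebra.single_mul_single, ← AddMonoidAlgebra.single_sub,
      ← AddMonoidAlgebra.single_add]
    rw [omega_eq_zero, AddMonoidAlgebra.single_zero])

theorem swap_eq_self {s : PairRing} (hs : s ∈ invariants) : swap s = s := by
  obtain ⟨f, rfl⟩ := hs
  have : swap.comp (aeval (pairSym u v)) = aeval (pairSym u v) := by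
    refine algHom_ext fun s => ?_
    induction s with
    | _ i j =>
    simp [pairSym_mk, swap]
    ring
  exact DFunLike.congr_fun this f

theorem torus_eq_C {s : PairRing} (hs : s ∈ invariants) : torus s = LaurentPolynomial.C s := by
  obtain ⟨f, rfl⟩ := hs
  have : torus.comp (aeval (pairSym u v)) =
      ((Algebra.ofId PairRing PairRing[T;T⁻¹]).restrictScalars ℂ).comp (aeval (pairSym u v)) := by
    refine algHom_ext fun s => ?_
    induction s with
    | _ i j =>
    have hT : (LaurentPolynomial.T 1 : PairRing[T;T⁻¹]) * LaurentPolynomial.T (-1) = 1 := by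
      rw [← LaurentPolynomial.T_add]; simp
    simp [pairSym_mk, torus, Algebra.ofId_apply, LaurentPolynomial.algebraMap_apply]
    linear_combination (LaurentPolynomial.C (u i) * LaurentPolynomial.C (v j)
      + LaurentPolynomial.C (u j) * LaurentPolynomial.C (v i)) * hT
  exact DFunLike.congr_fun this f

/-- The component of weight `n` for the action of the torus. -/
def weightPart (n : ℤ) (r : PairRing) : PairRing := (torus r).coeff n

theorem weightPart_add (n : ℤ) (x y : PairRing) :
    weightPart n (x + y) = weightPart n x + weightPart n y := by
  simp [weightPart]

theorem weightPart_mul_u (n : ℤ) (x : PairRing) (i : Fin 4) :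
    weightPart n (x * u i) = weightPart (n - 1) x * u i := by
  rw [weightPart, mul_comm, map_mul, torus, lift_u, AddMonoidAlgebra.coeff_single_mul_apply,
    mul_comm, show -1 + n = n - 1 by ring]
  rfl

theorem weightPart_mul_v (n : ℤ) (x : PairRing) (i : Fin 4) :
    weightPart n (x * v i) = weightPart (n + 1) x * v i := by
  rw [weightPart, mul_comm, map_mul, torus, lift_v, AddMonoidAlgebra.coeff_single_mul_apply,
    mul_comm, show - -1 + n = n + 1 by ring]
  rfl

theorem weightPart_zero_invariant {s : PairRing} (hs : s ∈ invariants) : weightPart 0 s = s := by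
  rw [weightPart, torus_eq_C hs, LaurentPolynomial.C_apply, if_pos rfl]

theorem weightPart_mem (n : ℤ) (r : PairRing) : weightPart n r ∈ weightSpace u v n := by
  obtain ⟨f, rfl⟩ := Ideal.Quotient.mk_surjective r
  have : Ideal.Quotient.mkₐ ℂ (Ideal.span {omegaPoly}) = aeval (Sum.elim u v) := by
    refine algHom_ext fun i => ?_
    rcases i with i | i <;> simp <;> rfl
  have h := coeff_mem_weightSpace u v torus (fun i => by simp [torus])
    (fun i => by simp [torus]) f n
  rw [← this] at h
  exact h

theorem half_mul_two : algebraMap ℂ PairRing 2⁻¹ * 2 = 1 := by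
  rw [← map_ofNat (algebraMap ℂ PairRing) 2, ← map_mul]; simp

theorem half_mem : algebraMap ℂ PairRing 2⁻¹ ∈ invariants := Subalgebra.algebraMap_mem _ _

/-- The elements of weight `0` are combinations of `1` and the coordinates of `u ∧ v` with
invariant coefficients. -/
theorem weightPart_zero_eq (r : PairRing) : ∃ s ∈ invariants, ∃ E : Fin 4 → Fin 4 → PairRing,
    (∀ i j, E i j ∈ invariants) ∧ weightPart 0 r = s + ∑ i, ∑ j, E i j * wedge i j := by
  let N : Submodule ℂ PairRing :=
    { carrier := {r | ∃ s ∈ invariants, ∃ E : Fin 4 → Fin 4 → PairRing,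
        (∀ i j, E i j ∈ invariants) ∧ r = s + ∑ i, ∑ j, E i j * wedge i j}
      zero_mem' := ⟨0, zero_mem _, fun _ _ => 0, fun _ _ => zero_mem _, by simp⟩
      add_mem' := by
        rintro _ _ ⟨s, hs, E, hE, rfl⟩ ⟨s', hs', E', hE', rfl⟩
        refine ⟨s + s', add_mem hs hs', fun i j => E i j + E' i j,
          fun i j => add_mem (hE i j) (hE' i j), ?_⟩
        simp only [add_mul, Finset.sum_add_distrib]
        ring
      smul_mem' := by
        rintro c _ ⟨s, hs, E, hE, rfl⟩
        refine ⟨c • s, Subalgebra.smul_mem _ hs c, fun i j => c • E i j,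
          fun i j => Subalgebra.smul_mem _ (hE i j) c, ?_⟩
        simp only [smul_add, Finset.smul_sum, smul_mul_assoc] }
  have hN : ∀ i j, ∀ x ∈ N, u i * v j * x ∈ N := by
    rintro i j _ ⟨s, hs, E, hE, rfl⟩
    have hB := pairSym_mem_invariants
    have hm : ∀ k l, wedge i j * wedge k l ∈ invariants := fun k l => by
      have : wedge i j * wedge k l = (u i * v l + u l * v i) * (u j * v k + u k * v j)
          - (u i * v k + u k * v i) * (u j * v l + u l * v j) := by simp only [wedge]; ring
      rw [this]
      exact sub_mem (mul_mem (hB _ _) (hB _ _)) (mul_mem (hB _ _) (hB _ _))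
    refine ⟨algebraMap ℂ PairRing 2⁻¹ * ((u i * v j + u j * v i) * s +
      ∑ k, ∑ l, E k l * (wedge i j * wedge k l)), ?_,
      fun k l => algebraMap ℂ PairRing 2⁻¹ * ((u i * v j + u j * v i) * E k l +
        if (k, l) = (i, j) then s else 0), ?_, ?_⟩
    · exact mul_mem half_mem (add_mem (mul_mem (hB _ _) hs)
        (sum_mem fun k _ => sum_mem fun l _ => mul_mem (hE k l) (hm k l)))
    · intro k l
      refine mul_mem half_mem (add_mem (mul_mem (hB _ _) (hE k l)) ?_)
      split_ifs
      exacts [hs, zero_mem _]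
    · have h1 : ∑ k, ∑ l, (if (k, l) = (i, j) then s else 0) * wedge k l = s * wedge i j := by
        simp [Prod.ext_iff, ite_and]
      have h2 : ∑ k, ∑ l, algebraMap ℂ PairRing 2⁻¹ * ((u i * v j + u j * v i) * E k l +
          if (k, l) = (i, j) then s else 0) * wedge k l = algebraMap ℂ PairRing 2⁻¹ *
          ((u i * v j + u j * v i) * ∑ k, ∑ l, E k l * wedge k l + s * wedge i j) := by
        rw [← h1]
        simp only [Finset.mul_sum, mul_add, add_mul, Finset.sum_add_distrib, mul_assoc]
      have h3 : ∑ k, ∑ l, E k l * (wedge i j * wedge k l) =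
          wedge i j * ∑ k, ∑ l, E k l * wedge k l := by
        simp only [Finset.mul_sum]
        exact Finset.sum_congr rfl fun k _ => Finset.sum_congr rfl fun l _ => by ring
      rw [h2, h3]
      have h4 : u i * v j = algebraMap ℂ PairRing 2⁻¹ * ((u i * v j + u j * v i) + wedge i j) := by
        simp only [wedge]
        linear_combination -(u i * v j) * half_mul_two
      rw [wedge] at *
      linear_combination (s + ∑ k, ∑ l, E k l * wedge k l) * h4
  refine weightSpace_le u v 0 N (fun s hs => ?_) hN (weightPart_mem 0 r)
  rw [Multiset.card_eq_zero.1 hs]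
  exact ⟨1, one_mem _, fun _ _ => 0, fun _ _ => zero_mem _, by simp⟩

/-- The elements of weight `2` are quadratic in `u` with invariant coefficients. -/
theorem weightPart_two_eq (r : PairRing) : ∃ E : Fin 4 → Fin 4 → PairRing,
    (∀ i j, E i j ∈ invariants) ∧ weightPart 2 r = ∑ i, ∑ j, E i j * (u i * u j) := by
  let N : Submodule ℂ PairRing :=
    { carrier := {r | ∃ E : Fin 4 → Fin 4 → PairRing,
        (∀ i j, E i j ∈ invariants) ∧ r = ∑ i, ∑ j, E i j * (u i * u j)}
      zero_mem' := ⟨fun _ _ => 0, fun _ _ => zero_mem _, by simp⟩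
      add_mem' := by
        rintro _ _ ⟨E, hE, rfl⟩ ⟨E', hE', rfl⟩
        refine ⟨fun i j => E i j + E' i j, fun i j => add_mem (hE i j) (hE' i j), ?_⟩
        simp only [add_mul, Finset.sum_add_distrib]
      smul_mem' := by
        rintro c _ ⟨E, hE, rfl⟩
        refine ⟨fun i j => c • E i j, fun i j => Subalgebra.smul_mem _ (hE i j) c, ?_⟩
        simp only [Finset.smul_sum, smul_mul_assoc] }
  have hS : ∀ s ∈ invariants, ∀ x ∈ N, s * x ∈ N := by
    rintro s hs _ ⟨E, hE, rfl⟩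
    refine ⟨fun i j => s * E i j, fun i j => mul_mem hs (hE i j), ?_⟩
    simp only [Finset.mul_sum, mul_assoc]
  have huu : ∀ i j, u i * u j ∈ N := fun i j => by
    refine ⟨fun k l => if (k, l) = (i, j) then 1 else 0, fun k l => ?_, ?_⟩
    · dsimp only
      split_ifs
      exacts [one_mem _, zero_mem _]
    · simp [Prod.ext_iff, ite_and]
  have hN : ∀ i j, ∀ x ∈ N, u i * v j * x ∈ N := by
    rintro i j _ ⟨E, hE, rfl⟩
    rw [Finset.mul_sum]
    refine sum_mem fun k _ => ?_
    rw [Finset.mul_sum]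
    refine sum_mem fun l _ => ?_
    -- a product `u i * u k * v j` is half an alternating sum of products of `u` with invariants
    have key : u i * v j * (E k l * (u k * u l)) = E k l * (algebraMap ℂ PairRing 2⁻¹ *
        ((u i * v j + u j * v i) * (u k * u l) + ((u k * v j + u j * v k) * (u i * u l)
          - (u i * v k + u k * v i) * (u j * u l)))) := by
      linear_combination -(u i * v j * (E k l * (u k * u l))) * half_mul_two
    rw [key]
    exact hS _ (hE k l) _ (hS _ half_mem _ (add_mem (hS _ (pairSym_mem_invariants _ _) _ (huu _ _))
      (sub_mem (hS _ (pairSym_mem_invariants _ _) _ (huu _ _))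
        (hS _ (pairSym_mem_invariants _ _) _ (huu _ _)))))
  refine weightSpace_le u v 2 N (fun s hs => ?_) hN (weightPart_mem 2 r)
  obtain ⟨i, j, rfl⟩ := Multiset.card_eq_two.1 hs
  simpa using huu i j

end PairRing

/-! ### The normal module: explicit solutions of the relations -/

section Polar

variable {Q : Type*} [CommRing Q]

/-- The standard symplectic form on four-dimensional space. -/
def sympForm (x y : Fin 4 → Q) : Q := x 0 * y 1 - x 1 * y 0 + x 2 * y 3 - x 3 * y 2

/-- The matrix of the standard symplectic form. -/
def sympMatrix (Q : Type*) [CommRing Q] : Fin 4 → Fin 4 → Q :=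
  ![![0, 1, 0, 0], ![-1, 0, 0, 0], ![0, 0, 0, 1], ![0, 0, -1, 0]]

/-- The derivative at `B` in the direction `X` of the entry `(i, j)` of `B J Bᵀ`. -/
def polar (B X : Fin 4 → Fin 4 → Q) (i j : Fin 4) : Q :=
  sympForm (X i) (B j) + sympForm (B i) (X j)

end Polar

namespace PairRing

/-- The symmetric matrix `u vᵀ + v uᵀ`. -/
def symUV (i j : Fin 4) : PairRing := u i * v j + u j * v i

theorem sympMatrix_mem (i j : Fin 4) : sympMatrix PairRing i j ∈ invariants := by
  fin_cases i <;> fin_cases j <;> simp [sympMatrix, one_mem, zero_mem]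

theorem sign_mem (i : Fin 4) : (![1, -1, 1, -1] i : PairRing) ∈ invariants := by
  fin_cases i
  exacts [one_mem _, neg_mem (one_mem _), one_mem _, neg_mem (one_mem _)]

theorem symUV_mem (i j : Fin 4) : symUV i j ∈ invariants := pairSym_mem_invariants i j

theorem swap_u (i : Fin 4) : swap (u i) = v i := lift_u _ _ _ _

theorem swap_v (i : Fin 4) : swap (v i) = u i := lift_v _ _ _ _

theorem swap_wedge (i j : Fin 4) : swap (wedge i j) = -wedge i j := by
  simp only [wedge, map_sub, map_mul, swap_u, swap_v]
  ring

/-- A vector that is linearly dependent with `u` and `v` is a combination of them. -/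
theorem exists_eq_combination (a : Fin 4 → PairRing)
    (h : ∀ i j k, a i * wedge j k + a j * wedge k i + a k * wedge i j = 0) :
    ∃ α β, ∀ i, a i = α * u i + β * v i := by
  obtain ⟨α, hα⟩ := exists_eq_mul_wedge (fun p : Fin 4 × Fin 4 => a p.1 * v p.2 - a p.2 * v p.1)
    (0, 1) (0, 2) (fun p => wedge p.1 p.2) rfl rfl (fun p q => by
      have h1 := h p.1 p.2 q.1
      have h2 := h p.1 p.2 q.2
      simp only [wedge] at h1 h2 ⊢
      linear_combination v q.2 * h1 - v q.1 * h2)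
  obtain ⟨β, hβ⟩ := exists_eq_mul_wedge (fun p : Fin 4 × Fin 4 => a p.2 * u p.1 - a p.1 * u p.2)
    (0, 1) (0, 2) (fun p => wedge p.1 p.2) rfl rfl (fun p q => by
      have h1 := h p.1 p.2 q.1
      have h2 := h p.1 p.2 q.2
      simp only [wedge] at h1 h2 ⊢
      linear_combination u q.1 * h2 - u q.2 * h1)
  refine ⟨α, β, fun i => mul_left_cancel₀ wedge_ne_zero ?_⟩
  have h1 := hα (0, 1)
  have h2 := hβ (0, 1)
  have h3 := h i 0 1
  simp only [wedge] at h1 h2 h3 ⊢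
  linear_combination h3 + u i * h1 + v i * h2

/-- A skew matrix whose product with `J u` and `J v` vanishes is a multiple of `u ∧ v`. -/
theorem exists_eq_mul_wedge_of_skew (h : Fin 4 → Fin 4 → PairRing) (hs : ∀ i j, h i j = -h j i)
    (hu : ∀ i, sympForm (h i) u = 0) (hv : ∀ i, sympForm (h i) v = 0) :
    ∃ c, ∀ i j, h i j = c * wedge i j := by
  have hd : ∀ i, h i i = 0 := fun i => by
    have := hs i i
    linear_combination (h i i) * -half_mul_two + algebraMap ℂ PairRing 2⁻¹ * this
  have om := omega_eq_zero
  have h10 := hs 1 0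
  have h20 := hs 2 0
  have h30 := hs 3 0
  have h21 := hs 2 1
  have h31 := hs 3 1
  have h32 := hs 3 2
  have u0 := hu 0
  have u1 := hu 1
  have u2 := hu 2
  have u3 := hu 3
  have v0 := hv 0
  have v1 := hv 1
  have v3 := hv 3
  simp only [sympForm, hd, h10, h20, h30, h21, h31, h32] at u0 u1 u2 u3 v0 v1 v3
  have key : ∀ k l, wedge 0 1 * h k l = wedge k l * h 0 1 := by
    have e02 : wedge 0 1 * h 0 2 = wedge 0 2 * h 0 1 := by
      simp only [wedge]; linear_combination v 2 * u0 - u 2 * v0 + h 0 2 * om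
    have e03 : wedge 0 1 * h 0 3 = wedge 0 3 * h 0 1 := by
      simp only [wedge]; linear_combination v 3 * u0 - u 3 * v0 + h 0 3 * om
    have e12 : wedge 0 1 * h 1 2 = wedge 1 2 * h 0 1 := by
      simp only [wedge]; linear_combination v 2 * u1 - u 2 * v1 + h 1 2 * om
    have e13 : wedge 0 1 * h 1 3 = wedge 1 3 * h 0 1 := by
      simp only [wedge]; linear_combination v 3 * u1 - u 3 * v1 + h 1 3 * om
    have e23 : wedge 0 1 * h 2 3 = wedge 2 3 * h 0 1 := by
      simp only [wedge]
      linear_combination -h 0 1 * om - u 0 * v1 - v 2 * u3 + v 3 * u2 + u 1 * v0 + h 2 3 * om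
    have hw : ∀ i j, wedge i j = -wedge j i := fun i j => by simp only [wedge]; ring
    have hwd : ∀ i, wedge i i = 0 := fun i => by simp only [wedge]; ring
    intro k l
    fin_cases k <;> fin_cases l <;>
      simp only [Fin.zero_eta, Fin.mk_one, Fin.reduceFinMk, hd, hwd, h10, h20, h30, h21, h31, h32,
        hw 1 0, hw 2 0, hw 3 0, hw 2 1, hw 3 1, hw 3 2] <;>
      first
      | ring1
      | linear_combination e02
      | linear_combination -e02
      | linear_combination e03
      | linear_combination -e03
      | linear_combination e12
      | linear_combination -e12
      | linear_combination e13
      | linear_combination -e13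
      | linear_combination e23
      | linear_combination -e23
  obtain ⟨c, hc⟩ := wedge_dvd (x := h 0 1) (y := h 0 2) (key 0 2).symm
  refine ⟨c, fun i j => mul_left_cancel₀ wedge_ne_zero ?_⟩
  rw [key, hc]
  ring

theorem torus_apply (r : PairRing) (n : ℤ) (hr : r ∈ weightSpace u v n) :
    torus r = AddMonoidAlgebra.single n r := by
  induction hr using Submodule.span_induction with
  | mem x hx =>
    obtain ⟨s, t, h, rfl⟩ := hx
    induction s using Multiset.induction_on generalizing n with
    | empty =>
      induction t using Multiset.induction_on generalizing n with
      | empty =>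
        simp only [Multiset.card_zero, Nat.cast_zero, sub_zero] at h
        subst h
        rw [Multiset.map_zero, Multiset.map_zero, Multiset.prod_zero, one_mul, map_one]
        rfl
      | cons i t ih =>
        simp only [Multiset.map_zero, Multiset.prod_zero, one_mul] at ih
        simp only [Multiset.map_cons, Multiset.prod_cons, Multiset.map_zero, Multiset.prod_zero,
          one_mul]
        rw [map_mul, ih (n + 1) (by simp at h ⊢; omega), torus, lift_v,
          AddMonoidAlgebra.single_mul_single]
        congr 1
        ring
    | cons i s ih =>
      simp only [Multiset.map_cons, Multiset.prod_cons, mul_assoc]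
      rw [map_mul, ih (n - 1) (by simp at h ⊢; omega), torus, lift_u,
        AddMonoidAlgebra.single_mul_single]
      congr 1
      ring
  | zero => simp
  | add x y _ _ hx hy => rw [map_add, hx, hy, AddMonoidAlgebra.single_add]
  | smul c x _ hx => rw [map_smul, hx, AddMonoidAlgebra.smul_single]

theorem weightPart_weightPart (n : ℤ) (r : PairRing) :
    weightPart n (weightPart n r) = weightPart n r := by
  rw [weightPart, torus_apply _ _ (weightPart_mem n r)]
  rw [AddMonoidAlgebra.coeff_single, Finsupp.single_eq_same]

theorem weightPart_mul_wedge (x : PairRing) (i j : Fin 4) :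
    weightPart 0 (x * wedge i j) = weightPart 0 x * wedge i j := by
  have e : x * wedge i j = x * u i * v j + (-x) * u j * v i := by simp only [wedge]; ring
  have hn : ∀ n, weightPart n (-x) = -weightPart n x := fun n => by simp [weightPart]
  rw [e, weightPart_add, weightPart_mul_v, weightPart_mul_v, weightPart_mul_u, weightPart_mul_u, hn,
    wedge]
  norm_num
  ring

theorem swap_sum_wedge {E : Fin 4 → Fin 4 → PairRing} (hE : ∀ i j, E i j ∈ invariants) :
    swap (∑ i, ∑ j, E i j * wedge i j) = -1 * ∑ i, ∑ j, E i j * wedge i j := by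
  simp only [map_sum, map_mul, swap_wedge, fun i j => swap_eq_self (hE i j), Finset.mul_sum]
  exact Finset.sum_congr rfl fun i _ => Finset.sum_congr rfl fun j _ => by ring

/-- An element of weight `0` that is fixed by the exchange of `u` and `v` is a function of
`u vᵀ + v uᵀ`. -/
theorem mem_invariants_of_swap {r : PairRing} (h0 : weightPart 0 r = r) (hr : swap r = r) :
    r ∈ invariants := by
  obtain ⟨s, hs, E, hE, h⟩ := weightPart_zero_eq r
  have h1 := congrArg swap (h0.symm.trans h)
  rw [hr, map_add, swap_eq_self hs] at h1
  rw [swap_sum_wedge hE] at h1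
  have : r = s := by
    linear_combination -(r - s) * half_mul_two + algebraMap ℂ PairRing 2⁻¹ * (h1 + h0.symm.trans h)
  rwa [this]

/-- An element of weight `0` that changes sign under the exchange of `u` and `v` is a combination
of the coordinates of `u ∧ v`. -/
theorem exists_eq_sum_wedge_of_swap {r : PairRing} (h0 : weightPart 0 r = r) (hr : swap r = -r) :
    ∃ E : Fin 4 → Fin 4 → PairRing, (∀ i j, E i j ∈ invariants) ∧
      r = ∑ i, ∑ j, E i j * wedge i j := by
  obtain ⟨s, hs, E, hE, h⟩ := weightPart_zero_eq r
  refine ⟨E, hE, ?_⟩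
  have h1 := congrArg swap (h0.symm.trans h)
  rw [hr, map_add, swap_eq_self hs] at h1
  rw [swap_sum_wedge hE] at h1
  linear_combination -(r - ∑ i, ∑ j, E i j * wedge i j) * half_mul_two
    + algebraMap ℂ PairRing 2⁻¹ * (h0.symm.trans h - h1)

/-- The matrix `J X J`. -/
def conjJ {Q : Type*} [CommRing Q] (X : Fin 4 → Fin 4 → Q) (i j : Fin 4) : Q :=
  -((![1, -1, 1, -1] i : Q) * ![1, -1, 1, -1] j * X (![1, 0, 3, 2] i) (![1, 0, 3, 2] j))

theorem sympForm_polar_conjJ (X : Fin 4 → Fin 4 → PairRing) (hX : ∀ i j, X i j = X j i)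
    (i : Fin 4) :
    sympForm (polar symUV (conjJ X) i) u =
      (∑ k, ∑ l, X k l * (v k * u l)) * u i + (∑ k, ∑ l, X k l * (u k * u l)) * v i := by
  have om := omega_eq_zero
  have h : sympForm (polar symUV (conjJ X) i) u - ((∑ k, ∑ l, X k l * (v k * u l)) * u i +
      (∑ k, ∑ l, X k l * (u k * u l)) * v i) = -sympForm (conjJ X i) u *
        (u 0 * v 1 - u 1 * v 0 + u 2 * v 3 - u 3 * v 2) := by
    simp only [sympForm, polar, symUV, conjJ, Fin.sum_univ_four]
    simp only [Matrix.cons_val, hX 1 0, hX 2 0, hX 3 0, hX 2 1, hX 3 1, hX 3 2]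
    ring
  linear_combination h - sympForm (conjJ X i) u * om

/-- For a skew matrix `E`, the matrix `J E B + B E J`. -/
def skewDirection {Q : Type*} [CommRing Q] (E B : Fin 4 → Fin 4 → Q) (i j : Fin 4) : Q :=
  ![1, -1, 1, -1] i * (∑ k, E (![1, 0, 3, 2] i) k * B k j)
    + ![1, -1, 1, -1] j * (∑ k, E (![1, 0, 3, 2] j) k * B k i)

theorem polar_skewDirection (E : Fin 4 → Fin 4 → PairRing) (hE : ∀ i j, E i j = -E j i)
    (i j : Fin 4) : polar symUV (skewDirection E symUV) i j =
      (∑ k, ∑ l, E k l * wedge k l) * wedge i j := by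
  have om := omega_eq_zero
  have hd : ∀ i, E i i = 0 := fun i => by
    linear_combination (E i i) * -half_mul_two + algebraMap ℂ PairRing 2⁻¹ * hE i i
  have h : polar symUV (skewDirection E symUV) i j - (∑ k, ∑ l, E k l * wedge k l) * wedge i j =
      -(![1, -1, 1, -1] i * (∑ k, E (![1, 0, 3, 2] i) k * wedge k j)
        + ![1, -1, 1, -1] j * (∑ k, E (![1, 0, 3, 2] j) k * wedge i k)) *
        (u 0 * v 1 - u 1 * v 0 + u 2 * v 3 - u 3 * v 2) := by
    simp only [polar, sympForm, skewDirection, symUV, wedge, Fin.sum_univ_four, Matrix.cons_val, hd,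
      hE 1 0, hE 2 0, hE 3 0, hE 2 1, hE 3 1, hE 3 2]
    ring
  rw [om] at h
  linear_combination h

/-- The normal vector fields: a skew matrix `H` with the symmetry that is forced by
`(B J B) J B = B J (B J B)` is the derivative of `B J B` in the direction of a symmetric matrix, up
to a multiple of `J`. -/
theorem exists_eq_polar_add (H : Fin 4 → Fin 4 → PairRing) (hH : ∀ i j, H i j ∈ invariants)
    (hs : ∀ i j, H i j = -H j i)
    (hr : ∀ i j, sympForm (symUV i) (fun k => H k j) = sympForm (H i) (symUV j)) :
    ∃ X : Fin 4 → Fin 4 → PairRing, (∀ i j, X i j ∈ invariants) ∧ (∀ i j, X i j = X j i) ∧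
      ∃ s ∈ invariants, ∀ i j, H i j = polar symUV X i j + s * sympMatrix PairRing i j := by
  have om := omega_eq_zero
  let a : Fin 4 → PairRing := fun i => sympForm (H i) u
  let c : Fin 4 → PairRing := fun i => sympForm (H i) v
  have star : ∀ i j, u i * c j + v i * a j = a i * v j + c i * u j := by
    intro i j
    have := hr i j
    simp only [sympForm, symUV] at this
    simp only [a, c, sympForm]
    rw [hs 0 j, hs 1 j, hs 2 j, hs 3 j] at this
    linear_combination this
  have hac : ∀ i, swap (a i) = c i := fun i => by
    simp only [a, c, sympForm, map_sub, map_add, map_mul, swap_u, fun i j => swap_eq_self (hH i j)]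
  obtain ⟨α, β, hα0, hβ2, ha⟩ : ∃ α β, weightPart 0 α = α ∧ weightPart 2 β = β ∧
      ∀ i, a i = α * u i + β * v i := by
    obtain ⟨α, β, h⟩ := exists_eq_combination a (fun i j k => by
      simp only [wedge]
      linear_combination u i * star j k + u j * star k i + u k * star i j)
    refine ⟨weightPart 0 α, weightPart 2 β, weightPart_weightPart _ _, weightPart_weightPart _ _,
      fun i => ?_⟩
    have h1 := congrArg (weightPart 1) (h i)
    rw [weightPart_add, weightPart_mul_u, weightPart_mul_v] at h1
    norm_num at h1
    rw [← h1]
    have e : a i = H i 0 * u 1 + -H i 1 * u 0 + H i 2 * u 3 + -H i 3 * u 2 := by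
      simp only [a, sympForm]; ring
    rw [e]
    simp only [weightPart_add, weightPart_mul_u]
    norm_num
    rw [weightPart_zero_invariant (hH i 0), weightPart_zero_invariant (neg_mem (hH i 1)),
      weightPart_zero_invariant (hH i 2), weightPart_zero_invariant (neg_mem (hH i 3))]
  have hc : ∀ i, c i = swap β * u i + swap α * v i := fun i => by
    rw [← hac, ha, map_add, map_mul, map_mul, swap_u, swap_v, add_comm]
  have hα : swap α = α := mul_right_cancel₀ wedge_ne_zero (by
    have := star 0 1
    rw [hc, hc, ha, ha] at this
    simp only [wedge]
    linear_combination this)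
  have hα' := mem_invariants_of_swap hα0 hα
  obtain ⟨E, hE, hβ⟩ := weightPart_two_eq β
  rw [hβ2] at hβ
  let X : Fin 4 → Fin 4 → PairRing := fun i j => algebraMap ℂ PairRing 2⁻¹ * (E i j + E j i)
  have hX : ∀ i j, X i j ∈ invariants := fun i j => mul_mem half_mem (add_mem (hE _ _) (hE _ _))
  have hXs : ∀ i j, X i j = X j i := fun i j => by simp only [X, add_comm]
  have hY : ∀ i j, conjJ X i j ∈ invariants := fun i j =>
    neg_mem (mul_mem (mul_mem (sign_mem i) (sign_mem j)) (hX _ _))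
  have hYs : ∀ i j, conjJ X i j = conjJ X j i := fun i j => by
    simp only [conjJ]; rw [hXs]; ring
  have hβX : β = ∑ k, ∑ l, X k l * (u k * u l) := by
    have h : ∑ k, ∑ l, X k l * (u k * u l) = algebraMap ℂ PairRing 2⁻¹ * 2 *
        ∑ k, ∑ l, E k l * (u k * u l) := by
      simp only [X, Fin.sum_univ_four]
      ring
    rw [h, half_mul_two, hβ, one_mul]
  let s : PairRing := ∑ k, ∑ l, X k l * (v k * u l)
  have hs' : s ∈ invariants := by
    have h : s = algebraMap ℂ PairRing 2⁻¹ * ∑ k, ∑ l, E k l * symUV k l := by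
      simp only [s, X, symUV, Fin.sum_univ_four]
      ring
    rw [h]
    exact mul_mem half_mem (sum_mem fun k _ => sum_mem fun l _ => mul_mem (hE k l) (symUV_mem k l))
  -- after subtraction of the derivative in the direction `J X J`, the matrix acts as a scalar
  -- on `J u`
  let H' : Fin 4 → Fin 4 → PairRing := fun i j =>
    H i j - polar symUV (conjJ X) i j + (α - s) * sympMatrix PairRing i j
  have hform : ∀ x y : Fin 4 → PairRing, (∀ i, x i ∈ invariants) → (∀ i, y i ∈ invariants) →
      sympForm x y ∈ invariants := fun x y hx hy =>
    sub_mem (add_mem (sub_mem (mul_mem (hx _) (hy _)) (mul_mem (hx _) (hy _)))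
      (mul_mem (hx _) (hy _))) (mul_mem (hx _) (hy _))
  have hH' : ∀ i j, H' i j ∈ invariants := fun i j =>
    add_mem (sub_mem (hH i j) (add_mem (hform _ _ (hY i) (symUV_mem j))
      (hform _ _ (symUV_mem i) (hY j)))) (mul_mem (sub_mem hα' hs') (sympMatrix_mem i j))
  have hs'' : ∀ i j, H' i j = -H' j i := fun i j => by
    have h1 : sympMatrix PairRing i j = -sympMatrix PairRing j i := by
      fin_cases i <;> fin_cases j <;> simp [sympMatrix]
    have h2 : polar symUV (conjJ X) i j = -polar symUV (conjJ X) j i := by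
      simp only [polar, sympForm]; ring
    simp only [H']
    rw [hs i j, h1, h2]
    ring
  have hu' : ∀ i, sympForm (H' i) u = 0 := fun i => by
    have h1 : sympForm (H' i) u = a i - sympForm (polar symUV (conjJ X) i) u
        + (α - s) * sympForm (sympMatrix PairRing i) u := by
      simp only [sympForm, H', a]; ring
    have h2 : sympForm (sympMatrix PairRing i) u = -u i := by
      fin_cases i <;>
        simp only [Fin.zero_eta, Fin.mk_one, Fin.reduceFinMk, sympMatrix, sympForm,
          Matrix.cons_val] <;>
        ring
    rw [h1, h2, sympForm_polar_conjJ X hXs, ha, ← hβX]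
    simp only [s]
    ring
  have hv' : ∀ i, sympForm (H' i) v = 0 := fun i => by
    have := congrArg swap (hu' i)
    simpa only [sympForm, map_sub, map_add, map_mul, swap_u, fun i j => swap_eq_self (hH' i j),
      map_zero] using this
  obtain ⟨κ, hκ⟩ := exists_eq_mul_wedge_of_skew H' hs'' hu' hv'
  obtain ⟨e, he, hκe⟩ := exists_eq_sum_wedge_of_swap (r := κ) (mul_right_cancel₀ wedge_ne_zero (by
      rw [← weightPart_mul_wedge, ← hκ, weightPart_zero_invariant (hH' _ _)]))
    (mul_right_cancel₀ wedge_ne_zero (by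
      have := congrArg swap (hκ 0 1)
      rw [swap_eq_self (hH' _ _), hκ, map_mul, swap_wedge] at this
      linear_combination this))
  let F : Fin 4 → Fin 4 → PairRing := fun i j => algebraMap ℂ PairRing 2⁻¹ * (e i j - e j i)
  have hF : ∀ i j, F i j ∈ invariants := fun i j => mul_mem half_mem (sub_mem (he _ _) (he _ _))
  have hFs : ∀ i j, F i j = -F j i := fun i j => by simp only [F]; ring
  have hκF : κ = ∑ k, ∑ l, F k l * wedge k l := by
    have h : ∑ k, ∑ l, F k l * wedge k l = algebraMap ℂ PairRing 2⁻¹ * 2 *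
        ∑ k, ∑ l, e k l * wedge k l := by
      simp only [F, wedge, Fin.sum_univ_four]
      ring
    rw [h, half_mul_two, hκe, one_mul]
  have hZs : ∀ i j, skewDirection F symUV i j = skewDirection F symUV j i := fun i j =>
    add_comm _ _
  refine ⟨fun i j => conjJ X i j + skewDirection F symUV i j, fun i j => add_mem (hY i j) ?_,
    fun i j => ?_, -(α - s), neg_mem (sub_mem hα' hs'), fun i j => ?_⟩
  · exact add_mem (mul_mem (sign_mem i) (sum_mem fun k _ => mul_mem (hF _ _) (symUV_mem _ _)))
      (mul_mem (sign_mem j) (sum_mem fun k _ => mul_mem (hF _ _) (symUV_mem _ _)))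
  · exact congrArg₂ (· + ·) (hYs i j) (hZs i j)
  · have h1 := hκ i j
    have h2 := polar_skewDirection F hFs i j
    rw [← hκF] at h2
    simp only [H'] at h1
    rw [← h2] at h1
    simp only [polar, sympForm] at h1 ⊢
    linear_combination h1

end PairRing

/-! ### The annihilator of the generator of the normal module -/

namespace PairRing

/-- The matrix `Z B W + W B Z`. -/
def sandwich {Q : Type*} [CommRing Q] (B Z W : Fin 4 → Fin 4 → Q) (i j : Fin 4) : Q :=
  ∑ k, ∑ l, (Z i k * B k l * W l j + W i k * B k l * Z l j)

set_option maxHeartbeats 1000000 in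
/-- The skew matrices `Z` with `Z₀₁ + Z₂₃ = 0` form a Clifford system for `J`, whence the
derivative of `B J B` in the direction `J (Z B W + W B Z) J` is a multiple of `J`. -/
theorem polar_conjJ_sandwich {Z W : Fin 4 → Fin 4 → PairRing} (hZ : ∀ i j, Z i j = -Z j i)
    (hW : ∀ i j, W i j = -W j i) (hZJ : Z 0 1 + Z 2 3 = 0) (hWJ : W 0 1 + W 2 3 = 0) (i j : Fin 4) :
    polar symUV (conjJ (sandwich symUV Z W)) i j =
      -2 * (∑ k, ∑ l, u k * Z k l * v l) * (∑ k, ∑ l, u k * W k l * v l)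
        * sympMatrix PairRing i j := by
  have om := omega_eq_zero
  have hd : ∀ {Z : Fin 4 → Fin 4 → PairRing}, (∀ i j, Z i j = -Z j i) → ∀ i, Z i i = 0 :=
    fun {Z} hZ i => by
      linear_combination (Z i i) * -half_mul_two + algebraMap ℂ PairRing 2⁻¹ * hZ i i
  have hZ' : Z 2 3 = -Z 0 1 := by linear_combination hZJ
  have hW' : W 2 3 = -W 0 1 := by linear_combination hWJ
  have h : polar symUV (conjJ (sandwich symUV Z W)) i j -
      -2 * (∑ k, ∑ l, u k * Z k l * v l) * (∑ k, ∑ l, u k * W k l * v l)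
        * sympMatrix PairRing i j = ((∑ k, ∑ l, u k * W k l * v l) * conjJ Z i j +
      (∑ k, ∑ l, u k * Z k l * v l) * conjJ W i j) *
        (u 0 * v 1 - u 1 * v 0 + u 2 * v 3 - u 3 * v 2) := by
    simp only [polar, sympForm, sandwich, symUV, Fin.sum_univ_four, conjJ, sympMatrix]
    fin_cases i <;> fin_cases j <;>
      simp only [Fin.zero_eta, Fin.mk_one, Fin.reduceFinMk, Matrix.cons_val, hd hZ, hd hW,
        hZ 1 0, hZ 2 0, hZ 3 0, hZ 2 1, hZ 3 1, hZ 3 2, hW 1 0, hW 2 0, hW 3 0, hW 2 1, hW 3 1,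
        hW 3 2, hZ', hW'] <;>
      ring1
  rw [om] at h
  linear_combination h

/-- The matrix of the `2`-form `(x, y) ↦ xᵢ yⱼ - xⱼ yᵢ`, made orthogonal to `J`. -/
def elementarySkew (i j p q : Fin 4) : PairRing :=
  (if p = i then 1 else 0) * (if q = j then 1 else 0)
    - (if p = j then 1 else 0) * (if q = i then 1 else 0)
    - algebraMap ℂ PairRing 2⁻¹ * sympMatrix PairRing i j * sympMatrix PairRing p q

/-- A product of two coordinates of `u ∧ v` carries `J` to a derivative of `B J B`. -/
theorem exists_polar_eq_wedge_mul_wedge (i j k l : Fin 4) :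
    ∃ X : Fin 4 → Fin 4 → PairRing, (∀ p q, X p q ∈ invariants) ∧ (∀ p q, X p q = X q p) ∧
      ∀ p q, polar symUV X p q = wedge i j * wedge k l * sympMatrix PairRing p q := by
  have om := omega_eq_zero
  have hJs : ∀ i j, sympMatrix PairRing i j = -sympMatrix PairRing j i := fun i j => by
    fin_cases i <;> fin_cases j <;> simp [sympMatrix]
  have hZ : ∀ i j p q, elementarySkew i j p q = -elementarySkew i j q p := fun i j p q => by
    simp only [elementarySkew]
    rw [hJs p q]
    ring
  have hZJ : ∀ i j, elementarySkew i j 0 1 + elementarySkew i j 2 3 = 0 := fun i j => by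
    have h : sympMatrix PairRing i j * (algebraMap ℂ PairRing 2⁻¹ * 2 - 1) = 0 := by
      rw [half_mul_two]; ring
    fin_cases i <;> fin_cases j <;> simp [elementarySkew, sympMatrix] at h ⊢ <;>
      first
      | linear_combination -h
      | linear_combination h
  have hmem : ∀ i j p q, elementarySkew i j p q ∈ invariants := fun i j p q => by
    refine sub_mem (sub_mem ?_ ?_) (mul_mem (mul_mem half_mem (sympMatrix_mem _ _))
      (sympMatrix_mem _ _)) <;>
      refine mul_mem ?_ ?_ <;> split_ifs <;> first | exact one_mem _ | exact zero_mem _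
  have hw : ∀ i j, ∑ p, ∑ q, u p * elementarySkew i j p q * v q = wedge i j := fun i j => by
    have h : ∑ p, ∑ q, u p * elementarySkew i j p q * v q = wedge i j -
        algebraMap ℂ PairRing 2⁻¹ * sympMatrix PairRing i j *
          (u 0 * v 1 - u 1 * v 0 + u 2 * v 3 - u 3 * v 2) := by
      have e : ∀ i j, ∑ p, ∑ q, u p * ((if p = i then 1 else 0) * (if q = j then 1 else 0)) * v q =
          u i * v j := fun i j => by
        rw [Finset.sum_eq_single i (fun p _ hp => Finset.sum_eq_zero fun q _ => by
          rw [if_neg hp]; ring) (fun h => absurd (Finset.mem_univ _) h),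
          Finset.sum_eq_single j (fun q _ hq => by rw [if_neg hq]; ring)
            (fun h => absurd (Finset.mem_univ _) h), if_pos rfl, if_pos rfl]
        ring
      simp only [elementarySkew, mul_sub, sub_mul, Finset.sum_sub_distrib, e, wedge]
      simp only [Fin.sum_univ_four, sympMatrix, Matrix.cons_val]
      ring
    rw [h, om]
    ring
  have hsm : ∀ p q, sandwich symUV (elementarySkew i j) (elementarySkew k l) p q ∈ invariants :=
    fun p q => sum_mem fun a _ => sum_mem fun b _ => add_mem
      (mul_mem (mul_mem (hmem _ _ _ _) (symUV_mem _ _)) (hmem _ _ _ _))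
      (mul_mem (mul_mem (hmem _ _ _ _) (symUV_mem _ _)) (hmem _ _ _ _))
  refine ⟨fun p q => -(algebraMap ℂ PairRing 2⁻¹ *
    conjJ (sandwich symUV (elementarySkew i j) (elementarySkew k l)) p q), fun p q => ?_,
    fun p q => ?_, fun p q => ?_⟩
  · exact neg_mem (mul_mem half_mem (neg_mem (mul_mem
    (mul_mem (sign_mem p) (sign_mem q)) (hsm _ _))))
  · have hs : ∀ p q, sandwich symUV (elementarySkew i j) (elementarySkew k l) p q =
        sandwich symUV (elementarySkew i j) (elementarySkew k l) q p := fun p q => by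
      rw [sandwich, sandwich, Finset.sum_comm]
      refine Finset.sum_congr rfl fun a _ => Finset.sum_congr rfl fun b _ => ?_
      rw [hZ i j p b, hZ k l p b, hZ i j a q, hZ k l a q, symUV, symUV]
      ring
    simp only [conjJ]
    rw [hs]
    ring
  · have h := polar_conjJ_sandwich (hZ i j) (hZ k l) (hZJ i j) (hZJ k l) p q
    rw [hw, hw] at h
    have h' : polar symUV (fun p q => -(algebraMap ℂ PairRing 2⁻¹ *
        conjJ (sandwich symUV (elementarySkew i j) (elementarySkew k l)) p q)) p q =
        -(algebraMap ℂ PairRing 2⁻¹ *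
        polar symUV (conjJ (sandwich symUV (elementarySkew i j) (elementarySkew k l))) p q) := by
      simp only [polar, sympForm]
      ring
    rw [h', h]
    linear_combination (wedge i j * wedge k l * sympMatrix PairRing p q) * half_mul_two

/-- The specialization `u = v = x`. -/
def diagonal : PairRing →ₐ[ℂ] MvPolynomial (Fin 4) ℂ := lift MvPolynomial.X MvPolynomial.X (by ring)

/-- If `c J` is a derivative of `B J B`, then `c` vanishes on the matrices of rank one, for on
these matrices a derivative of `B J B` has rank at most two. -/
theorem diagonal_eq_zero_of_polar {c : PairRing} {X : Fin 4 → Fin 4 → PairRing}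
    (h : ∀ p q, polar symUV X p q = c * sympMatrix PairRing p q) : diagonal c = 0 := by
  let y : Fin 4 → MvPolynomial (Fin 4) ℂ := fun i =>
    2 * sympForm (fun j => diagonal (X i j)) MvPolynomial.X
  have hy : ∀ p q, diagonal (polar symUV X p q) =
    y p * MvPolynomial.X q - MvPolynomial.X p * y q := by
    intro p q
    simp only [polar, sympForm, symUV, map_add, map_sub, map_mul, diagonal, lift_u, lift_v, y]
    ring
  have hc : diagonal c * diagonal c = 0 := by
    have h01 := hy 0 1
    have h23 := hy 2 3
    have h13 := hy 1 3
    have h12 := hy 1 2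
    rw [h, map_mul] at h01 h23 h13 h12
    simp only [sympMatrix, Matrix.cons_val, map_one, map_zero, mul_one, mul_zero]
      at h01 h23 h13 h12
    -- the Pfaffian of a matrix of rank two vanishes, and the one of `c J` is `c ^ 2`
    linear_combination h01 * diagonal c + (y 0 * MvPolynomial.X 1 - MvPolynomial.X 0 * y 1) * h23 -
      (y 0 * MvPolynomial.X 2 - MvPolynomial.X 0 * y 2) * h13 +
      (y 0 * MvPolynomial.X 3 - MvPolynomial.X 0 * y 3) * h12
  exact mul_self_eq_zero.1 hc

end PairRing

/-! ### The normal module in linear coordinates -/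

section NormalModule

open MvPolynomial PairRing

variable {ι : Type*} [Fintype ι]

/-- The data of linear coordinates `X i` on the space of symmetric `4 × 4` matrices: the entries of
the matrix are the elements `y s`, the ring homomorphism `ρ` is the restriction of functions to the
matrices `u vᵀ + v uᵀ` with `ω(u, v) = 0`, and `I` is its kernel. The last field says that the
coordinate change identifies the vector fields in the two systems of coordinates. -/
structure IsPairPresentation (I : Ideal (MvPolynomial ι ℂ)) (ρ : MvPolynomial ι ℂ →ₐ[ℂ] PairRing)
    (y : Sym2 (Fin 4) → MvPolynomial ι ℂ) : Prop where
  ker_eq : RingHom.ker ρ = I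
  map_entry : ∀ s, ρ (y s) = pairSym u v s
  surjective : Function.Surjective (aeval (R := ℂ) y)
  exists_field : ∀ X : Sym2 (Fin 4) → MvPolynomial ι ℂ ⧸ I, ∃ a : ι → MvPolynomial ι ℂ ⧸ I,
    ∀ s, ∑ i, a i * Ideal.Quotient.mk I (pderiv i (y s)) = X s

namespace IsPairPresentation

variable {I : Ideal (MvPolynomial ι ℂ)} {ρ : MvPolynomial ι ℂ →ₐ[ℂ] PairRing}
  {y : Sym2 (Fin 4) → MvPolynomial ι ℂ}

theorem map_aeval (h : IsPairPresentation I ρ y) (f : MvPolynomial (Sym2 (Fin 4)) ℂ) :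
    ρ (aeval y f) = aeval (pairSym u v) f := by
  have : ρ.comp (aeval y) = aeval (pairSym u v) := algHom_ext fun s => by simp [h.map_entry]
  exact DFunLike.congr_fun this f

theorem mem_iff (h : IsPairPresentation I ρ y) {f : MvPolynomial ι ℂ} : f ∈ I ↔ ρ f = 0 := by
  rw [← h.ker_eq, RingHom.mem_ker]

/-- The embedding of the coordinate ring into `PairRing`. -/
def embedding (h : IsPairPresentation I ρ y) : MvPolynomial ι ℂ ⧸ I →ₐ[ℂ] PairRing :=
  Ideal.Quotient.liftₐ I ρ fun _ ha => h.mem_iff.1 ha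

@[simp] theorem embedding_mk (h : IsPairPresentation I ρ y) (f : MvPolynomial ι ℂ) :
    h.embedding (Ideal.Quotient.mk I f) = ρ f := rfl

theorem embedding_injective (h : IsPairPresentation I ρ y) : Function.Injective h.embedding := by
  rw [injective_iff_map_eq_zero]
  intro x hx
  obtain ⟨f, rfl⟩ := Ideal.Quotient.mk_surjective x
  exact Ideal.Quotient.eq_zero_iff_mem.2 (h.mem_iff.2 hx)

theorem embedding_mem (h : IsPairPresentation I ρ y) (x : MvPolynomial ι ℂ ⧸ I) :
    h.embedding x ∈ invariants := by
  obtain ⟨f, rfl⟩ := Ideal.Quotient.mk_surjective x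
  obtain ⟨g, rfl⟩ := h.surjective f
  exact ⟨g, (h.map_aeval g).symm⟩

theorem exists_embedding_eq (h : IsPairPresentation I ρ y) {r : PairRing} (hr : r ∈ invariants) :
    ∃ x, h.embedding x = r := by
  obtain ⟨g, rfl⟩ := hr
  exact ⟨Ideal.Quotient.mk I (aeval y g), h.map_aeval g⟩

theorem isDomain (h : IsPairPresentation I ρ y) : IsDomain (MvPolynomial ι ℂ ⧸ I) :=
  h.embedding_injective.isDomain

theorem map_symMat (h : IsPairPresentation I ρ y) (i j : Fin 4) : ρ (symMat y i j) = symUV i j :=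
  h.map_entry _

/-- The entries of `B J B`, as elements of the ideal. -/
def equation (h : IsPairPresentation I ρ y) (i j : Fin 4) : I :=
  ⟨sqEntry (symMat y) i j, h.mem_iff.2 (by
    simp only [sqEntry, map_sub, map_add, map_mul, h.map_symMat, symUV]
    linear_combination (u j * v i - u i * v j) * omega_eq_zero)⟩

/-- The ideal is generated by the entries of `B J B`. -/
theorem mem_span_equation (h : IsPairPresentation I ρ y) {f : MvPolynomial ι ℂ} (hf : f ∈ I) :
    f ∈ Ideal.span (Set.range fun p : Fin 4 × Fin 4 =>
        (h.equation p.1 p.2 : MvPolynomial ι ℂ)) := by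
  obtain ⟨g, rfl⟩ := h.surjective f
  rw [← Ideal.Quotient.eq_zero_iff_mem]
  set K := Ideal.span (Set.range fun p : Fin 4 × Fin 4 => (h.equation p.1 p.2 : MvPolynomial ι ℂ))
  have h1 : (Ideal.Quotient.mkₐ ℂ K).comp (aeval y) = aeval (fun s => Ideal.Quotient.mk K (y s)) :=
    algHom_ext fun s => by simp
  have h2 := DFunLike.congr_fun h1 g
  refine Eq.trans h2 (aeval_eq_zero_of_aeval_pairSym _ (fun i j => ?_) g ?_)
  · have : Ideal.Quotient.mk K (h.equation i j) = 0 :=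
      Ideal.Quotient.eq_zero_iff_mem.2 (Ideal.subset_span ⟨(i, j), rfl⟩)
    simpa [equation, sqEntry, symMat] using this
  · rw [← h.map_aeval]
    exact h.mem_iff.1 hf

section Normal

variable (ψ : I.Cotangent →ₗ[MvPolynomial ι ℂ ⧸ I] MvPolynomial ι ℂ ⧸ I)

theorem _root_.Ideal.Cotangent.map_smul_toCotangent {R : Type*} [CommRing R] {I : Ideal R}
    (ψ : I.Cotangent →ₗ[R ⧸ I] R ⧸ I) (r : R) (f : I) :
    ψ (I.toCotangent (r • f)) = Ideal.Quotient.mk I r * ψ (I.toCotangent f) := by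
  rw [map_smul]
  exact (ψ.restrictScalars R).map_smul r _

/-- The images of the entries of `B J B` under a homomorphism on the conormal module. -/
def normalMatrix (h : IsPairPresentation I ρ y) (i j : Fin 4) : PairRing :=
  h.embedding (ψ (I.toCotangent (h.equation i j)))

theorem normalMatrix_skew (h : IsPairPresentation I ρ y) (i j : Fin 4) :
    h.normalMatrix ψ i j = -h.normalMatrix ψ j i := by
  have : h.equation i j = -h.equation j i := Subtype.ext (by
    simp only [equation, sqEntry, Submodule.coe_neg]; ring)
  rw [normalMatrix, this, map_neg, map_neg, map_neg]
  rfl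

/-- The syzygy `(B J B) J B = B J (B J B)`. -/
theorem normalMatrix_relation (h : IsPairPresentation I ρ y) (i j : Fin 4) :
    sympForm (symUV i) (fun k => h.normalMatrix ψ k j) =
      sympForm (h.normalMatrix ψ i) (symUV j) := by
  have e : symMat y i 0 • h.equation 1 j - symMat y i 1 • h.equation 0 j
      + symMat y i 2 • h.equation 3 j - symMat y i 3 • h.equation 2 j =
      symMat y j 1 • h.equation i 0 - symMat y j 0 • h.equation i 1
      + symMat y j 3 • h.equation i 2 - symMat y j 2 • h.equation i 3 := Subtype.ext (by
    simp only [equation, sqEntry, Submodule.coe_sub, Submodule.coe_add, Submodule.coe_smul,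
      smul_eq_mul, symMat_comm y 1 0, symMat_comm y 2 0, symMat_comm y 3 0, symMat_comm y 2 1,
      symMat_comm y 3 1, symMat_comm y 3 2]
    ring)
  have := congrArg (fun f => h.embedding (ψ (I.toCotangent f))) e
  simp only [map_add, map_sub, Ideal.Cotangent.map_smul_toCotangent, map_mul, embedding_mk,
    h.map_symMat] at this
  simp only [sympForm, normalMatrix]
  linear_combination this

/-- A homomorphism on the conormal module is determined by its values on the entries of `B J B`. -/
theorem ext_normalMatrix (h : IsPairPresentation I ρ y)
    {ψ φ : I.Cotangent →ₗ[MvPolynomial ι ℂ ⧸ I] MvPolynomial ι ℂ ⧸ I}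
    (H : ∀ i j, h.normalMatrix ψ i j = h.normalMatrix φ i j) : ψ = φ := by
  have key : ∀ f, ∀ hf : f ∈ Ideal.span (Set.range fun p : Fin 4 × Fin 4 =>
      (h.equation p.1 p.2 : MvPolynomial ι ℂ)), ∀ hI : f ∈ I,
      ψ (I.toCotangent ⟨f, hI⟩) = φ (I.toCotangent ⟨f, hI⟩) := by
    intro f hf hI
    have hle : Ideal.span (Set.range fun p : Fin 4 × Fin 4 =>
      (h.equation p.1 p.2 : MvPolynomial ι ℂ)) ≤ I := Ideal.span_le.2 (by
        rintro _ ⟨p, rfl⟩; exact (h.equation p.1 p.2).2)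
    induction hf using Submodule.span_induction with
    | mem x hx =>
      obtain ⟨p, rfl⟩ := hx
      exact h.embedding_injective (H p.1 p.2)
    | zero => rw [show (⟨0, hI⟩ : I) = 0 from rfl, map_zero, map_zero, map_zero]
    | add a b ha hb iha ihb =>
      have : (⟨a + b, hI⟩ : I) = ⟨a, hle ha⟩ + ⟨b, hle hb⟩ := rfl
      rw [this, map_add, map_add, map_add, iha, ihb]
    | smul r a ha iha =>
      have : (⟨r • a, hI⟩ : I) = r • ⟨a, hle ha⟩ := rfl
      rw [this, Ideal.Cotangent.map_smul_toCotangent, Ideal.Cotangent.map_smul_toCotangent, iha]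
  ext x
  obtain ⟨f, rfl⟩ := I.toCotangent_surjective x
  exact key f (h.mem_span_equation f.2) f.2

theorem normalMatrix_tangentToNormal (h : IsPairPresentation I ρ y) (a : ι → MvPolynomial ι ℂ ⧸ I)
    (i j : Fin 4) : h.normalMatrix (tangentToNormal I a) i j = polar symUV (symMat fun s =>
      h.embedding (∑ k, a k * Ideal.Quotient.mk I (pderiv k (y s)))) i j := by
  rw [normalMatrix, tangentToNormal_apply]
  have : ∀ k, pderiv k (sqEntry (symMat y) i j) =
      polar (symMat y) (fun p q => pderiv k (symMat y p q)) i j := fun k => by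
    simp only [sqEntry, polar, sympForm, map_add, map_sub, Derivation.leibniz, smul_eq_mul]
    ring
  simp only [equation, this]
  simp only [polar, sympForm, symMat, map_sum, map_mul, embedding_mk, Finset.sum_mul,
    Finset.mul_sum,
    ← Finset.sum_add_distrib, ← Finset.sum_sub_distrib]
  refine Finset.sum_congr rfl fun k _ => ?_
  simp only [map_add, map_sub, map_mul, h.map_entry, pairSym_mk, symUV]
  ring

end Normal
end IsPairPresentation

theorem algHom_aeval_C_mul_X {σ k E : Type*} [Field k] [CommRing E] [Algebra k E]
    (χ : MvPolynomial σ k →ₐ[k] E) (c : k) (g : MvPolynomial σ k) :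
    χ (aeval (R := k) (fun s => (C c * X s : MvPolynomial σ k)) g) =
      aeval (fun s => algebraMap k E c * χ (X s)) g := by
  have : χ.comp (aeval (R := k) (fun s => (C c * X s : MvPolynomial σ k))) =
      aeval (fun s => algebraMap k E c * χ (X s)) := algHom_ext fun s => by
    rw [AlgHom.comp_apply, aeval_X, map_mul, aeval_X, ← algebraMap_eq, AlgHom.commutes]
  exact DFunLike.congr_fun this g

theorem exists_aeval_C_mul_X {σ k : Type*} [Field k] {c : k} (hc : c ≠ 0) (g : MvPolynomial σ k) :
    ∃ g', aeval (R := k) (fun s => (C c * X s : MvPolynomial σ k)) g' = g := by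
  refine ⟨aeval (R := k) (fun s => (C c⁻¹ * X s : MvPolynomial σ k)) g, ?_⟩
  have : (aeval (R := k) (fun s => (C c * X s : MvPolynomial σ k))).comp
      (aeval (R := k) (fun s => (C c⁻¹ * X s : MvPolynomial σ k))) = AlgHom.id k _ :=
    algHom_ext fun s => by
      rw [AlgHom.comp_apply, aeval_X, map_mul, aeval_C, aeval_X, algebraMap_eq, ← mul_assoc,
        ← C_mul,
        inv_mul_cancel₀ hc, C_1, one_mul, AlgHom.id_apply]
  exact DFunLike.congr_fun this g

/-- A polynomial that vanishes on the symmetric matrices `2 x xᵀ` vanishes on all symmetric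
matrices whose `2 × 2` minors vanish. -/
theorem algHom_eq_zero_of_veronese {E : Type*} [CommRing E] [Algebra ℂ E]
    (χ : MvPolynomial (Sym2 (Fin 4)) ℂ →ₐ[ℂ] E)
    (hχ : ∀ i j k l, χ (X s(i, j)) * χ (X s(k, l)) = χ (X s(i, l)) * χ (X s(k, j)))
    (r : MvPolynomial (Sym2 (Fin 4)) ℂ →ₐ[ℂ] MvPolynomial (Fin 4) ℂ)
    (hr : ∀ i j, r (X s(i, j)) = 2 * (X i * X j)) {g : MvPolynomial (Sym2 (Fin 4)) ℂ}
    (hg : r g = 0) : χ g = 0 := by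
  -- rescaling the variables turns `2 x xᵀ` into `x xᵀ`
  obtain ⟨g, rfl⟩ := exists_aeval_C_mul_X (c := 2⁻¹) (by norm_num) g
  rw [algHom_aeval_C_mul_X] at hg ⊢
  refine aeval_eq_zero_of_aeval_monomial_eq_zero veroneseExponent _ (fun s t hst => ?_) g ?_
  · refine prod_eq_of_veronese _ (fun i j k l => ?_) s t hst
    linear_combination algebraMap ℂ E 2⁻¹ ^ 2 * hχ i j k l
  · rw [← hg]
    congr 2
    ext1 s
    induction s with
    | _ i j =>
    have e : monomial (veroneseExponent s(i, j)) (1 : ℂ) = X i * X j := by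
      rw [veroneseExponent_mk, ← one_mul (1 : ℂ), ← monomial_mul]
      rfl
    rw [e, hr, ← mul_assoc, ← map_ofNat (algebraMap ℂ (MvPolynomial (Fin 4) ℂ)) 2, ← map_mul]
    norm_num

namespace IsPairPresentation

variable {I : Ideal (MvPolynomial ι ℂ)} {ρ : MvPolynomial ι ℂ →ₐ[ℂ] PairRing}
  {y : Sym2 (Fin 4) → MvPolynomial ι ℂ}

/-- The derivatives of `B J B` in the directions of symmetric matrices are the normal vector fields
that come from tangent vector fields of the ambient space. -/
theorem exists_normalMatrix_eq_polar (h : IsPairPresentation I ρ y) {X : Fin 4 → Fin 4 → PairRing}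
    (hX : ∀ i j, X i j ∈ invariants) (hs : ∀ i j, X i j = X j i) :
    ∃ a, ∀ i j, h.normalMatrix (tangentToNormal I a) i j = polar symUV X i j := by
  choose Z hZ using fun p : Fin 4 × Fin 4 => h.exists_embedding_eq (hX p.1 p.2)
  have hZs : ∀ i j, Z (i, j) = Z (j, i) := fun i j => h.embedding_injective (by
    rw [hZ, hZ]; exact hs i j)
  obtain ⟨a, ha⟩ := h.exists_field (Sym2.lift ⟨fun i j => Z (i, j), hZs⟩)
  refine ⟨a, fun i j => ?_⟩
  rw [h.normalMatrix_tangentToNormal]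
  congr 1
  ext i j
  rw [symMat, ha]
  exact hZ (i, j)

theorem normalMatrix_smul (h : IsPairPresentation I ρ y)
    (ψ : I.Cotangent →ₗ[MvPolynomial ι ℂ ⧸ I] MvPolynomial ι ℂ ⧸ I) (s : MvPolynomial ι ℂ ⧸ I)
    (i j : Fin 4) : h.normalMatrix (s • ψ) i j = h.embedding s * h.normalMatrix ψ i j :=
  map_mul h.embedding _ _

/-- There is a normal vector field with `B J B ↦ J`: a vector field with `B J B ↦ c J`, where
`c ≠ 0`, has values divisible by `c`. -/
theorem exists_normalMatrix_eq_sympMatrix (h : IsPairPresentation I ρ y) :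
    ∃ φ : I.Cotangent →ₗ[MvPolynomial ι ℂ ⧸ I] MvPolynomial ι ℂ ⧸ I,
      ∀ i j, h.normalMatrix φ i j = sympMatrix PairRing i j := by
  have := h.isDomain
  obtain ⟨X, hX, hXs, hXJ⟩ := exists_polar_eq_wedge_mul_wedge 0 1 0 1
  obtain ⟨a, ha⟩ := h.exists_normalMatrix_eq_polar hX hXs
  have hw : wedge 0 1 * wedge 0 1 ∈ invariants := by
    have : wedge 0 1 * wedge 0 1 = symUV 0 1 * symUV 1 0 - symUV 0 0 * symUV 1 1 := by
      simp only [wedge, symUV]; ring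
    rw [this]
    exact sub_mem (mul_mem (symUV_mem _ _) (symUV_mem _ _))
      (mul_mem (symUV_mem _ _) (symUV_mem _ _))
  obtain ⟨c, hc⟩ := h.exists_embedding_eq hw
  have hc0 : c ≠ 0 := by
    rintro rfl
    rw [map_zero] at hc
    exact mul_ne_zero wedge_ne_zero wedge_ne_zero hc.symm
  have hJ : ∀ i j, ∃ z, h.embedding z = sympMatrix PairRing i j := fun i j =>
    h.exists_embedding_eq (sympMatrix_mem i j)
  let μ : (MvPolynomial ι ℂ ⧸ I) →ₗ[MvPolynomial ι ℂ ⧸ I] (MvPolynomial ι ℂ ⧸ I) :=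
    LinearMap.mulLeft _ c
  have hμ : Function.Injective μ := mul_right_injective₀ hc0
  have hD : ∀ f, ∀ hf : f ∈ Ideal.span (Set.range fun p : Fin 4 × Fin 4 =>
      (h.equation p.1 p.2 : MvPolynomial ι ℂ)), ∀ hI : f ∈ I,
      tangentToNormal I a (I.toCotangent ⟨f, hI⟩) ∈ LinearMap.range μ := by
    intro f hf hI
    have hle : Ideal.span (Set.range fun p : Fin 4 × Fin 4 =>
      (h.equation p.1 p.2 : MvPolynomial ι ℂ)) ≤ I := Ideal.span_le.2 (by
        rintro _ ⟨p, rfl⟩; exact (h.equation p.1 p.2).2)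
    induction hf using Submodule.span_induction with
    | mem x hx =>
      obtain ⟨p, rfl⟩ := hx
      obtain ⟨z, hz⟩ := hJ p.1 p.2
      refine ⟨z, h.embedding_injective ?_⟩
      rw [LinearMap.mulLeft_apply, map_mul, hc, hz, ← hXJ, ← ha]
      rfl
    | zero =>
      rw [show (⟨0, hI⟩ : I) = 0 from rfl, map_zero, map_zero]
      exact zero_mem _
    | add p q hp hq ihp ihq =>
      have : (⟨p + q, hI⟩ : I) = ⟨p, hle hp⟩ + ⟨q, hle hq⟩ := rfl
      rw [this, map_add, map_add]
      exact add_mem (ihp _) (ihq _)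
    | smul r p hp ihp =>
      have : (⟨r • p, hI⟩ : I) = r • ⟨p, hle hp⟩ := rfl
      rw [this, Ideal.Cotangent.map_smul_toCotangent]
      exact Submodule.smul_mem _ (Ideal.Quotient.mk I r) (ihp _)
  have hD' : ∀ x, tangentToNormal I a x ∈ LinearMap.range μ := fun x => by
    obtain ⟨f, rfl⟩ := I.toCotangent_surjective x
    exact hD f (h.mem_span_equation f.2) f.2
  refine ⟨(LinearEquiv.ofInjective μ hμ).symm.toLinearMap ∘ₗ
    LinearMap.codRestrict (LinearMap.range μ) (tangentToNormal I a) hD', fun i j => ?_⟩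
  refine mul_left_cancel₀ (mul_ne_zero wedge_ne_zero wedge_ne_zero) ?_
  rw [← hXJ, ← ha, ← hc, normalMatrix, ← map_mul, normalMatrix]
  congr 1
  exact congrArg Subtype.val ((LinearEquiv.ofInjective μ hμ).apply_symm_apply
    (LinearMap.codRestrict (LinearMap.range μ) (tangentToNormal I a) hD' _))

/-- The restriction of functions to the matrices of rank one. -/
def rankOne (h : IsPairPresentation I ρ y) : MvPolynomial ι ℂ ⧸ I →ₐ[ℂ] MvPolynomial (Fin 4) ℂ :=
  diagonal.comp h.embedding

theorem rankOne_entry (h : IsPairPresentation I ρ y) (i j : Fin 4) :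
    h.rankOne (Ideal.Quotient.mk I (y s(i, j))) = 2 * (X i * X j) := by
  simp only [rankOne, AlgHom.comp_apply, embedding_mk, h.map_entry, pairSym_mk, map_add, map_mul,
    diagonal, lift_u, lift_v]
  ring

/-- The generator of the normal module times `s` is tangent if and only if `s` vanishes on the
matrices of rank one. -/
theorem smul_mem_range_iff (h : IsPairPresentation I ρ y)
    {φ : I.Cotangent →ₗ[MvPolynomial ι ℂ ⧸ I] MvPolynomial ι ℂ ⧸ I}
    (hφ : ∀ i j, h.normalMatrix φ i j = sympMatrix PairRing i j) (s : MvPolynomial ι ℂ ⧸ I) :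
    s • φ ∈ LinearMap.range (tangentToNormal I) ↔ h.rankOne s = 0 := by
  constructor
  · rintro ⟨a, ha⟩
    refine diagonal_eq_zero_of_polar (c := h.embedding s) (X := symMat fun s =>
      h.embedding (∑ k, a k * Ideal.Quotient.mk I (pderiv k (y s)))) fun p q => ?_
    rw [← hφ, ← h.normalMatrix_smul, ← ha, h.normalMatrix_tangentToNormal]
  · intro hs
    -- the multipliers of `φ` into the tangent vector fields form an ideal that contains the minors
    let K : Ideal (MvPolynomial ι ℂ ⧸ I) := (LinearMap.range (tangentToNormal I)).comap
      (LinearMap.toSpanSingleton _ _ φ)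
    have hK : ∀ i j k l, symMat (fun s => Ideal.Quotient.mk I (y s)) i j *
        symMat (fun s => Ideal.Quotient.mk I (y s)) k l -
        symMat (fun s => Ideal.Quotient.mk I (y s)) i l *
        symMat (fun s => Ideal.Quotient.mk I (y s)) k j ∈ K := by
      intro i j k l
      obtain ⟨X, hX, hXs, hXJ⟩ := exists_polar_eq_wedge_mul_wedge i k l j
      obtain ⟨a, ha⟩ := h.exists_normalMatrix_eq_polar hX hXs
      refine ⟨a, h.ext_normalMatrix fun p q => ?_⟩
      rw [ha, hXJ, LinearMap.toSpanSingleton_apply, normalMatrix_smul, hφ]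
      congr 1
      simp only [symMat, map_sub, map_mul, embedding_mk, h.map_entry, pairSym_mk, wedge]
      ring
    suffices s ∈ K by exact this
    obtain ⟨f, rfl⟩ := Ideal.Quotient.mk_surjective s
    obtain ⟨g, rfl⟩ := h.surjective f
    rw [← Ideal.Quotient.eq_zero_iff_mem]
    refine algHom_eq_zero_of_veronese (E := (MvPolynomial ι ℂ ⧸ I) ⧸ K)
      ((Ideal.Quotient.mkₐ ℂ K).comp ((Ideal.Quotient.mkₐ ℂ I).comp (aeval y))) (fun i j k l => ?_)
      (h.rankOne.comp ((Ideal.Quotient.mkₐ ℂ I).comp (aeval y))) (fun i j => ?_) hs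
    · simp only [AlgHom.comp_apply, aeval_X]
      have := (Ideal.Quotient.mk_eq_mk_iff_sub_mem _ _).2 (hK i j k l)
      exact ((Ideal.Quotient.mk K).map_mul _ _).symm.trans
        (this.trans ((Ideal.Quotient.mk K).map_mul _ _))
    · simp only [AlgHom.comp_apply, aeval_X]
      exact h.rankOne_entry i j

/-- The normal module is generated by `φ` and the tangent vector fields. -/
theorem exists_eq_tangentToNormal_add (h : IsPairPresentation I ρ y)
    {φ : I.Cotangent →ₗ[MvPolynomial ι ℂ ⧸ I] MvPolynomial ι ℂ ⧸ I}
    (hφ : ∀ i j, h.normalMatrix φ i j = sympMatrix PairRing i j)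
    (ψ : I.Cotangent →ₗ[MvPolynomial ι ℂ ⧸ I] MvPolynomial ι ℂ ⧸ I) :
    ∃ a, ∃ s : MvPolynomial ι ℂ ⧸ I, ψ = tangentToNormal I a + s • φ := by
  obtain ⟨X, hX, hXs, s, hs, hH⟩ := exists_eq_polar_add (h.normalMatrix ψ)
    (fun i j => h.embedding_mem _) (h.normalMatrix_skew ψ) (h.normalMatrix_relation ψ)
  obtain ⟨a, ha⟩ := h.exists_normalMatrix_eq_polar hX hXs
  obtain ⟨s, rfl⟩ := h.exists_embedding_eq hs
  refine ⟨a, s, h.ext_normalMatrix fun i j => ?_⟩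
  rw [hH, ← hφ, ← ha]
  have e : h.normalMatrix (tangentToNormal I a + s • φ) i j =
      h.normalMatrix (tangentToNormal I a) i j + h.normalMatrix (s • φ) i j :=
          map_add h.embedding _ _
  rw [e, normalMatrix_smul]

end IsPairPresentation

/-! ### Dimension and purity -/

theorem ringKrullDim_le_of_isIntegral {R S : Type*} [CommRing R] [CommRing S] (f : R →+* S)
    (hf : f.IsIntegral) : ringKrullDim S ≤ ringKrullDim R := by
  algebraize [f]
  refine Order.krullDim_le_of_strictMono (PrimeSpectrum.comap f) fun p q hpq => ?_
  exact Ideal.IsIntegral.comap_lt_comap (R := R) (I := p.asIdeal) (J := q.asIdeal) hpq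

theorem ringKrullDim_eq_of_isIntegral_comp {R S T : Type*} [CommRing R] [CommRing S] [CommRing T]
    (f : R →+* S) (g : S →+* T) (hg : Function.Injective g) (h : (g.comp f).IsIntegral)
    (hRT : ringKrullDim R = ringKrullDim T) : ringKrullDim S = ringKrullDim T :=
  le_antisymm (hRT ▸ ringKrullDim_le_of_isIntegral f (RingHom.IsIntegral.tower_bot f g hg h))
    (ringKrullDim_le_of_isIntegral g (RingHom.IsIntegral.tower_top f g h))

namespace IsPairPresentation

variable {I : Ideal (MvPolynomial ι ℂ)} {ρ : MvPolynomial ι ℂ →ₐ[ℂ] PairRing}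
  {y : Sym2 (Fin 4) → MvPolynomial ι ℂ}

/-- The functions on the matrices of rank one are the even polynomials in four variables; both the
polynomial ring in the variables and the one in their squares have dimension `4`. -/
theorem ringKrullDim_quotient_ker_rankOne (h : IsPairPresentation I ρ y) :
    ringKrullDim ((MvPolynomial ι ℂ ⧸ I) ⧸ RingHom.ker h.rankOne) = 4 := by
  let g : (MvPolynomial ι ℂ ⧸ I) ⧸ RingHom.ker h.rankOne →+* MvPolynomial (Fin 4) ℂ :=
    Ideal.Quotient.lift (RingHom.ker h.rankOne) h.rankOne.toRingHom fun _ ha => ha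
  let f : MvPolynomial (Fin 4) ℂ →+* (MvPolynomial ι ℂ ⧸ I) ⧸ RingHom.ker h.rankOne :=
    (Ideal.Quotient.mk (RingHom.ker h.rankOne)).comp ((Ideal.Quotient.mk I).comp
      (aeval (R := ℂ) (fun i : Fin 4 => y s(i, i))).toRingHom)
  have hg : Function.Injective g := by
    rw [injective_iff_map_eq_zero]
    intro x hx
    obtain ⟨x, rfl⟩ := Ideal.Quotient.mk_surjective x
    exact Ideal.Quotient.eq_zero_iff_mem.2 hx
  have hgf : ∀ p, g (f p) = aeval (fun i => (2 * (X i * X i) : MvPolynomial (Fin 4) ℂ)) p := by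
    intro p
    have : h.rankOne.comp ((Ideal.Quotient.mkₐ ℂ I).comp
        (aeval (R := ℂ) (fun i : Fin 4 => y s(i, i)))) =
        aeval (fun i => (2 * (X i * X i) : MvPolynomial (Fin 4) ℂ)) := algHom_ext fun i => by
      simp only [AlgHom.comp_apply, aeval_X]
      exact h.rankOne_entry i i
    exact DFunLike.congr_fun this p
  have hint : (g.comp f).IsIntegral := by
    intro p
    have hC : ∀ a : ℂ, (g.comp f) (C a) = C a := fun a => (hgf _).trans (by simp)
    induction p using MvPolynomial.induction_on with
    | C a =>
      rw [← hC]
      exact RingHom.isIntegralElem_map _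
    | add p q hp hq => exact hp.add _ hq
    | mul_X p i hp =>
      refine hp.mul _ ⟨Polynomial.X ^ 2 - Polynomial.C (C 2⁻¹ * X i),
        Polynomial.monic_X_pow_sub_C _ two_ne_zero, ?_⟩
      have : (g.comp f) (X i) = 2 * (X i * X i) := (hgf _).trans (by simp)
      rw [Polynomial.eval₂_sub, Polynomial.eval₂_X_pow, Polynomial.eval₂_C, map_mul, hC, this,
        ← map_ofNat (C : ℂ →+* MvPolynomial (Fin 4) ℂ) 2, ← mul_assoc, ← C_mul]
      norm_num
      ring
  refine (ringKrullDim_eq_of_isIntegral_comp (R := MvPolynomial (Fin 4) ℂ)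
    (S := (MvPolynomial ι ℂ ⧸ I) ⧸ RingHom.ker h.rankOne) (T := MvPolynomial (Fin 4) ℂ)
    f g hg hint rfl).trans ?_
  simp

/-- Every nonzero submodule of `T¹` has the same annihilator, since `T¹` is isomorphic to the ring
of functions on the matrices of rank one. -/
theorem annihilator_eq (h : IsPairPresentation I ρ y)
    (N : Submodule (MvPolynomial ι ℂ ⧸ I) (TangentOne I)) (hN : N ≠ ⊥) :
    Module.annihilator (MvPolynomial ι ℂ ⧸ I) N = RingHom.ker h.rankOne := by
  obtain ⟨φ, hφ⟩ := h.exists_normalMatrix_eq_sympMatrix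
  have hgen : ∀ m : TangentOne I, ∃ s : MvPolynomial ι ℂ ⧸ I,
    m = Submodule.Quotient.mk (s • φ) := by
    intro m
    obtain ⟨ψ, rfl⟩ := Submodule.Quotient.mk_surjective _ m
    obtain ⟨a, s, hs⟩ := h.exists_eq_tangentToNormal_add hφ ψ
    refine ⟨s, (Submodule.Quotient.eq _).2 ⟨a, ?_⟩⟩
    rw [hs, add_sub_cancel_right]
  have hzero : ∀ s : MvPolynomial ι ℂ ⧸ I,
      (Submodule.Quotient.mk (s • φ) : TangentOne I) = 0 ↔ h.rankOne s = 0 := fun s =>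
    (Submodule.Quotient.mk_eq_zero _).trans (h.smul_mem_range_iff hφ s)
  obtain ⟨m, hm, hm0⟩ := Submodule.exists_mem_ne_zero_of_ne_bot hN
  obtain ⟨s, rfl⟩ := hgen m
  ext r
  rw [Module.mem_annihilator, RingHom.mem_ker]
  constructor
  · intro hr
    have := congrArg Subtype.val (hr ⟨_, hm⟩)
    have h1 : (Submodule.Quotient.mk ((r * s) • φ) : TangentOne I) = 0 :=
      (congrArg Submodule.Quotient.mk (mul_smul r s φ)).trans this
    rw [hzero, map_mul] at h1
    exact (mul_eq_zero.1 h1).resolve_right fun h2 => hm0 ((hzero s).2 h2)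
  · rintro hr ⟨m', hm'⟩
    obtain ⟨t, rfl⟩ := hgen m'
    refine Subtype.ext ?_
    refine (congrArg Submodule.Quotient.mk (mul_smul r t φ)).symm.trans ((hzero _).2 ?_)
    rw [map_mul, hr, zero_mul]

theorem finite_tangentOne (h : IsPairPresentation I ρ y) :
    Module.Finite (MvPolynomial ι ℂ ⧸ I) (TangentOne I) := by
  obtain ⟨φ, hφ⟩ := h.exists_normalMatrix_eq_sympMatrix
  refine ⟨⟨{Submodule.Quotient.mk φ}, eq_top_iff.2 fun m _ => ?_⟩⟩
  obtain ⟨ψ, rfl⟩ := Submodule.Quotient.mk_surjective _ m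
  obtain ⟨a, s, hs⟩ := h.exists_eq_tangentToNormal_add hφ ψ
  rw [Finset.coe_singleton, Submodule.mem_span_singleton]
  refine ⟨s, (Submodule.Quotient.eq _).2 ⟨-a, ?_⟩⟩
  rw [hs, map_neg]
  abel

theorem finite_submodule (h : IsPairPresentation I ρ y)
    (N : Submodule (MvPolynomial ι ℂ ⧸ I) (TangentOne I)) :
    Module.Finite (MvPolynomial ι ℂ ⧸ I) N := by
  have := h.finite_tangentOne
  have : IsNoetherian (MvPolynomial ι ℂ ⧸ I) (TangentOne I) :=
    isNoetherian_of_isNoetherianRing_of_finite _ _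
  exact Module.IsNoetherian.finite _ N

theorem nontrivial_tangentOne (h : IsPairPresentation I ρ y) : Nontrivial (TangentOne I) := by
  obtain ⟨φ, hφ⟩ := h.exists_normalMatrix_eq_sympMatrix
  refine ⟨⟨Submodule.Quotient.mk φ, 0, fun h0 => ?_⟩⟩
  rw [Submodule.Quotient.mk_eq_zero, ← one_smul (MvPolynomial ι ℂ ⧸ I) φ, h.smul_mem_range_iff hφ,
    map_one] at h0
  exact one_ne_zero h0

theorem supportDim_eq (h : IsPairPresentation I ρ y)
    (N : Submodule (MvPolynomial ι ℂ ⧸ I) (TangentOne I)) (hN : N ≠ ⊥) :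
    Module.supportDim (MvPolynomial ι ℂ ⧸ I) N = 4 := by
  have := h.finite_submodule N
  rw [Module.supportDim_eq_ringKrullDim_quotient_annihilator, h.annihilator_eq N hN,
    h.ringKrullDim_quotient_ker_rankOne]

theorem isPureOfDim_tangentOne (h : IsPairPresentation I ρ y) :
    IsPureOfDim (MvPolynomial ι ℂ ⧸ I) (TangentOne I) 4 := by
  have := h.nontrivial_tangentOne
  refine ⟨?_, fun N hN => h.supportDim_eq N hN⟩
  rw [← Module.supportDim_eq_of_equiv (Submodule.topEquiv (R := MvPolynomial ι ℂ ⧸ I)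
    (M := TangentOne I))]
  exact h.supportDim_eq ⊤ top_ne_bot

/-- A submodule of `T¹` supported in a closed subset that does not contain the cone of matrices of
rank one is zero. -/
theorem eq_bot_of_support_subset (h : IsPairPresentation I ρ y)
    {𝔞 : Ideal (MvPolynomial ι ℂ ⧸ I)} (h𝔞 : ¬ 𝔞 ≤ RingHom.ker h.rankOne)
    (N : Submodule (MvPolynomial ι ℂ ⧸ I) (TangentOne I))
    (hN : Module.support (MvPolynomial ι ℂ ⧸ I) N ⊆ PrimeSpectrum.zeroLocus 𝔞) : N = ⊥ := by
  by_contra hne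
  have := h.finite_submodule N
  refine h𝔞 (hN (?_ : (⟨RingHom.ker h.rankOne, RingHom.ker_isPrime _⟩ : PrimeSpectrum _) ∈ _))
  rw [Module.support_eq_zeroLocus, h.annihilator_eq N hne]
  exact le_refl (RingHom.ker h.rankOne)

end IsPairPresentation

end NormalModule

/-! ### Symplectic bases and the symplectic Lie algebra -/

section Symplectic

variable {V : Type*} [AddCommGroup V] [Module ℂ V] {ω : LinearMap.BilinForm ℂ V}

theorem exists_symplectic_basis (hV : Module.finrank ℂ V = 4) (hω : ω.IsAlt)
    (hω' : ω.Nondegenerate) :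
    ∃ d : Module.Basis (Fin 4) ℂ V, ∀ i j, ω (d i) (d j) = sympMatrix ℂ i j := by
  have hfin : FiniteDimensional ℂ V := .of_finrank_pos (by omega)
  have hneg : ∀ x y, ω x y = -ω y x := fun x y => (hω.neg_eq y x).symm
  have hex : ∀ x : V, x ≠ 0 → ∃ z, ω x z = 1 := by
    intro x hx
    obtain ⟨z, hz⟩ : ∃ z, ω x z ≠ 0 := by
      by_contra! hz
      exact hx (hω'.1 x hz)
    exact ⟨(ω x z)⁻¹ • z, by rw [map_smul, smul_eq_mul, inv_mul_cancel₀ hz]⟩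
  have : Nontrivial V := Module.nontrivial_of_finrank_pos (R := ℂ) (by omega)
  obtain ⟨a, ha⟩ := exists_ne (0 : V)
  obtain ⟨a', haa'⟩ := hex a ha
  obtain ⟨c, hc, hc0⟩ : ∃ c ∈ LinearMap.ker ((ω a).prod (ω a')), c ≠ 0 := by
    refine Submodule.exists_mem_ne_zero_of_ne_bot fun h => ?_
    have h1 := LinearMap.finrank_le_finrank_of_injective (LinearMap.ker_eq_bot.1 h)
    rw [hV, Module.finrank_prod, Module.finrank_self] at h1
    omega
  obtain ⟨hc1, hc2⟩ : ω a c = 0 ∧ ω a' c = 0 := Prod.mk_eq_zero.1 (LinearMap.mem_ker.1 hc)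
  obtain ⟨x, hx⟩ := hex c hc0
  let c' := x - ω a x • a' + ω a' x • a
  have h1 : ω a c' = 0 := by simp [c', haa', hω.self_eq_zero a]
  have h2 : ω a' c' = 0 := by simp [c', hneg a' a, haa', hω.self_eq_zero a']
  have h3 : ω c c' = 1 := by simp [c', hneg c a, hneg c a', hc1, hc2, hx]
  let d : Fin 4 → V := ![a, a', c, c']
  have hd : ∀ i j, ω (d i) (d j) = sympMatrix ℂ i j := by
    intro i j
    fin_cases i <;> fin_cases j <;>
      simp [d, sympMatrix, hω.self_eq_zero, haa', hc1, hc2, h1, h2, h3, hneg a' a, hneg c a,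
        hneg c a', hneg c' a, hneg c' a', hneg c' c]
  have hli : LinearIndependent ℂ d := by
    rw [Fintype.linearIndependent_iff]
    intro g hg
    have key : ∀ j, ∑ i, g i * sympMatrix ℂ j i = 0 := fun j => by
      have := congrArg (ω (d j)) hg
      simpa [map_sum, hd] using this
    have k0 := key 0
    have k1 := key 1
    have k2 := key 2
    have k3 := key 3
    simp [Fin.sum_univ_four, sympMatrix] at k0 k1 k2 k3
    intro i
    fin_cases i
    exacts [k1, k0, k3, k2]
  refine ⟨basisOfLinearIndependentOfCardEqFinrank hli (by simp [hV]), fun i j => ?_⟩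
  rw [coe_basisOfLinearIndependentOfCardEqFinrank, hd]

/-- The expansion of a vector in a symplectic basis. -/
theorem eq_of_symplectic_basis (d : Module.Basis (Fin 4) ℂ V)
    (hd : ∀ i j, ω (d i) (d j) = sympMatrix ℂ i j) (z : V) :
    z = ω z (d 1) • d 0 - ω z (d 0) • d 1 + ω z (d 3) • d 2 - ω z (d 2) • d 3 := by
  conv_lhs => rw [← d.sum_repr z]
  have : ∀ j, ω z (d j) = ∑ i, d.repr z i * sympMatrix ℂ i j := fun j => by
    conv_lhs => rw [← d.sum_repr z]
    simp only [map_sum, LinearMap.sum_apply, map_smul, LinearMap.smul_apply, hd, smul_eq_mul]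
  simp only [this, Fin.sum_univ_four, sympMatrix, Matrix.cons_val]
  module

theorem symmetric_of_mem (hω : ω.IsAlt) (A : skewAdjointLieSubalgebra ω) (x y : V) :
    ω ((A : Module.End ℂ V) x) y = ω ((A : Module.End ℂ V) y) x := by
  have h : ω ((A : Module.End ℂ V) x) y = ω x ((-(A : Module.End ℂ V)) y) :=
    ((LinearMap.mem_skewAdjointSubmodule _).1 A.2) x y
  rw [h, LinearMap.neg_apply, map_neg]
  exact hω.neg_eq _ _

/-- The linear map that sends an element `A` of the symplectic Lie algebra to the matrix of the
quadratic form `ω(A x, x)` in a basis. -/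
def sympLieMap (hω : ω.IsAlt) (d : Fin 4 → V) :
    skewAdjointLieSubalgebra ω →ₗ[ℂ] (Sym2 (Fin 4) → ℂ) where
  toFun A := Sym2.lift ⟨fun i j => ω ((A : Module.End ℂ V) (d i)) (d j), fun i j =>
    symmetric_of_mem hω A _ _⟩
  map_add' A B := by
    ext s
    induction s with
    | _ i j => simp
  map_smul' c A := by
    ext s
    induction s with
    | _ i j => simp

/-- The identification of the symplectic Lie algebra with the space of symmetric matrices, by the
quadratic form `ω(A x, x)` in a symplectic basis. -/
def sympLieEquiv (hω : ω.IsAlt) (d : Module.Basis (Fin 4) ℂ V)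
    (hd : ∀ i j, ω (d i) (d j) = sympMatrix ℂ i j) :
    skewAdjointLieSubalgebra ω ≃ₗ[ℂ] (Sym2 (Fin 4) → ℂ) :=
  LinearEquiv.ofBijective (sympLieMap hω d)
    (by
      constructor
      · rw [injective_iff_map_eq_zero]
        intro A hA
        have : ∀ i j, ω ((A : Module.End ℂ V) (d i)) (d j) = 0 := fun i j => congrFun hA s(i, j)
        refine Subtype.ext (d.ext fun i => ?_)
        rw [eq_of_symplectic_basis d hd ((A : Module.End ℂ V) (d i))]
        simp [this]
      · intro B
        let A : Module.End ℂ V := d.constr ℂ fun i =>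
          B s(i, 1) • d 0 - B s(i, 0) • d 1 + B s(i, 3) • d 2 - B s(i, 2) • d 3
        have hA : ∀ i j, ω (A (d i)) (d j) = B s(i, j) := fun i j => by
          simp only [A, Module.Basis.constr_basis, map_sub, map_add, map_smul, LinearMap.sub_apply,
            LinearMap.add_apply, LinearMap.smul_apply, hd, smul_eq_mul]
          fin_cases j <;> simp [sympMatrix]
        have hmem : A ∈ skewAdjointLieSubalgebra ω := by
          refine (LinearMap.mem_skewAdjointSubmodule _).2 fun x y => ?_
          have : ω.compl₁₂ A LinearMap.id = ω.compl₁₂ LinearMap.id (-A) :=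
            LinearMap.BilinForm.ext_basis d fun i j => by
              rw [LinearMap.compl₁₂_apply, LinearMap.compl₁₂_apply, LinearMap.id_apply,
                LinearMap.id_apply, hA, LinearMap.neg_apply, map_neg, hω.neg_eq, hA, Sym2.eq_swap]
          exact LinearMap.congr_fun₂ this x y
        refine ⟨⟨A, hmem⟩, ?_⟩
        ext s
        induction s with
        | _ i j => exact hA i j)

theorem sympLieEquiv_apply (hω : ω.IsAlt) (d : Module.Basis (Fin 4) ℂ V)
    (hd : ∀ i j, ω (d i) (d j) = sympMatrix ℂ i j) (A : skewAdjointLieSubalgebra ω) (i j : Fin 4) :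
    sympLieEquiv hω d hd A s(i, j) = ω ((A : Module.End ℂ V) (d i)) (d j) := rfl

/-- The entries of `B J B` are the numbers `-ω(A² dᵢ, dⱼ)`. -/
theorem pow_two_eq_zero_iff_sqEntry (hω : ω.IsAlt) (hω' : ω.Nondegenerate)
    (d : Module.Basis (Fin 4) ℂ V)
    (hd : ∀ i j, ω (d i) (d j) = sympMatrix ℂ i j) (A : skewAdjointLieSubalgebra ω) :
    (A : Module.End ℂ V) ^ 2 = 0 ↔ ∀ i j, sqEntry (symMat (sympLieEquiv hω d hd A)) i j = 0 := by
  have hneg : ∀ x y, ω x y = -ω y x := fun x y => (hω.neg_eq y x).symm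
  have key : ∀ i j, ω (((A : Module.End ℂ V) ^ 2) (d i)) (d j) =
      -sqEntry (symMat (sympLieEquiv hω d hd A)) i j := by
    intro i j
    rw [pow_two, Module.End.mul_apply, symmetric_of_mem hω, hneg]
    conv_lhs => rw [eq_of_symplectic_basis d hd ((A : Module.End ℂ V) (d i))]
    simp only [sqEntry, symMat, sympLieEquiv_apply, map_sub, map_add, map_smul, LinearMap.sub_apply,
            LinearMap.add_apply, LinearMap.smul_apply, smul_eq_mul,
                hneg (d _) ((A : Module.End ℂ V) (d j))]
    ring
  constructor
  · intro h i j
    have := key i j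
    rw [h] at this
    simpa using this
  · intro h
    refine d.ext fun i => hω'.1 _ fun y => ?_
    have : ω (((A : Module.End ℂ V) ^ 2) (d i)) = 0 := d.ext fun j => by
      rw [key, h, neg_zero, LinearMap.zero_apply]
    rw [this, LinearMap.zero_apply]

end Symplectic

/-! ### The coordinate ring of `{B ∈ 𝔰𝔭(V) | B² = 0}` -/

section LinearForms

open MvPolynomial

variable {k α β : Type*} [Field k] [Fintype α] [DecidableEq α]

/-- The coordinates of a linear map, as linear forms. -/
def linearForms (f : (α → k) →ₗ[k] (β → k)) (b : β) : MvPolynomial α k :=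
  ∑ a, C (f (Pi.single a 1) b) * X a

theorem aeval_linearForms {E : Type*} [CommRing E] [Algebra k E] (f : (α → k) →ₗ[k] (β → k))
    (z : α → E)
    (b : β) : aeval z (linearForms f b) = ∑ a, algebraMap k E (f (Pi.single a 1) b) * z a := by
  simp [linearForms]

theorem aeval_linearForms_self (f : (α → k) →ₗ[k] (β → k)) (x : α → k) (b : β) :
    aeval x (linearForms f b) = f x b := by
  rw [aeval_linearForms]
  conv_rhs => rw [LinearMap.pi_apply_eq_sum_univ f x]
  simp only [Finset.sum_apply, Pi.smul_apply, smul_eq_mul, Algebra.algebraMap_self,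
    RingHom.id_apply]
  refine Finset.sum_congr rfl fun a _ => ?_
  rw [mul_comm]
  congr 1
  exact congrFun (congrArg f (funext fun i => by simp [Pi.single_apply, eq_comm])) b

theorem pderiv_linearForms (f : (α → k) →ₗ[k] (β → k)) (a : α) (b : β) :
    pderiv a (linearForms f b) = C (f (Pi.single a 1) b) := by
  simp only [linearForms, map_sum, pderiv_C_mul]
  rw [Finset.sum_eq_single a (fun c _ hc => by rw [pderiv_X_of_ne hc]; simp) (by simp)]
  simp

variable [DecidableEq β]

theorem sum_single_mul_single (f : (α → k) ≃ₗ[k] (β → k)) (b c : β) :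
    ∑ a, f (Pi.single a 1) b * f.symm (Pi.single c 1) a = (Pi.single c 1 : β → k) b := by
  have := aeval_linearForms_self f.toLinearMap (f.symm (Pi.single c 1)) b
  rw [aeval_linearForms] at this
  simpa using this

theorem aeval_linearForms_linearForms [Fintype β] (f : (α → k) ≃ₗ[k] (β → k)) (b : β) :
    aeval (linearForms f.symm.toLinearMap) (linearForms f.toLinearMap b) = X b := by
  rw [aeval_linearForms]
  simp only [linearForms, Finset.mul_sum]
  rw [Finset.sum_comm]
  have : ∀ c, ∑ a, algebraMap k (MvPolynomial β k) (f.toLinearMap (Pi.single a 1) b) *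
      (C (f.symm.toLinearMap (Pi.single c 1) a) * X c) = C ((Pi.single c 1 : β → k) b) * X c := by
    intro c
    rw [← sum_single_mul_single f b c, map_sum, Finset.sum_mul]
    refine Finset.sum_congr rfl fun a _ => ?_
    rw [algebraMap_eq, ← mul_assoc, ← C_mul]
    rfl
  simp only [this]
  rw [Finset.sum_eq_single b (fun c _ hc => by simp [Ne.symm hc]) (by simp)]
  simp

end LinearForms

section Presentation

open MvPolynomial PairRing

variable {V ι : Type*} [AddCommGroup V] [Module ℂ V] [Fintype ι] {ω : LinearMap.BilinForm ℂ V}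

/-- The ideal of `Z` is the kernel of the restriction of functions to the matrices `u vᵀ + v uᵀ`:
these matrices satisfy `B J B = 0`, and a function that vanishes on them vanishes at every `B` with
`B J B = 0`. -/
theorem isPairPresentation_squareZeroIdeal [DecidableEq ι] (hω : ω.IsAlt) (hω' : ω.Nondegenerate)
    (b : Module.Basis ι ℂ (skewAdjointLieSubalgebra ω)) (d : Module.Basis (Fin 4) ℂ V)
    (hd : ∀ i j, ω (d i) (d j) = sympMatrix ℂ i j) :
    IsPairPresentation (squareZeroIdeal b)
      ((aeval (pairSym u v)).comp
        (aeval (linearForms (b.equivFun.symm.trans (sympLieEquiv hω d hd)).symm.toLinearMap)))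
      (linearForms (b.equivFun.symm.trans (sympLieEquiv hω d hd)).toLinearMap) := by
  set L := b.equivFun.symm.trans (sympLieEquiv hω d hd) with hL
  have hlocus : ∀ x, x ∈ squareZeroLocus b ↔ ∀ i j, sqEntry (symMat (L x)) i j = 0 := fun x =>
    pow_two_eq_zero_iff_sqEntry hω hω' d hd _
  have hev : ∀ (z : Sym2 (Fin 4) → ℂ) f, aeval z (aeval (linearForms L.symm.toLinearMap) f) =
      aeval (L.symm z) f := fun z f => by
    have : (aeval z).comp (aeval (linearForms L.symm.toLinearMap)) = aeval (L.symm z) :=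
      algHom_ext fun i => by
        rw [AlgHom.comp_apply, aeval_X, aeval_X, aeval_linearForms_self]; rfl
    exact DFunLike.congr_fun this f
  refine ⟨?_, fun s => ?_, fun f => ?_, fun X => ?_⟩
  · ext f
    rw [RingHom.mem_ker, squareZeroIdeal, mem_vanishingIdeal_iff]
    constructor
    · intro hf x hx
      have := aeval_eq_zero_of_aeval_pairSym (L x) ((hlocus x).1 hx) _ hf
      have h' := (hev (L x) f).symm.trans this
      rwa [LinearEquiv.symm_apply_apply] at h'
    · intro hf
      -- by the Nullstellensatz, it suffices to evaluate at the pairs of orthogonal vectors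
      let p : PairPoly := aeval (pairSym (fun i => MvPolynomial.X (.inl i))
          fun i => MvPolynomial.X (.inr i))
        (aeval (linearForms L.symm.toLinearMap) f)
      have hp : p ∈ Ideal.span {omegaPoly} := by
        rw [← IsPrime.vanishingIdeal_zeroLocus (K := ℂ) (Ideal.span {omegaPoly}),
          mem_vanishingIdeal_iff]
        intro x hx
        have hx' := hx omegaPoly (Ideal.mem_span_singleton_self _)
        have h1 : ∀ g, aeval x (aeval (pairSym (fun i => (MvPolynomial.X (.inl i) : PairPoly))
            fun i => MvPolynomial.X (.inr i)) g) =
            aeval (pairSym (fun i => x (.inl i)) fun i => x (.inr i)) g := fun g => by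
          have : (aeval x).comp (aeval (pairSym (fun i => (MvPolynomial.X (.inl i) : PairPoly))
              fun i => MvPolynomial.X (.inr i))) =
              aeval (pairSym (fun i => x (.inl i)) fun i => x (.inr i)) :=
            algHom_ext fun s => by
              induction s with
              | _ i j => simp [pairSym_mk]
          exact DFunLike.congr_fun this g
        rw [h1, hev]
        refine hf _ ((hlocus _).2 fun i j => ?_)
        rw [LinearEquiv.apply_symm_apply]
        simp only [omegaPoly, map_sub, map_add, map_mul, aeval_X] at hx'
        simp only [sqEntry, symMat, pairSym_mk]
        linear_combination (x (.inl j) * x (.inr i) - x (.inl i) * x (.inr j)) * hx'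
      have h2 : (Ideal.Quotient.mkₐ ℂ (Ideal.span {omegaPoly})).comp (aeval (pairSym
          (fun i => (MvPolynomial.X (.inl i) : PairPoly)) fun i => MvPolynomial.X (.inr i))) =
          aeval (pairSym u v) := algHom_ext fun s => by
        induction s with
        | _ i j =>
        simp [pairSym_mk, u, v]
      rw [AlgHom.comp_apply, ← h2]
      exact Ideal.Quotient.eq_zero_iff_mem.2 hp
  · rw [AlgHom.comp_apply, aeval_linearForms_linearForms, aeval_X]
  · refine ⟨aeval (linearForms L.symm.toLinearMap) f, ?_⟩
    have : (aeval (linearForms L.toLinearMap)).comp (aeval (linearForms L.symm.toLinearMap)) =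
        AlgHom.id ℂ _ := algHom_ext fun i => by
      rw [AlgHom.comp_apply, aeval_X]
      exact aeval_linearForms_linearForms L.symm i
    exact DFunLike.congr_fun this f
  · refine ⟨fun i => ∑ t, algebraMap ℂ _ (L.symm (Pi.single t 1) i) * X t, fun s => ?_⟩
    simp only [pderiv_linearForms, Finset.sum_mul]
    rw [Finset.sum_comm]
    have : ∀ t, ∑ i, algebraMap ℂ _ (L.symm (Pi.single t 1) i) * X t *
        Ideal.Quotient.mk (squareZeroIdeal b) (C (L.toLinearMap (Pi.single i 1) s)) =
        algebraMap ℂ (MvPolynomial ι ℂ ⧸ squareZeroIdeal b)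
          ((Pi.single t 1 : Sym2 (Fin 4) → ℂ) s) * X t := by
      intro t
      rw [← sum_single_mul_single L s t, map_sum, Finset.sum_mul]
      refine Finset.sum_congr rfl fun i _ => ?_
      rw [map_mul, mul_right_comm, mul_comm (algebraMap _ _ (L (Pi.single i 1) s))]
      rfl
    simp only [this]
    rw [Finset.sum_eq_single s (fun c _ hc => by simp [Ne.symm hc]) (by simp)]
    simp

/-- The cone of matrices of rank one is not contained in the origin. -/
theorem not_originIdeal_le (b : Module.Basis ι ℂ (skewAdjointLieSubalgebra ω))
    {ρ : MvPolynomial ι ℂ →ₐ[ℂ] PairRing} {y : Sym2 (Fin 4) → MvPolynomial ι ℂ}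
    (h : IsPairPresentation (squareZeroIdeal b) ρ y)
        (hy : ∀ s, ∃ c : ι → ℂ, y s = ∑ i, C (c i) * X i) :
    ¬ originIdeal b ≤ RingHom.ker h.rankOne := by
  intro hle
  obtain ⟨c, hc⟩ := hy s(0, 0)
  have h1 := h.rankOne_entry 0 0
  have h2 : Ideal.Quotient.mk (squareZeroIdeal b) (y s(0, 0)) ∈ originIdeal b := by
    rw [hc, map_sum]
    refine sum_mem fun i _ => ?_
    rw [map_mul]
    exact Ideal.mul_mem_left _ _ (Ideal.subset_span ⟨i, rfl⟩)
  rw [(RingHom.mem_ker).1 (hle h2)] at h1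
  exact mul_ne_zero two_ne_zero (mul_ne_zero (X_ne_zero _) (X_ne_zero _)) h1.symm

end Presentation

/-! ### Small extensions and flatness -/

section SmallExtension

open IsLocalRing

variable {k A B S : Type*} [Field k] [CommRing A] [CommRing B] [Algebra k B] [Algebra A B]
  [CommRing S] [Algebra k S]

theorem Ideal.exists_sub_mul_mem_map (𝔟 : Ideal A) (t : A) {x : B}
    (hx : x ∈ (𝔟 ⊔ Ideal.span {t}).map (algebraMap A B)) :
    ∃ β, x - algebraMap A B t * β ∈ 𝔟.map (algebraMap A B) := by
  rw [Ideal.map_sup, Ideal.map_span, Set.image_singleton] at hx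
  obtain ⟨y, hy, z, hz, rfl⟩ := Submodule.mem_sup.1 hx
  obtain ⟨β, rfl⟩ := Ideal.mem_span_singleton'.1 hz
  exact ⟨β, by rwa [mul_comm, add_sub_cancel_right]⟩

variable [IsLocalRing A]

/-- Downward induction on the ideals contained in a nilpotent maximal ideal: each proper step adds
an element `t` that is killed by the maximal ideal modulo the smaller ideal. -/
theorem Ideal.small_extension_induction [IsNoetherianRing A] (hm : IsNilpotent (maximalIdeal A))
    {p : Ideal A → Prop} (top : p (maximalIdeal A))
    (step : ∀ (𝔟 : Ideal A) (t : A), 𝔟 ≤ maximalIdeal A → t ∈ maximalIdeal A → t ∉ 𝔟 →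
      (∀ a ∈ maximalIdeal A, a * t ∈ 𝔟) → p (𝔟 ⊔ Ideal.span {t}) → p 𝔟)
    (𝔟 : Ideal A) (h𝔟 : 𝔟 ≤ maximalIdeal A) : p 𝔟 := by
  induction 𝔟 using WellFoundedGT.induction with
  | ind 𝔟 ih =>
  by_cases heq : 𝔟 = maximalIdeal A
  · rwa [heq]
  -- `t` is an element of the last power of the maximal ideal that is not contained in `𝔟`
  have hex : ∃ n, maximalIdeal A ^ n ≤ 𝔟 := by
    obtain ⟨n, hn⟩ := hm
    exact ⟨n, by rw [hn]; exact bot_le⟩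
  classical
  obtain ⟨n, hn⟩ : ∃ n, Nat.find hex = n + 1 := Nat.exists_eq_succ_of_ne_zero fun h0 => by
    have := Nat.find_spec hex
    rw [h0, pow_zero, Ideal.one_eq_top] at this
    exact (maximalIdeal.isMaximal A).ne_top (top_le_iff.1 (this.trans h𝔟))
  have hn0 : n ≠ 0 := by
    rintro rfl
    have := Nat.find_spec hex
    rw [hn, zero_add, pow_one] at this
    exact heq (le_antisymm h𝔟 this)
  obtain ⟨t, ht, ht'⟩ := SetLike.not_le_iff_exists.1
    (Nat.find_min hex (show n < Nat.find hex by omega))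
  have htm : t ∈ maximalIdeal A := Ideal.pow_le_self hn0 ht
  refine step 𝔟 t h𝔟 htm ht' (fun a ha => ?_) (ih _ ?_ ?_)
  · refine Nat.find_spec hex ?_
    rw [hn, pow_succ']
    exact Ideal.mul_mem_mul ha ht
  · exact lt_of_le_of_ne le_sup_left fun h => ht' (h ▸ Ideal.mem_sup_right
    (Ideal.mem_span_singleton_self t))
  · exact sup_le h𝔟 ((Ideal.span_singleton_le_iff_mem _).2 htm)

/-- An element `t ∉ 𝔟` acts on a flat module modulo `𝔟` with kernel in `𝔪 B`. -/
theorem Module.Flat.mem_map_of_mul_mem [Module.Flat A B] {𝔟 : Ideal A} {t : A} (ht : t ∉ 𝔟) {β : B}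
    (h : algebraMap A B t * β ∈ 𝔟.map (algebraMap A B)) :
    β ∈ (maximalIdeal A).map (algebraMap A B) := by
  obtain ⟨n, c, x, hcx⟩ : ∃ (n : ℕ) (c : Fin n → 𝔟) (x : Fin n → B),
      algebraMap A B t * β = ∑ i, (c i : A) • x i := by
    have h' : algebraMap A B t * β ∈ (𝔟 • ⊤ : Submodule A B) := by
      rw [Ideal.smul_top_eq_map]; exact h
    refine Submodule.smul_induction_on h' (fun r hr m _ => ⟨1, fun _ => ⟨r, hr⟩,
      fun _ => m, by simp⟩) ?_
    rintro _ _ ⟨n, c, x, rfl⟩ ⟨n', c', x', rfl⟩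
    refine ⟨n + n', Fin.append c c', Fin.append x x', ?_⟩
    simp [Fin.sum_univ_add]
  have hrel : ∑ i : Option (Fin n), (i.elim t fun i => -(c i : A)) • (i.elim β x) = 0 := by
    rw [Fintype.sum_option]
    simp [Algebra.smul_def, hcx]
  obtain ⟨l, a, z, hz, ha⟩ := Module.Flat.isTrivialRelation_of_sum_smul_eq_zero
    (f := fun i : Option (Fin n) => i.elim t fun i => -(c i : A))
    (x := fun i : Option (Fin n) => i.elim β x) hrel
  have hβ : β = ∑ j, a none j • z j := hz none
  rw [hβ]
  refine sum_mem fun j _ => ?_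
  rw [Algebra.smul_def]
  refine Ideal.mul_mem_right _ _ (Ideal.mem_map_of_mem _ ?_)
  rw [mem_maximalIdeal, mem_nonunits_iff]
  intro hu
  have h1 := ha j
  rw [Fintype.sum_option] at h1
  have h2 : t * a none j ∈ 𝔟 := by
    have : t * a none j = ∑ i, (c i : A) * a (some i) j := by
      simpa [add_neg_eq_zero] using h1
    rw [this]
    exact sum_mem fun i _ => Ideal.mul_mem_right _ _ (c i).2
  exact ht ((Ideal.mul_unit_mem_iff_mem _ hu).1 h2)

/-- Together with `IsDeformation.mul_mem_map`: if `t` spans a one-dimensional space modulo `𝔟`, the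
product `t * β` modulo `𝔟` and the restriction of `β` to the special fibre determine each other. -/
theorem IsDeformation.map_eq_zero_of_mul_mem {π : B →ₐ[k] S} (hπ : IsDeformation A π) {𝔟 : Ideal A}
    {t : A} (ht : t ∉ 𝔟) {β : B} (h : algebraMap A B t * β ∈ 𝔟.map (algebraMap A B)) : π β = 0 := by
  have := hπ.flat
  rw [← RingHom.mem_ker, hπ.ker_eq]
  exact Module.Flat.mem_map_of_mul_mem ht h

theorem Ideal.mul_mem_map_of_mem_map {𝔟 : Ideal A} {t : A}
    (ht : ∀ a ∈ maximalIdeal A, a * t ∈ 𝔟) {β : B}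
    (h : β ∈ (maximalIdeal A).map (algebraMap A B)) :
    algebraMap A B t * β ∈ 𝔟.map (algebraMap A B) := by
  induction h using Submodule.span_induction with
  | mem x hx =>
    obtain ⟨a, ha, rfl⟩ := hx
    rw [← map_mul, mul_comm]
    exact Ideal.mem_map_of_mem _ (ht a ha)
  | zero => simp
  | add x y _ _ hx hy => rw [mul_add]; exact add_mem hx hy
  | smul r x _ hx =>
    rw [smul_eq_mul, mul_left_comm]
    exact Ideal.mul_mem_left _ _ hx

theorem IsDeformation.mul_mem_map {π : B →ₐ[k] S} (hπ : IsDeformation A π) {𝔟 : Ideal A} {t : A}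
    (ht : ∀ a ∈ maximalIdeal A, a * t ∈ 𝔟) {β : B} (h : π β = 0) :
    algebraMap A B t * β ∈ 𝔟.map (algebraMap A B) :=
  Ideal.mul_mem_map_of_mem_map ht (by rw [← hπ.ker_eq]; exact h)

end SmallExtension

/-! ### Deformations of an affine variety: obstructions to triviality -/

section Obstruction

open IsLocalRing MvPolynomial

variable {k A B σ : Type*} [Field k] [CommRing B] [Algebra k B]

/-- Taylor expansion to first order. -/
theorem MvPolynomial.taylor_mem [Fintype σ] (J : Ideal B) {T : B} (hT : T * T ∈ J)
    (θ θ' : MvPolynomial σ k →ₐ[k] B)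
    (c : σ → B) (h : ∀ i, θ' (X i) - θ (X i) - T * c i ∈ J) (f : MvPolynomial σ k) :
    θ' f - θ f - T * ∑ i, c i * θ (pderiv i f) ∈ J := by
  classical
  induction f using MvPolynomial.induction_on with
  | C a => simp [← algebraMap_eq]
  | add p q hp hq =>
    convert add_mem hp hq using 1
    simp only [map_add, mul_add, Finset.sum_add_distrib]
    ring
  | mul_X p j hp =>
    have e : ∑ i, c i * θ (pderiv i (p * X j)) =
      θ p * c j + θ (X j) * ∑ i, c i * θ (pderiv i p) := by
      simp only [Derivation.leibniz, smul_eq_mul, map_add, map_mul, mul_add, Finset.sum_add_distrib,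
        Finset.mul_sum]
      congr 1
      · rw [Finset.sum_eq_single j (fun i _ hi => by rw [pderiv_X_of_ne hi.symm]; simp) (by simp)]
        simp [mul_comm]
      · exact Finset.sum_congr rfl fun i _ => by ring
    rw [e, map_mul, map_mul]
    have := add_mem (add_mem (J.mul_mem_left (θ' (X j)) hp) (J.mul_mem_left (θ p) (h j)))
      (J.mul_mem_left (∑ i, c i * θ (pderiv i p))
        (add_mem (J.mul_mem_left T (h j)) (J.mul_mem_left (c j) hT)))
    convert this using 1
    ring

variable [CommRing A] [IsLocalRing A] [Algebra A B]
  {I : Ideal (MvPolynomial σ k)} {π : B →ₐ[k] MvPolynomial σ k ⧸ I}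

/-- The obstruction to lifting a trivialization from `A/(𝔟 + t)` to `A/𝔟`: a homomorphism on the
conormal module. -/
theorem IsDeformation.exists_obstruction (hπ : IsDeformation A π) {𝔟 : Ideal A} {t : A} (ht : t ∉ 𝔟)
    (θ : MvPolynomial σ k →ₐ[k] B) (hθ : ∀ f, π (θ f) = Ideal.Quotient.mk I f)
    (hI : ∀ f ∈ I, θ f ∈ (𝔟 ⊔ Ideal.span {t}).map (algebraMap A B)) :
    ∃ h : I.Cotangent →ₗ[MvPolynomial σ k ⧸ I] MvPolynomial σ k ⧸ I, ∀ (f : I) (β : B),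
      θ f - algebraMap A B t * β ∈ 𝔟.map (algebraMap A B) → h (I.toCotangent f) = π β := by
  choose β hβ using fun f : I => Ideal.exists_sub_mul_mem_map 𝔟 t (hI f f.2)
  have huniq : ∀ (f : I) (β' : B), θ f - algebraMap A B t * β' ∈ 𝔟.map (algebraMap A B) →
      π (β f) = π β' := fun f β' h => by
    have : algebraMap A B t * (β' - β f) ∈ 𝔟.map (algebraMap A B) := by
      convert sub_mem (hβ f) h using 1
      ring
    have := hπ.map_eq_zero_of_mul_mem ht this
    rw [map_sub, sub_eq_zero] at this
    exact this.symm
  let h₀ : I →ₗ[MvPolynomial σ k] MvPolynomial σ k ⧸ I :=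
    { toFun := fun f => π (β f)
      map_add' := fun f g => by
        rw [← map_add]
        refine huniq _ _ ?_
        convert add_mem (hβ f) (hβ g) using 1
        simp only [Submodule.coe_add, map_add]
        ring
      map_smul' := fun r f => by
        have : π (β (r • f)) = π (θ r * β f) := huniq _ _ (by
          convert Ideal.mul_mem_left _ (θ r) (hβ f) using 1
          simp only [Submodule.coe_smul, smul_eq_mul, map_mul]
          ring)
        rw [this, map_mul, hθ]
        rfl }
  have hI2 : (I • ⊤ : Submodule (MvPolynomial σ k) I) ≤ LinearMap.ker h₀ := by
    rw [Submodule.smul_le]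
    intro r hr f _
    rw [LinearMap.mem_ker, map_smul]
    exact (Algebra.smul_def r (h₀ f)).trans
      (by rw [Ideal.Quotient.algebraMap_eq, Ideal.Quotient.eq_zero_iff_mem.2 hr, zero_mul])
  let h₁ : I.Cotangent →ₗ[MvPolynomial σ k] MvPolynomial σ k ⧸ I :=
    (I • ⊤ : Submodule (MvPolynomial σ k) I).liftQ h₀ hI2
  exact ⟨h₁.extendScalarsOfSurjective Ideal.Quotient.mk_surjective, fun f β' h => huniq f β' h⟩

/-- If the obstruction is induced by a vector field, the trivialization can be corrected by the
vector field and lifts to `A/𝔟`. -/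
theorem IsDeformation.exists_lift [Fintype σ] (hπ : IsDeformation A π) {𝔟 : Ideal A} {t : A}
    (htm : t ∈ maximalIdeal A) (ht : ∀ a ∈ maximalIdeal A, a * t ∈ 𝔟)
    (θ : MvPolynomial σ k →ₐ[k] B) (hθ : ∀ f, π (θ f) = Ideal.Quotient.mk I f)
    (hI : ∀ f ∈ I, θ f ∈ (𝔟 ⊔ Ideal.span {t}).map (algebraMap A B))
    (a : σ → MvPolynomial σ k ⧸ I)
    (h : ∀ (f : I) (β : B), θ f - algebraMap A B t * β ∈ 𝔟.map (algebraMap A B) →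
      tangentToNormal I a (I.toCotangent f) = π β) :
    ∃ θ' : MvPolynomial σ k →ₐ[k] B, (∀ f, π (θ' f) = Ideal.Quotient.mk I f) ∧
      ∀ f ∈ I, θ' f ∈ 𝔟.map (algebraMap A B) := by
  choose c hc using fun i => hπ.surjective (a i)
  have htπ : π (algebraMap A B t) = 0 := by
    rw [← RingHom.mem_ker, hπ.ker_eq]
    exact Ideal.mem_map_of_mem _ htm
  let θ' : MvPolynomial σ k →ₐ[k] B := aeval fun i => θ (X i) - algebraMap A B t * c i
  have htt : algebraMap A B t * algebraMap A B t ∈ 𝔟.map (algebraMap A B) := by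
    rw [← map_mul]; exact Ideal.mem_map_of_mem _ (ht t htm)
  have htay := fun f => MvPolynomial.taylor_mem (𝔟.map (algebraMap A B)) htt θ θ' (fun i => -c i)
    (fun i => by
      have : θ' (X i) - θ (X i) - algebraMap A B t * -c i = 0 := by
        simp only [θ', aeval_X]; ring
      rw [this]
      exact zero_mem _) f
  refine ⟨θ', fun f => ?_, fun f hf => ?_⟩
  · have : π.comp θ' = Ideal.Quotient.mkₐ k I := algHom_ext fun i => by
      simp only [AlgHom.comp_apply, θ', aeval_X, map_sub, map_mul, htπ, zero_mul, sub_zero, hθ]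
      rfl
    exact DFunLike.congr_fun this f
  · obtain ⟨β, hβ⟩ := Ideal.exists_sub_mul_mem_map 𝔟 t (hI f hf)
    have h1 := h ⟨f, hf⟩ β hβ
    rw [tangentToNormal_apply] at h1
    have h2 : algebraMap A B t * (β + ∑ i, -c i * θ (pderiv i f)) ∈ 𝔟.map (algebraMap A B) := by
      refine hπ.mul_mem_map ht ?_
      rw [map_add, ← h1, map_sum, ← Finset.sum_add_distrib]
      refine Finset.sum_eq_zero fun i _ => ?_
      rw [map_mul, map_neg, hc, hθ]
      ring
    convert add_mem (htay f) (add_mem hβ h2) using 1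
    ring

end Obstruction

/-! ### Automorphisms of trivial deformations -/

section Exponential

variable {k A R : Type*} [Field k] [CommRing A] [Algebra k A] [CommRing R] [Algebra k R]

theorem Derivation.baseChange_leibniz (d : Derivation k R R) (x y : A ⊗[k] R) :
    (d : R →ₗ[k] R).baseChange A (x * y) =
      x * (d : R →ₗ[k] R).baseChange A y + (d : R →ₗ[k] R).baseChange A x * y := by
  induction x with
  | zero => simp
  | add x x' hx hx' => rw [add_mul, map_add, map_add, hx, hx']; ring
  | tmul a r =>
    induction y with
    | zero => simp
    | add y y' hy hy' => rw [mul_add, map_add, map_add, hy, hy']; ring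
    | tmul b s =>
      simp only [Algebra.TensorProduct.tmul_mul_tmul, LinearMap.baseChange_tmul,
        Derivation.coeFn_coe, Derivation.leibniz, smul_eq_mul, TensorProduct.tmul_add]
      rw [mul_comm s]

/-- The exponential of `t` times a derivation, for nilpotent `t`. -/
theorem exists_algHom_exp [CharZero k] (d : Derivation k R R) {t : A} (ht : IsNilpotent t)
    (J : Ideal (A ⊗[k] R)) (hJ : algebraMap A (A ⊗[k] R) (t * t) ∈ J) :
    ∃ E : A ⊗[k] R →ₐ[A] A ⊗[k] R, ∀ c,
      E c - c - algebraMap A (A ⊗[k] R) t * (d : R →ₗ[k] R).baseChange A c ∈ J := by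
  let : Module ℚ (A ⊗[k] R) := Module.compHom _ (algebraMap ℚ k)
  have hsmul : ∀ (q : ℚ) (x : A ⊗[k] R), q • x =
    algebraMap k (A ⊗[k] R) (q : k) * x := fun q x => by
    rw [← Algebra.smul_def]
    rfl
  let D₀ : Module.End A (A ⊗[k] R) := (d : R →ₗ[k] R).baseChange A
  have hD : ∀ n, (t • D₀) ^ n = t ^ n • D₀ ^ n := fun n => smul_pow t D₀ n
  have hnil : IsNilpotent (t • D₀) := by
    obtain ⟨n, hn⟩ := ht
    exact ⟨n, by rw [hD, hn, zero_smul]⟩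
  have hder : ∀ x y, (t • D₀) (x * y) = x * (t • D₀) y + (t • D₀) x * y := fun x y => by
    simp only [LinearMap.smul_apply, D₀, Derivation.baseChange_leibniz, smul_add, mul_smul_comm,
      smul_mul_assoc]
  obtain ⟨N, hN⟩ := hnil
  have hN2 : (t • D₀) ^ (N + 2) = 0 := by rw [pow_add, hN, zero_mul]
  have hsum : ∀ c, IsNilpotent.exp (t • D₀) c = c + t • D₀ c +
      ∑ i ∈ Finset.range N, ((i + 2).factorial : ℚ)⁻¹ • ((t • D₀) ^ (i + 2)) c := fun c => by
    rw [IsNilpotent.exp_eq_sum hN2, LinearMap.sum_apply, Finset.sum_range_succ',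
      Finset.sum_range_succ']
    simp only [LinearMap.smul_apply, zero_add, pow_zero, pow_one, Nat.factorial_zero,
      Nat.factorial_one, Nat.cast_one, inv_one, one_smul, Module.End.one_apply]
    rw [add_assoc, add_comm, add_comm (t • D₀ c)]
  have h1 : D₀ 1 = 0 := by
    have : D₀ 1 = 1 ⊗ₜ d 1 := rfl
    rw [this, Derivation.map_one_eq_zero, TensorProduct.tmul_zero]
  refine ⟨AlgHom.ofLinearMap (IsNilpotent.exp (t • D₀)) ?_ ?_, fun c => ?_⟩
  · rw [hsum, h1, smul_zero, add_zero, add_eq_left]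
    refine Finset.sum_eq_zero fun i _ => ?_
    rw [pow_succ, Module.End.mul_apply, LinearMap.smul_apply, h1, smul_zero, map_zero, smul_zero]
  · exact fun x y => Module.End.exp_mul_of_derivation A _ (t • D₀) hder ⟨N, hN⟩ x y
  · rw [AlgHom.ofLinearMap_apply, hsum, ← Algebra.smul_def, add_sub_right_comm, add_sub_cancel_left,
      add_sub_right_comm]
    have e : t • D₀ c - t • (d : R →ₗ[k] R).baseChange A c = 0 := sub_self _
    rw [e, zero_add]
    refine sum_mem fun i _ => ?_
    rw [hsmul, hD, LinearMap.smul_apply, Algebra.smul_def, pow_add, pow_two, map_mul]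
    exact J.mul_mem_left _ (J.mul_mem_right _ (J.mul_mem_left _ hJ))

/-- A derivation extends to a localization: it is the nilpotent part of a homomorphism to the ring of
dual numbers, which carries the denominators to units. -/
theorem Derivation.exists_extension {S : Type*} [CommRing S] [Algebra k S] [Algebra S R]
    [IsScalarTower k S R] (M : Submonoid S) [IsLocalization M R] (d : Derivation k S R) :
    ∃ d' : Derivation k R R, ∀ s, d' (algebraMap S R s) = d s := by
  let φ : S →ₐ[k] TrivSqZeroExt R R :=
    { toFun := fun s => TrivSqZeroExt.inl (algebraMap S R s) + TrivSqZeroExt.inr (d s)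
      map_one' := by simp
      map_mul' := fun x y => by
        ext
        · simp
        · simp
          rw [Algebra.smul_def, Algebra.smul_def]
          ring
      map_zero' := by simp
      map_add' := fun x y => by ext <;> simp
      commutes' := fun c => by
        ext
        · simp [TrivSqZeroExt.algebraMap_eq_inl', ← IsScalarTower.algebraMap_apply]
        · simp [TrivSqZeroExt.algebraMap_eq_inl'] }
  have hφ : ∀ m : M, IsUnit (φ m) := fun m => by
    rw [TrivSqZeroExt.isUnit_iff_isUnit_fst]
    simpa [φ] using IsLocalization.map_units R m
  let ψ : R →ₐ[k] TrivSqZeroExt R R := IsLocalization.liftAlgHom hφ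
  have hψ : ∀ s, ψ (algebraMap S R s) = φ s := fun s => IsLocalization.lift_eq hφ s
  have hfst : ∀ r, (ψ r).fst = r := by
    have : (TrivSqZeroExt.fstHom k R R).toRingHom.comp ψ.toRingHom = RingHom.id R :=
      IsLocalization.ringHom_ext M (RingHom.ext fun s => by
        change (ψ (algebraMap S R s)).fst = _
        rw [hψ]
        simp [φ])
    exact fun r => DFunLike.congr_fun this r
  refine ⟨Derivation.mk' ((TrivSqZeroExt.sndHom R R).restrictScalars k ∘ₗ ψ.toLinearMap)
    fun x y => ?_, fun s => ?_⟩
  · change (ψ (x * y)).snd = x • (ψ y).snd + y • (ψ x).snd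
    rw [map_mul, TrivSqZeroExt.snd_mul, hfst, hfst, op_smul_eq_smul]
  · change (ψ (algebraMap S R s)).snd = _
    rw [hψ]
    simp [φ]

end Exponential

/-! ### Locally trivial deformations -/

section Rigidity

open IsLocalRing MvPolynomial

variable {k A R : Type*} [Field k] [CommRing A] [IsLocalRing A] [Algebra k A]
    [CommRing R] [Algebra k R]

theorem TensorProduct.tmul_eq_sub_algebraMap_mul_add {k A R : Type*} [Field k] [CommRing A]
    [Algebra k A]
    [CommRing R] [Algebra k R] (a : A) (c : k) (r : R) :
    a ⊗ₜ[k] r = algebraMap A (A ⊗[k] R) (a - algebraMap k A c) * 1 ⊗ₜ r + 1 ⊗ₜ (c • r) := by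
  rw [Algebra.TensorProduct.algebraMap_apply, Algebra.TensorProduct.tmul_mul_tmul,
    TensorProduct.tmul_smul, TensorProduct.smul_tmul', Algebra.algebraMap_self_apply, mul_one,
    one_mul, ← Algebra.algebraMap_eq_smul_one, ← TensorProduct.add_tmul, sub_add_cancel]

/-- The projection `A ⊗ R → R` is a deformation. -/
theorem isDeformation_tensorProduct (hk : ∀ a : A, ∃ c : k, a - algebraMap k A c ∈ maximalIdeal A)
    (ϖ : A ⊗[k] R →ₐ[k] R) (h1 : ∀ r, ϖ (1 ⊗ₜ r) = r)
    (hϖ : ∀ a ∈ maximalIdeal A, ϖ (algebraMap A (A ⊗[k] R) a) = 0) : IsDeformation A ϖ := by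
  have hker : (maximalIdeal A).map (algebraMap A (A ⊗[k] R)) ≤ RingHom.ker ϖ := by
    rw [Ideal.map_le_iff_le_comap]
    exact hϖ
  have hsub : ∀ x : A ⊗[k] R, x - 1 ⊗ₜ ϖ x ∈ (maximalIdeal A).map (algebraMap A (A ⊗[k] R)) := by
    intro x
    induction x with
    | zero => simp
    | add x y hx hy =>
      convert add_mem hx hy using 1
      rw [map_add, TensorProduct.tmul_add]
      ring
    | tmul a r =>
      obtain ⟨c, hc⟩ := hk a
      have e := TensorProduct.tmul_eq_sub_algebraMap_mul_add (k := k) a c r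
      have e' : ϖ (a ⊗ₜ[k] r) = c • r := by
        rw [e, map_add, map_mul, hϖ _ hc, zero_mul, zero_add, h1]
      rw [e', e, add_sub_cancel_right]
      exact Ideal.mul_mem_right _ _ (Ideal.mem_map_of_mem _ hc)
  refine ⟨inferInstance, fun r => ⟨1 ⊗ₜ r, h1 r⟩, le_antisymm (fun x hx => ?_) hker⟩
  have := hsub x
  rwa [show ϖ x = 0 from hx, TensorProduct.tmul_zero, sub_zero] at this

variable {σ : Type*} [IsNoetherianRing A] {I : Ideal (MvPolynomial σ k)}
  [Algebra (MvPolynomial σ k ⧸ I) R] [IsScalarTower k (MvPolynomial σ k ⧸ I) R]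

/-- A homomorphism from the coordinate ring to a localization of a trivial deformation that is
defined modulo an ideal of the base lifts, since the automorphisms of the trivial deformation over
the quotient of the base lift. -/
theorem IsDeformation.exists_lift_of_tensorProduct [CharZero k]
    (hk : ∀ a : A, ∃ c : k, a - algebraMap k A c ∈ maximalIdeal A)
        (hm : IsNilpotent (maximalIdeal A))
    (M : Submonoid (MvPolynomial σ k ⧸ I)) [IsLocalization M R] {ϖ : A ⊗[k] R →ₐ[k] R}
    (hϖ : IsDeformation A ϖ) (h1 : ∀ r, ϖ (1 ⊗ₜ r) = r)
    (θ : MvPolynomial σ k →ₐ[k] A ⊗[k] R)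
    (hθ : ∀ f, ϖ (θ f) = algebraMap _ R (Ideal.Quotient.mk I f)) (𝔟 : Ideal A)
    (h𝔟 : 𝔟 ≤ maximalIdeal A) (hI : ∀ f ∈ I, θ f ∈ 𝔟.map (algebraMap A (A ⊗[k] R))) :
    ∃ τ : MvPolynomial σ k ⧸ I →ₐ[k] A ⊗[k] R,
      ∀ f, τ (Ideal.Quotient.mk I f) - θ f ∈ 𝔟.map (algebraMap A (A ⊗[k] R)) := by
  revert hI
  refine Ideal.small_extension_induction hm (p := fun 𝔟 =>
    (∀ f ∈ I, θ f ∈ 𝔟.map (algebraMap A (A ⊗[k] R))) →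
    ∃ τ : MvPolynomial σ k ⧸ I →ₐ[k] A ⊗[k] R,
      ∀ f, τ (Ideal.Quotient.mk I f) - θ f ∈ 𝔟.map (algebraMap A (A ⊗[k] R))) ?_ ?_ 𝔟 h𝔟
  · intro _
    refine ⟨Algebra.TensorProduct.includeRight.comp
      (IsScalarTower.toAlgHom k (MvPolynomial σ k ⧸ I) R), fun f => ?_⟩
    rw [← hϖ.ker_eq, RingHom.mem_ker, map_sub, hθ]
    change ϖ (1 ⊗ₜ _) - _ = 0
    rw [h1]
    exact sub_self _
  · intro 𝔟 t h𝔟 htm ht hmt ih hI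
    obtain ⟨τ, hτ⟩ := ih fun f hf => Ideal.map_mono le_sup_left (hI f hf)
    have hϖt : ϖ (algebraMap A (A ⊗[k] R) t) = 0 := by
      rw [← RingHom.mem_ker, hϖ.ker_eq]
      exact Ideal.mem_map_of_mem _ htm
    have hτϖ : ∀ f, ϖ (τ (Ideal.Quotient.mk I f)) = ϖ (θ f) := fun f => by
      rw [← sub_eq_zero, ← map_sub, ← RingHom.mem_ker, hϖ.ker_eq]
      exact Ideal.map_mono (sup_le h𝔟 ((Ideal.span_singleton_le_iff_mem _).2 htm)) (hτ f)
    -- the difference of `τ` and `θ` is `t` times a derivation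
    have huniq : ∀ {f f' : MvPolynomial σ k} {β β' : A ⊗[k] R},
        Ideal.Quotient.mk I f = Ideal.Quotient.mk I f' →
        τ (Ideal.Quotient.mk I f) - θ f - algebraMap A _ t * β ∈ 𝔟.map (algebraMap A (A ⊗[k] R)) →
        τ (Ideal.Quotient.mk I f') - θ f' - algebraMap A _ t * β' ∈
          𝔟.map (algebraMap A (A ⊗[k] R)) → ϖ β = ϖ β' := by
      intro f f' β β' hff h h'
      have h2 := hI _ ((Ideal.Quotient.mk_eq_mk_iff_sub_mem _ _).1 hff)
      have h3 : algebraMap A _ t * (β' - β) ∈ 𝔟.map (algebraMap A (A ⊗[k] R)) := by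
        convert add_mem (sub_mem h h') h2 using 1
        rw [hff, map_sub]
        ring
      have := hϖ.map_eq_zero_of_mul_mem ht h3
      rw [map_sub, sub_eq_zero] at this
      exact this.symm
    choose F hF using Ideal.Quotient.mk_surjective (I := I)
    choose β hβ using fun f => Ideal.exists_sub_mul_mem_map 𝔟 t (hτ f)
    let d : Derivation k (MvPolynomial σ k ⧸ I) R := Derivation.mk'
      { toFun := fun s => ϖ (β (F s))
        map_add' := fun x y => by
          rw [← map_add]
          refine huniq (f' := F x + F y) (by rw [hF, map_add, hF, hF]) (hβ _) ?_
          convert add_mem (hβ (F x)) (hβ (F y)) using 1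
          simp only [map_add]
          ring
        map_smul' := fun c x => by
          change ϖ (β (F (c • x))) = c • ϖ (β (F x))
          rw [← map_smul ϖ]
          refine huniq (f' := c • F x) (by
            rw [hF]
            exact (congrArg (c • ·) (hF x)).symm) (hβ _) ?_
          convert Ideal.mul_mem_left _ (algebraMap k _ c) (hβ (F x)) using 1
          have : Ideal.Quotient.mk I (c • F x) = c • Ideal.Quotient.mk I (F x) := rfl
          rw [this, map_smul τ, map_smul θ, Algebra.smul_def, Algebra.smul_def, Algebra.smul_def]
          ring }
      (fun x y => by
        have hs : ∀ (s : MvPolynomial σ k ⧸ I) (r : A ⊗[k] R),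
            s • ϖ r = ϖ (τ s * r) := fun s r => by
          conv_rhs => rw [← hF s]
          rw [map_mul, hτϖ, hθ, hF, Algebra.smul_def]
        have hs' : ∀ (s : MvPolynomial σ k ⧸ I) (r : A ⊗[k] R),
            s • ϖ r = ϖ (θ (F s) * r) := fun s r => by
          rw [map_mul, hθ, hF, Algebra.smul_def]
        change ϖ (β (F (x * y))) = x • ϖ (β (F y)) + y • ϖ (β (F x))
        rw [hs x, hs' y, ← map_add]
        refine huniq (f' := F x * F y) (by rw [hF, map_mul, hF, hF]) (hβ _) ?_
        convert add_mem (Ideal.mul_mem_left _ (τ x) (hβ (F y)))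
          (Ideal.mul_mem_left _ (θ (F y)) (hβ (F x))) using 1
        rw [map_mul, map_mul, map_mul, hF, hF]
        ring)
    obtain ⟨d', hd'⟩ := d.exists_extension (R := R) M
    -- the exponential of `-t d'` removes the difference modulo `𝔟`, since `t * t ∈ 𝔟`
    have htnil : IsNilpotent t := by
      obtain ⟨n, hn⟩ := hm
      exact ⟨n, by simpa [hn] using Ideal.pow_mem_pow htm n⟩
    obtain ⟨E, hE⟩ := exists_algHom_exp (-d') htnil (𝔟.map (algebraMap A (A ⊗[k] R)))
      (Ideal.mem_map_of_mem _ (hmt t htm))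
    refine ⟨(E.restrictScalars k).comp τ, fun f => ?_⟩
    have h2 := hE (τ (Ideal.Quotient.mk I f))
    have h3 := hβ f
    have h4 : algebraMap A _ t * ((-d' : Derivation k R R) : R →ₗ[k] R).baseChange A
        (τ (Ideal.Quotient.mk I f)) + algebraMap A _ t * β f ∈ 𝔟.map (algebraMap A (A ⊗[k] R)) := by
      rw [← mul_add]
      refine hϖ.mul_mem_map hmt ?_
      have h5 : ∀ x : A ⊗[k] R, ϖ (((-d' : Derivation k R R) : R →ₗ[k] R).baseChange A x) =
          (-d') (ϖ x) := fun x => by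
        induction x with
        | zero => simp only [map_zero]
        | add x y hx hy => simp only [map_add, hx, hy]
        | tmul a r =>
          obtain ⟨c, hc⟩ := hk a
          have h6 : ∀ r : R, ϖ (a ⊗ₜ r) = c • r := fun r => by
            rw [TensorProduct.tmul_eq_sub_algebraMap_mul_add a c, map_add, map_mul, h1,
              RingHom.mem_ker.1 (hϖ.ker_eq ▸ Ideal.mem_map_of_mem _ hc),
              zero_mul, zero_add, h1]
          rw [LinearMap.baseChange_tmul, h6, h6]
          exact ((-d').map_smul c r).symm
      rw [map_add, h5, hτϖ, hθ, Derivation.neg_apply, hd', neg_add_eq_zero]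
      exact huniq (hF _) (hβ _) (hβ _)
    convert add_mem (add_mem h2 h3) h4 using 1
    rw [AlgHom.comp_apply, AlgHom.restrictScalars_apply]
    ring

end Rigidity

section LocalVanishing

open IsLocalRing MvPolynomial

universe w

variable {k A B : Type*} [Field k] [CommRing A] [Algebra k A]
  [CommRing B] [Algebra k B] [Algebra A B]

/-- A trivialization over the principal open subset `D(π g)`, as a homomorphism `l` from `B` to the
trivial deformation `A ⊗ R` of a localization `R` of `S`, with its projection `ϖ` to `R`. -/
theorem IsTrivialDeformation.exists_algHom_tensorProduct [IsScalarTower k A B] {S : Type w}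
    [CommRing S] [Algebra k S]
    {π : B →ₐ[k] S} {g : B} (hg : IsTrivialDeformation A (Localization.awayMapₐ π g)) :
    ∃ (R : Type w) (_ : CommRing R) (_ : Algebra k R) (_ : Algebra S R) (_ : IsScalarTower k S R)
      (_ : IsLocalization.Away (π g) R) (ϖ : A ⊗[k] R →ₐ[k] R) (l : B →ₐ[k] A ⊗[k] R),
      (∀ r, ϖ (1 ⊗ₜ r) = r) ∧ (∀ a, l (algebraMap A B a) = algebraMap A (A ⊗[k] R) a) ∧
        ∀ b, ϖ (l b) = algebraMap S R (π b) := by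
  obtain ⟨e, he⟩ := hg
  refine ⟨Localization.Away (π g), inferInstance, inferInstance, inferInstance, inferInstance,
    inferInstance, (Localization.awayMapₐ π g).comp (e.toAlgHom.restrictScalars k),
    (e.symm.toAlgHom.restrictScalars k).comp (IsScalarTower.toAlgHom k B (Localization.Away g)),
    he, fun a => ?_, fun b => ?_⟩
  · change e.symm (algebraMap B _ (algebraMap A B a)) = _
    rw [← IsScalarTower.algebraMap_apply]
    exact e.symm.commutes a
  · change Localization.awayMapₐ π g (e (e.symm (algebraMap B _ b))) = _
    rw [e.apply_symm_apply]
    exact IsLocalization.map_eq (T := Submonoid.powers (π g)) (g := (π : B →+* S))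
      (Submonoid.powers_le.2 (Submonoid.mem_powers (π g))) b

variable [IsLocalRing A] [IsNoetherianRing A] {σ : Type*} [Fintype σ]
  {I : Ideal (MvPolynomial σ k)} {π : B →ₐ[k] MvPolynomial σ k ⧸ I}

/-- The obstruction to lifting a trivialization vanishes in `T¹` over each principal open subset on
which the deformation is trivial. -/
theorem IsDeformation.exists_pow_smul_mem_range [CharZero k] [IsDomain (MvPolynomial σ k ⧸ I)]
    (hk : ∀ a : A, ∃ c : k, a - algebraMap k A c ∈ maximalIdeal A)
    (hm : IsNilpotent (maximalIdeal A)) (hπ : IsDeformation A π) {𝔟 : Ideal A} {t : A}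
    (h𝔟 : 𝔟 ≤ maximalIdeal A) (htm : t ∈ maximalIdeal A) (ht : t ∉ 𝔟)
    (hmt : ∀ a ∈ maximalIdeal A, a * t ∈ 𝔟)
    (θ : MvPolynomial σ k →ₐ[k] B) (hθ : ∀ f, π (θ f) = Ideal.Quotient.mk I f)
    (hI : ∀ f ∈ I, θ f ∈ (𝔟 ⊔ Ideal.span {t}).map (algebraMap A B))
    {h : I.Cotangent →ₗ[MvPolynomial σ k ⧸ I] MvPolynomial σ k ⧸ I}
    (hh : ∀ (f : I) (β : B),
      θ f - algebraMap A B t * β ∈ 𝔟.map (algebraMap A B) → h (I.toCotangent f) = π β)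
    {g : B} {R : Type*} [CommRing R] [Algebra k R] [Algebra (MvPolynomial σ k ⧸ I) R]
    [IsScalarTower k (MvPolynomial σ k ⧸ I) R] [IsLocalization.Away (π g) R]
    {ϖ : A ⊗[k] R →ₐ[k] R} {l : B →ₐ[k] A ⊗[k] R} (h1 : ∀ r, ϖ (1 ⊗ₜ r) = r)
    (hlA : ∀ a, l (algebraMap A B a) = algebraMap A (A ⊗[k] R) a)
    (hϖl : ∀ b, ϖ (l b) = algebraMap (MvPolynomial σ k ⧸ I) R (π b)) :
    ∃ n : ℕ, π g ^ n • h ∈ LinearMap.range (tangentToNormal I) := by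
  by_cases hg0 : π g = 0
  · refine ⟨1, ?_⟩
    have : π g ^ 1 • h = 0 := by
      rw [hg0, pow_one]
      exact zero_smul (MvPolynomial σ k ⧸ I) h
    rw [this]
    exact zero_mem _
  have hl : ∀ (𝔠 : Ideal A) (x : B), x ∈ 𝔠.map (algebraMap A B) →
      l x ∈ 𝔠.map (algebraMap A (A ⊗[k] R)) := fun 𝔠 x hx => by
    have := Ideal.mem_map_of_mem (l : B →+* A ⊗[k] R) hx
    rw [Ideal.map_map] at this
    rwa [show (l : B →+* A ⊗[k] R).comp (algebraMap A B) = algebraMap A (A ⊗[k] R) from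
      RingHom.ext fun a => hlA a] at this
  have hϖ : IsDeformation A ϖ := isDeformation_tensorProduct hk ϖ h1 fun a ha => by
    have : algebraMap A B a ∈ RingHom.ker π := hπ.ker_eq ▸ Ideal.mem_map_of_mem _ ha
    rw [← hlA, hϖl, RingHom.mem_ker.1 this, map_zero]
  obtain ⟨τ, hτ⟩ := hϖ.exists_lift_of_tensorProduct hk hm (Submonoid.powers (π g)) h1 (l.comp θ)
    (fun f => by rw [AlgHom.comp_apply, hϖl, hθ]) (𝔟 ⊔ Ideal.span {t})
    (sup_le h𝔟 ((Ideal.span_singleton_le_iff_mem _).2 htm)) (fun f hf => hl _ _ (hI f hf))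
  choose γ hγ using fun i => Ideal.exists_sub_mul_mem_map 𝔟 t (hτ (X i))
  have htay := MvPolynomial.taylor_mem (𝔟.map (algebraMap A (A ⊗[k] R)))
    (T := algebraMap A (A ⊗[k] R) t)
    (by rw [← map_mul]; exact Ideal.mem_map_of_mem _ (hmt t htm)) (l.comp θ)
    (τ.comp (Ideal.Quotient.mkₐ k I)) γ hγ
  have key : ∀ f : I, algebraMap (MvPolynomial σ k ⧸ I) R (h (I.toCotangent f)) =
      ∑ i, ϖ (-γ i) * algebraMap _ R (Ideal.Quotient.mk I (pderiv i (f : MvPolynomial σ k))) := by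
    intro f
    obtain ⟨β, hβ⟩ := Ideal.exists_sub_mul_mem_map 𝔟 t (hI f f.2)
    have h2 : algebraMap A (A ⊗[k] R) t *
      (l β - ∑ i, -γ i * l (θ (pderiv i (f : MvPolynomial σ k)))) ∈
        𝔟.map (algebraMap A (A ⊗[k] R)) := by
      have h3 := neg_mem (add_mem (htay f) (hl _ _ hβ))
      have h4 : (τ.comp (Ideal.Quotient.mkₐ k I)) (f : MvPolynomial σ k) = 0 := by
        change τ (Ideal.Quotient.mk I f) = 0
        rw [Ideal.Quotient.eq_zero_iff_mem.2 f.2, map_zero]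
      rw [h4, map_sub, map_mul, hlA] at h3
      convert h3 using 1
      simp only [AlgHom.comp_apply, neg_mul, Finset.sum_neg_distrib]
      ring
    have h5 := hϖ.map_eq_zero_of_mul_mem ht h2
    rw [map_sub, sub_eq_zero, hϖl, map_sum] at h5
    rw [hh f β hβ, h5]
    exact Finset.sum_congr rfl fun i _ => by rw [map_mul, hϖl, hθ]
  obtain ⟨⟨_, n, rfl⟩, ha⟩ := IsLocalization.exist_integer_multiples_of_finite
    (Submonoid.powers (π g)) (fun i => ϖ (-γ i))
  choose a ha using ha
  refine ⟨n, a, LinearMap.ext fun x => ?_⟩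
  obtain ⟨f, rfl⟩ := I.toCotangent_surjective x
  have hinj : Function.Injective (algebraMap (MvPolynomial σ k ⧸ I) R) :=
    IsLocalization.injective R (powers_le_nonZeroDivisors_of_noZeroDivisors hg0)
  apply hinj
  rw [tangentToNormal_apply, LinearMap.smul_apply, smul_eq_mul, map_mul, key, Finset.mul_sum,
    map_sum]
  refine Finset.sum_congr rfl fun i _ => ?_
  rw [map_mul, ha, Algebra.smul_def, mul_assoc]

end LocalVanishing

section Triviality

open IsLocalRing MvPolynomial

variable {k A B S : Type*} [Field k] [CommRing A] [IsLocalRing A] [IsNoetherianRing A] [Algebra k A]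
  [CommRing B] [Algebra k B] [Algebra A B] [IsScalarTower k A B] [CommRing S] [Algebra k S]

/-- A deformation is trivial if its projection to the special fibre has a section on the coordinate
ring. -/
theorem IsDeformation.isTrivialDeformation_of_section
    (hk : ∀ a : A, ∃ c : k, a - algebraMap k A c ∈ maximalIdeal A)
    (hm : IsNilpotent (maximalIdeal A)) {π : B →ₐ[k] S} (hπ : IsDeformation A π) (s : S →ₐ[k] B)
    (hs : ∀ x, π (s x) = x) : IsTrivialDeformation A π := by
  let Φ : A ⊗[k] S →ₐ[A] B :=
    Algebra.TensorProduct.lift (Algebra.ofId A B) s fun _ _ => mul_comm _ _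
  have hΦ : ∀ x, Φ (1 ⊗ₜ x) = s x := fun x => by
    refine (Algebra.TensorProduct.lift_tmul (Algebra.ofId A B) s
      (fun _ _ => mul_comm _ _) 1 x).trans ?_
    rw [map_one, one_mul]
  let ϖ : A ⊗[k] S →ₐ[k] S := π.comp (Φ.restrictScalars k)
  have hϖΦ : ∀ x, ϖ x = π (Φ x) := fun _ => rfl
  have hϖ : IsDeformation A ϖ := isDeformation_tensorProduct hk ϖ
    (fun r => by rw [hϖΦ, hΦ, hs]) fun a ha => by
      have : algebraMap A B a ∈ RingHom.ker π := hπ.ker_eq ▸ Ideal.mem_map_of_mem _ ha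
      rw [hϖΦ, Φ.commutes]
      exact this
  have hinj : Function.Injective Φ := by
    rw [injective_iff_map_eq_zero]
    intro x hx
    have := Ideal.small_extension_induction hm
      (p := fun 𝔟 => x ∈ 𝔟.map (algebraMap A (A ⊗[k] S))) ?_ ?_ ⊥ bot_le
    · simpa using this
    · rw [← hϖ.ker_eq, RingHom.mem_ker, hϖΦ, hx, map_zero]
    · intro 𝔟 t h𝔟 htm ht hmt h
      obtain ⟨β, hβ⟩ := Ideal.exists_sub_mul_mem_map 𝔟 t h
      have h1 : Φ (x - algebraMap A _ t * β) ∈ 𝔟.map (algebraMap A B) := by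
        have := Ideal.mem_map_of_mem (Φ : A ⊗[k] S →+* B) hβ
        rwa [Ideal.map_map, show (Φ : A ⊗[k] S →+* B).comp (algebraMap A (A ⊗[k] S)) =
          algebraMap A B from RingHom.ext fun a => Φ.commutes a] at this
      rw [map_sub, hx, zero_sub, neg_mem_iff, map_mul, Φ.commutes] at h1
      have h2 := hϖ.mul_mem_map hmt (β := β) (hπ.map_eq_zero_of_mul_mem ht h1)
      convert add_mem hβ h2 using 1
      ring
  have hsurj : Function.Surjective Φ := fun y => by
    have := Ideal.small_extension_induction hm
      (p := fun 𝔟 => ∃ x, y - Φ x ∈ 𝔟.map (algebraMap A B)) ?_ ?_ ⊥ bot_le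
    · obtain ⟨x, hx⟩ := this
      rw [Ideal.map_bot, Ideal.mem_bot, sub_eq_zero] at hx
      exact ⟨x, hx.symm⟩
    · refine ⟨1 ⊗ₜ π y, ?_⟩
      rw [← hπ.ker_eq, RingHom.mem_ker, map_sub, hΦ, hs, sub_self]
    · rintro 𝔟 t h𝔟 htm ht hmt ⟨x, h⟩
      obtain ⟨β, hβ⟩ := Ideal.exists_sub_mul_mem_map 𝔟 t h
      have h2 := hπ.mul_mem_map hmt (β := β - s (π β)) (by rw [map_sub, hs, sub_self])
      refine ⟨x + algebraMap A _ t * 1 ⊗ₜ π β, ?_⟩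
      rw [map_add, map_mul, Φ.commutes, hΦ]
      convert add_mem hβ h2 using 1
      ring
  exact ⟨AlgEquiv.ofBijective Φ ⟨hinj, hsurj⟩, fun x => (congrArg π (hΦ x)).trans (hs x)⟩

variable {σ : Type*} [Fintype σ] {I : Ideal (MvPolynomial σ k)}

/-- If `T¹` has no nonzero submodule supported in `V(𝔞)`, then a deformation that is locally
trivial away from `V(𝔞)` is trivial: each obstruction to lifting a trivialization along a small
extension of the base spans such a submodule. -/
theorem IsDeformation.isTrivialDeformation_of_isLocallyTrivialAwayFrom [CharZero k]
    [IsDomain (MvPolynomial σ k ⧸ I)]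
    (hk : ∀ a : A, ∃ c : k, a - algebraMap k A c ∈ maximalIdeal A)
    (hm : IsNilpotent (maximalIdeal A)) {𝔞 : Ideal (MvPolynomial σ k ⧸ I)}
    (hT : ∀ N : Submodule (MvPolynomial σ k ⧸ I) (TangentOne I),
      Module.support (MvPolynomial σ k ⧸ I) N ⊆
        PrimeSpectrum.zeroLocus (𝔞 : Set (MvPolynomial σ k ⧸ I)) → N = ⊥)
    {π : B →ₐ[k] MvPolynomial σ k ⧸ I} (hπ : IsDeformation A π)
    (hloc : IsLocallyTrivialAwayFrom A π 𝔞) : IsTrivialDeformation A π := by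
  obtain ⟨θ, hθ, hI⟩ := Ideal.small_extension_induction hm
    (p := fun 𝔟 => ∃ θ : MvPolynomial σ k →ₐ[k] B, (∀ f, π (θ f) = Ideal.Quotient.mk I f) ∧
      ∀ f ∈ I, θ f ∈ 𝔟.map (algebraMap A B)) (by
      choose c hc using fun i => hπ.surjective (Ideal.Quotient.mk I (X i))
      have h1 : π.comp (aeval c) = Ideal.Quotient.mkₐ k I := algHom_ext fun i => by
        rw [AlgHom.comp_apply, aeval_X, hc]
        rfl
      refine ⟨aeval c, DFunLike.congr_fun h1, fun f hf => ?_⟩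
      rw [← hπ.ker_eq, RingHom.mem_ker]
      exact (DFunLike.congr_fun h1 f).trans (Ideal.Quotient.eq_zero_iff_mem.2 hf)) (by
      rintro 𝔟 t h𝔟 htm ht hmt ⟨θ, hθ, hI⟩
      obtain ⟨h, hh⟩ := hπ.exists_obstruction ht θ hθ hI
      have hN : h ∈ LinearMap.range (tangentToNormal I) := by
        have := hT (Submodule.span _ {Submodule.Quotient.mk h}) fun p hp => by
          by_contra hp'
          obtain ⟨g, hgp, hg⟩ := hloc p hp'
          obtain ⟨R, _, _, _, _, _, ϖ, l, h1, hlA, hϖl⟩ := hg.exists_algHom_tensorProduct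
          obtain ⟨n, hn⟩ := hπ.exists_pow_smul_mem_range (g := g) (R := R)
            hk hm h𝔟 htm ht hmt θ hθ hI hh h1 hlA hϖl
          rw [Module.mem_support_iff'] at hp
          obtain ⟨⟨m, hmem⟩, hm'⟩ := hp
          refine hm' (π g ^ n) (fun hmem' => hgp (p.2.mem_of_pow_mem n hmem')) (Subtype.ext ?_)
          obtain ⟨r, rfl⟩ := Submodule.mem_span_singleton.1 hmem
          change π g ^ n • r • (Submodule.Quotient.mk h : TangentOne I) = 0
          rw [smul_comm, ← Submodule.Quotient.mk_smul, (Submodule.Quotient.mk_eq_zero _).2 hn,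
            smul_zero]
        rw [Submodule.span_singleton_eq_bot] at this
        exact (Submodule.Quotient.mk_eq_zero _).1 this
      obtain ⟨a, ha⟩ := hN
      exact hπ.exists_lift htm hmt θ hθ hI a fun f β hβ => by rw [ha, hh f β hβ]) ⊥ bot_le
  exact hπ.isTrivialDeformation_of_section hk hm
    (Ideal.Quotient.liftₐ I θ fun f hf => by simpa using hI f hf) fun x => by
      obtain ⟨f, rfl⟩ := Ideal.Quotient.mk_surjective x
      exact hθ f

end Triviality

theorem IsLocalRing.exists_sub_algebraMap_mem_maximalIdeal (k A : Type*) [Field k] [IsAlgClosed k]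
    [CommRing A] [IsLocalRing A] [Algebra k A] [Module.Finite k A] (a : A) :
    ∃ c : k, a - algebraMap k A c ∈ IsLocalRing.maximalIdeal A := by
  have : Module.Finite k (IsLocalRing.ResidueField A) := Module.Finite.of_surjective
    (IsScalarTower.toAlgHom k A (IsLocalRing.ResidueField A)).toLinearMap
    IsLocalRing.residue_surjective
  obtain ⟨c, hc⟩ := (IsAlgClosed.algebraMap_bijective_of_isIntegral
    (k := k) (K := IsLocalRing.ResidueField A)).2 (IsLocalRing.residue A a)
  refine ⟨c, ?_⟩
  rw [← IsLocalRing.residue_eq_zero_iff, map_sub, sub_eq_zero, ← hc]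
  rfl

end

theorem mainTheorem4 {V : Type*} [AddCommGroup V] [Module ℂ V] (hV : Module.finrank ℂ V = 4)
    (ω : LinearMap.BilinForm ℂ V) (hω : ω.IsAlt) (hω' : ω.Nondegenerate)
    {ι : Type*} [Fintype ι] (b : Module.Basis ι ℂ (skewAdjointLieSubalgebra ω)) :
    IsPureOfDim (SquareZeroRing b) (TangentOne (squareZeroIdeal b)) 4 ∧
    (∀ N : Submodule (SquareZeroRing b) (TangentOne (squareZeroIdeal b)),
      Module.support (SquareZeroRing b) N ⊆
        PrimeSpectrum.zeroLocus (originIdeal b : Set (SquareZeroRing b)) → N = ⊥) ∧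
    (∀ (A : Type*) [CommRing A] [IsLocalRing A] [Algebra ℂ A] [Module.Finite ℂ A]
      (B : Type*) [CommRing B] [Algebra ℂ B] [Algebra A B] [IsScalarTower ℂ A B]
      (π : B →ₐ[ℂ] SquareZeroRing b),
      IsDeformation A π → IsLocallyTrivialAwayFrom A π (originIdeal b) →
        IsTrivialDeformation A π) := by
  classical
  obtain ⟨d, hd⟩ := exists_symplectic_basis hV hω hω'
  have h := isPairPresentation_squareZeroIdeal hω hω' b d hd
  have hT := fun N hN => h.eq_bot_of_support_subset
    (not_originIdeal_le b h fun s => ⟨_, rfl⟩) N hN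
  refine ⟨h.isPureOfDim_tangentOne, hT, ?_⟩
  intro A _ _ _ _ B _ _ _ _ π hπ hloc
  have := IsArtinianRing.of_finite ℂ A
  have := h.isDomain
  exact hπ.isTrivialDeformation_of_isLocallyTrivialAwayFrom
    (IsLocalRing.exists_sub_algebraMap_mem_maximalIdeal ℂ A)
    (IsLocalRing.jacobson_eq_maximalIdeal (⊥ : Ideal A) bot_ne_top ▸
      IsArtinianRing.isNilpotent_jacobson_bot) hT hloc
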